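/- Let $\Sigma$ be a finite alphabet. All languages below are languages over $\Sigma$, $\lambda$ is the empty word, and all sets of nonterminals, states, pushdown symbols, productions and transitions are finite. **Controlled state grammars.** A state grammar has disjoint sets $V$ (nonterminals), $\Sigma$ (terminals) and $Q$ (states), an initial nonterminal $S\in V$, an initial state $q_0\in Q$, a set $F\subseteq Q$ of final states, and productions $(q,A)\to(p,z)$ with $q,p\in Q$, $A\in V$, $z\in(V\cup\Sigma)^*$; such a production rewrites $(q,uAv)$ to $(p,uzv)$. It is a *controlled state grammar* if $V=V_1\cup V_2$ is a disjoint union with $S\in V_1$ and $V_2\neq\emptyset$, and $z\in V_2^*$ for every production $(q,A)\to(p,z)$ with $A\in V_2$. A production for $A\in V_1$ may be applied only to the leftmost nonterminal of $V_1$ in the sentential form (nonterminals of $V_2$ may precede it); a production for $A\in V_2$ may be applied to any occurrence of $A$. The generated language is the set of $w\in\Sigma^*$ for which there is a derivation from $(q_0,S)$ to $(f,w)$ with $f\in F$ such that, for every $C\in V_2$, once a production $(q,C)\to(p,z)$ with no $C$ in $z$ has been applied, no later applied production has $C$ in its right-hand side. The grammar is *linear* (CLGS), respectively *right-linear* (CRLGS),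 if for every production $(q,A)\to(p,z)$ with $A\in V_1$, deleting all symbols of $V_2$ from $z$ gives a word of $\Sigma^*V_1\Sigma^*\cup\Sigma^*$, respectively of $\Sigma^*V_1\cup\Sigma^*$. **Grammars with monotonic counters.** These have $k$ counters and productions $A\to(c_1,\dots,c_k,z)$ with $c_j\in\{0,1\}$ and $z\in(V\cup\Sigma)^*$; applying one rewrites an occurrence of $A$ by $z$ and adds $c_j$ to counter $j$. The language is $\{w\in\Sigma^*: (0,\dots,0,S)\Rightarrow^*(n,\dots,n,w)\text{ for some }n\ge 0\}$. The grammar is an LG-MC (RLG-MC) if always $z\in\Sigma^*V\Sigma^*\cup\Sigma^*$ ($z\in\Sigma^*V\cup\Sigma^*$). **State grammars with reversal-bounded counters.** These have $k$ counters with values in $\mathbb N$, initially $0$, and productions $(q,i_1,\dots,i_k,A)\to(p,l_1,\dots,l_k,z)$ with $i_j\in\{0,1\}$, $l_j\in\{-1,0,1\}$ and $z\in(V\cup\Sigma)^*$, applicable in state $q$ to an occurrence of $A$ if for each $j$ counter $j$ is zero when $i_j=0$ and positive when $i_j=1$; counter $j$ changes by $l_j$. For some $r$, in every derivation from $(q_0,0,\dots,0,S)$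 every counter switches at most $r$ times between increasing and decreasing. The language consists of the $w\in\Sigma^*$ such that some $(f,c_1,\dots,c_k,w)$ with $f\in F$ is derivable. The grammar is an LG-SC (RLG-SC) if always $z\in\Sigma^*V\Sigma^*\cup\Sigma^*$ ($z\in\Sigma^*V\cup\Sigma^*$). **Machines.** An NCM is a one-way nondeterministic finite automaton, with $\lambda$-moves, with $k$ counters that are tested and changed as above and are $r$-reversal-bounded in every computation, for some $k$ and $r$. An NPCM(1) has in addition a pushdown that is $1$-reversal-bounded: in every computation, once it has popped it never pushes again. Acceptance is by final state after the whole input has been read. Write $\mathcal L(X)$ for the family of languages over $\Sigma$ defined by the devices of type $X$. Then 1. $\mathcal L(\mathrm{CLGS})=\mathcal L(\mathrm{NPCM}(1))=\mathcal L(\mathrm{LG\text{-}MC})=\mathcal L(\mathrm{LG\text{-}SC})$. 2. $\mathcal L(\mathrm{CRLGS})=\mathcal L(\mathrm{NCM})=\mathcal L(\mathrm{RLG\text{-}MC})=\mathcal L(\mathrm{RLG\text{-}SC})$. Moreover, $\mathcal L(\mathrm{CRLGS})$ and $\mathcal L(\mathrm{RLG\text{-}MC})$ also equal $\mathcal L(\mathrm{NCM})$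 if in their definitions $\Sigma^*V_1\cup\Sigma^*$ and $\Sigma^*V\cup\Sigma^*$ are replaced by $V_1\Sigma^*\cup\Sigma^*$ and $V\Sigma^*\cup\Sigma^*$. -/

import Mathlib

/-! ### Runs, reversals and shapes of right-hand sides -/

/-- `LabelledRun step ls s t`: one can pass from `s` to `t` by successive steps whose labels are,
in order, the entries of the list `ls`. -/
inductive LabelledRun {S L : Type} (step : L → S → S → Prop) : List L → S → S → Prop
  | nil (s : S) : LabelledRun step [] s s
  | cons {l : L} {ls : List L} {s t u : S} (h : step l s t) (hs : LabelledRun step ls t u) :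
      LabelledRun step (l :: ls) s u

/-- The number of switches between increasing and decreasing in a sequence of changes
`-1`, `0`, `+1` of a counter (changes by `0` do not count). -/
def numReversals (l : List SignType) : ℕ :=
  ((l.filter (· ≠ 0)).destutter (· ≠ ·)).length - 1

section Shapes

variable {T N : Type}

/-- The word `w`, over the terminals and the nonterminals, consists of terminals only. -/
def IsTerminalWord (w : List (Symbol T N)) : Prop :=
  ∃ x : List T, w = x.map Symbol.terminal

/-- `w ∈ Σ* N Σ* ∪ Σ*`. -/
def IsLinearWord (w : List (Symbol T N)) : Prop :=
  IsTerminalWord w ∨ ∃ (x : List T) (A : N) (y : List T),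
    w = x.map Symbol.terminal ++ [Symbol.nonterminal A] ++ y.map Symbol.terminal

/-- `w ∈ Σ* N ∪ Σ*`. -/
def IsRightLinearWord (w : List (Symbol T N)) : Prop :=
  IsTerminalWord w ∨ ∃ (x : List T) (A : N),
    w = x.map Symbol.terminal ++ [Symbol.nonterminal A]

/-- `w ∈ N Σ* ∪ Σ*`. -/
def IsLeftLinearWord (w : List (Symbol T N)) : Prop :=
  IsTerminalWord w ∨ ∃ (A : N) (y : List T),
    w = [Symbol.nonterminal A] ++ y.map Symbol.terminal

end Shapes

/-! ### Controlled state grammars -/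

/-- A production `(src, lhs) → (tgt, rhs)` of a state grammar with terminals `T`,
nonterminals `N` and states `Q`. -/
structure StateRule (T N Q : Type) where
  src : Q
  lhs : N
  tgt : Q
  rhs : List (Symbol T N)

/-- A controlled state grammar over the terminal alphabet `T`: a state grammar whose set of
nonterminals is the disjoint union of `V₁` and a nonempty set `V₂`, with the initial nonterminal
in `V₁`, in which every nonterminal of `V₂` is rewritten to a word over `V₂`. -/
structure ControlledStateGrammar (T : Type) where
  V₁ : Type
  V₂ : Type
  Q : Type
  finite_V₁ : Finite V₁
  finite_V₂ : Finite V₂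
  finite_Q : Finite Q
  nonempty_V₂ : Nonempty V₂
  start : V₁
  init : Q
  final : Set Q
  rules : Set (StateRule T (V₁ ⊕ V₂) Q)
  finite_rules : rules.Finite
  control : ∀ r ∈ rules, ∀ C : V₂, r.lhs = Sum.inr C →
    ∃ z : List V₂, r.rhs = z.map fun D => Symbol.nonterminal (Sum.inr D)

/-- Keep a terminal or a nonterminal of `V₁`, drop a nonterminal of `V₂`. -/
def keepUncontrolled {T V₁ V₂ : Type} : Symbol T (V₁ ⊕ V₂) → Option (Symbol T V₁)
  | Symbol.terminal a => some (Symbol.terminal a)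
  | Symbol.nonterminal (Sum.inl A) => some (Symbol.nonterminal A)
  | Symbol.nonterminal (Sum.inr _) => none

/-- The word obtained by deleting all symbols of `V₂`. -/
def deleteControl {T V₁ V₂ : Type} (w : List (Symbol T (V₁ ⊕ V₂))) : List (Symbol T V₁) :=
  w.filterMap keepUncontrolled

namespace ControlledStateGrammar

variable {T : Type} (G : ControlledStateGrammar T)

/-- Rewriting of sentential forms by the rule `r`. A nonterminal of `V₁` is rewritten only where
no nonterminal of `V₁` stands to its left; a nonterminal of `V₂` is rewritten anywhere. -/
def Step (r : StateRule T (G.V₁ ⊕ G.V₂) G.Q)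
    (s t : G.Q × List (Symbol T (G.V₁ ⊕ G.V₂))) : Prop :=
  r ∈ G.rules ∧ s.1 = r.src ∧ t.1 = r.tgt ∧
    ∃ u v : List (Symbol T (G.V₁ ⊕ G.V₂)),
      s.2 = u ++ [Symbol.nonterminal r.lhs] ++ v ∧ t.2 = u ++ r.rhs ++ v ∧
      ((∃ A : G.V₁, r.lhs = Sum.inl A) →
        ∀ B : G.V₁, Symbol.nonterminal (Sum.inl B) ∉ u)

/-- In the sequence `rs` of applied rules, once a rule has rewritten a `C ∈ V₂` to a word without
`C`, no later rule has `C` on its right-hand side. -/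
def ErasureRespecting (rs : List (StateRule T (G.V₁ ⊕ G.V₂) G.Q)) : Prop :=
  rs.Pairwise fun r r' => ∀ C : G.V₂, r.lhs = Sum.inr C →
    Symbol.nonterminal (Sum.inr C) ∉ r.rhs → Symbol.nonterminal (Sum.inr C) ∉ r'.rhs

/-- The generated language. -/
def language : Language T :=
  {w | ∃ (rs : List (StateRule T (G.V₁ ⊕ G.V₂) G.Q)) (f : G.Q), f ∈ G.final ∧
    LabelledRun G.Step rs (G.init, [Symbol.nonterminal (Sum.inl G.start)])
      (f, w.map Symbol.terminal) ∧
    G.ErasureRespecting rs}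

/-- After deletion of `V₂`, the rules for `V₁` have right-hand sides in `Σ* V₁ Σ* ∪ Σ*`. -/
def IsLinear : Prop :=
  ∀ r ∈ G.rules, ∀ A : G.V₁, r.lhs = Sum.inl A → IsLinearWord (deleteControl r.rhs)

/-- After deletion of `V₂`, the rules for `V₁` have right-hand sides in `Σ* V₁ ∪ Σ*`. -/
def IsRightLinear : Prop :=
  ∀ r ∈ G.rules, ∀ A : G.V₁, r.lhs = Sum.inl A → IsRightLinearWord (deleteControl r.rhs)

/-- After deletion of `V₂`, the rules for `V₁` have right-hand sides in `V₁ Σ* ∪ Σ*`. -/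
def IsLeftLinear : Prop :=
  ∀ r ∈ G.rules, ∀ A : G.V₁, r.lhs = Sum.inl A → IsLeftLinearWord (deleteControl r.rhs)

end ControlledStateGrammar

/-! ### Grammars with monotonic counters -/

/-- A production `lhs → (inc 1, …, inc k, rhs)`, where `inc j = true` stands for `+1` and
`inc j = false` for `0`. -/
structure MonotonicRule (T N : Type) (k : ℕ) where
  lhs : N
  inc : Fin k → Bool
  rhs : List (Symbol T N)

/-- A context-free grammar with `k` monotonic counters. -/
structure MonotonicCounterGrammar (T : Type) where
  V : Type
  k : ℕ
  finite_V : Finite V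
  start : V
  rules : Set (MonotonicRule T V k)
  finite_rules : rules.Finite

namespace MonotonicCounterGrammar

variable {T : Type} (G : MonotonicCounterGrammar T)

/-- Rewriting of a sentential form with counter values. -/
def Step (r : MonotonicRule T G.V G.k)
    (s t : (Fin G.k → ℕ) × List (Symbol T G.V)) : Prop :=
  r ∈ G.rules ∧ (∀ j, t.1 j = s.1 j + (r.inc j).toNat) ∧
    ∃ u v : List (Symbol T G.V),
      s.2 = u ++ [Symbol.nonterminal r.lhs] ++ v ∧ t.2 = u ++ r.rhs ++ v

/-- The generated language: at the end all counters have the same value. -/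
def language : Language T :=
  {w | ∃ (rs : List (MonotonicRule T G.V G.k)) (n : ℕ),
    LabelledRun G.Step rs (fun _ => 0, [Symbol.nonterminal G.start])
      (fun _ => n, w.map Symbol.terminal)}

def IsLinear : Prop := ∀ r ∈ G.rules, IsLinearWord r.rhs

def IsRightLinear : Prop := ∀ r ∈ G.rules, IsRightLinearWord r.rhs

def IsLeftLinear : Prop := ∀ r ∈ G.rules, IsLeftLinearWord r.rhs

end MonotonicCounterGrammar

/-! ### State grammars with reversal-bounded counters -/

/-- A production `(src, test 1, …, test k, lhs) → (tgt, delta 1, …, delta k, rhs)`;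
`test j = true` requires counter `j` to be positive, `test j = false` requires it to be zero. -/
structure CounterStateRule (T N Q : Type) (k : ℕ) where
  src : Q
  test : Fin k → Bool
  lhs : N
  tgt : Q
  delta : Fin k → SignType
  rhs : List (Symbol T N)

/-- A state grammar with `k` counters. -/
structure CounterStateGrammar (T : Type) where
  V : Type
  Q : Type
  k : ℕ
  finite_V : Finite V
  finite_Q : Finite Q
  start : V
  init : Q
  final : Set Q
  rules : Set (CounterStateRule T V Q k)
  finite_rules : rules.Finite

namespace CounterStateGrammar

variable {T : Type} (G : CounterStateGrammar T)

/-- Rewriting of any nonterminal of a sentential form with state and counter values. -/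
def Step (r : CounterStateRule T G.V G.Q G.k)
    (s t : G.Q × (Fin G.k → ℕ) × List (Symbol T G.V)) : Prop :=
  r ∈ G.rules ∧ s.1 = r.src ∧ t.1 = r.tgt ∧
    (∀ j, r.test j = true ↔ 0 < s.2.1 j) ∧
    (∀ j, (t.2.1 j : ℤ) = (s.2.1 j : ℤ) + (r.delta j : ℤ)) ∧
    ∃ u v : List (Symbol T G.V),
      s.2.2 = u ++ [Symbol.nonterminal r.lhs] ++ v ∧ t.2.2 = u ++ r.rhs ++ v

/-- The initial sentential form; all counters are zero. -/
def initial : G.Q × (Fin G.k → ℕ) × List (Symbol T G.V) :=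
  (G.init, fun _ => 0, [Symbol.nonterminal G.start])

/-- For some `b`, no counter makes more than `b` reversals in any derivation. -/
def IsReversalBounded : Prop :=
  ∃ b : ℕ, ∀ rs s, LabelledRun G.Step rs G.initial s →
    ∀ j, numReversals (rs.map fun r => r.delta j) ≤ b

/-- The generated language; the final values of the counters are arbitrary. -/
def language : Language T :=
  {w | ∃ (rs : List (CounterStateRule T G.V G.Q G.k)) (f : G.Q) (c : Fin G.k → ℕ),
    f ∈ G.final ∧ LabelledRun G.Step rs G.initial (f, c, w.map Symbol.terminal)}

def IsLinear : Prop := ∀ r ∈ G.rules, IsLinearWord r.rhs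

def IsRightLinear : Prop := ∀ r ∈ G.rules, IsRightLinearWord r.rhs

end CounterStateGrammar

/-! ### Counter machines -/

/-- A transition of a one-way nondeterministic machine with `k` counters. `read = none` leaves
the input alone; the tests and changes of the counters are as in `CounterStateRule`. -/
structure CounterTransition (T Q : Type) (k : ℕ) where
  src : Q
  read : Option T
  test : Fin k → Bool
  tgt : Q
  delta : Fin k → SignType

/-- A one-way nondeterministic finite automaton with `k` counters. -/
structure CounterMachine (T : Type) where
  Q : Type
  k : ℕ
  finite_Q : Finite Q
  init : Q
  final : Set Q
  transitions : Set (CounterTransition T Q k)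
  finite_transitions : transitions.Finite

namespace CounterMachine

variable {T : Type} (M : CounterMachine T)

/-- A move between configurations (state, unread input, counter values). -/
def Step (τ : CounterTransition T M.Q M.k)
    (s t : M.Q × List T × (Fin M.k → ℕ)) : Prop :=
  τ ∈ M.transitions ∧ s.1 = τ.src ∧ t.1 = τ.tgt ∧
    s.2.1 = τ.read.toList ++ t.2.1 ∧
    (∀ j, τ.test j = true ↔ 0 < s.2.2 j) ∧
    (∀ j, (t.2.2 j : ℤ) = (s.2.2 j : ℤ) + (τ.delta j : ℤ))

/-- The initial configuration on input `w`; all counters are zero. -/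
def initial (w : List T) : M.Q × List T × (Fin M.k → ℕ) := (M.init, w, fun _ => 0)

/-- For some `b`, no counter makes more than `b` reversals in any computation. -/
def IsReversalBounded : Prop :=
  ∃ b : ℕ, ∀ w τs s, LabelledRun M.Step τs (M.initial w) s →
    ∀ j, numReversals (τs.map fun τ => τ.delta j) ≤ b

/-- The accepted language: the input is read completely and a final state is reached. -/
def language : Language T :=
  {w | ∃ (τs : List (CounterTransition T M.Q M.k)) (f : M.Q) (c : Fin M.k → ℕ),
    f ∈ M.final ∧ LabelledRun M.Step τs (M.initial w) (f, [], c)}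

end CounterMachine

/-! ### Pushdown counter machines -/

/-- A transition of a one-way nondeterministic pushdown automaton with `k` counters: the topmost
pushdown symbol `top` is replaced by the word `push`, whose first letter becomes the new top. -/
structure PushdownCounterTransition (T Q Γ : Type) (k : ℕ) where
  src : Q
  read : Option T
  top : Γ
  test : Fin k → Bool
  tgt : Q
  push : List Γ
  delta : Fin k → SignType

/-- A one-way nondeterministic pushdown automaton with `k` counters. -/
structure PushdownCounterMachine (T : Type) where
  Q : Type
  Γ : Type
  k : ℕ
  finite_Q : Finite Q
  finite_Γ : Finite Γ
  init : Q
  bottom : Γ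
  final : Set Q
  transitions : Set (PushdownCounterTransition T Q Γ k)
  finite_transitions : transitions.Finite

namespace PushdownCounterMachine

variable {T : Type} (M : PushdownCounterMachine T)

/-- A move between configurations (state, unread input, counter values, pushdown). -/
def Step (τ : PushdownCounterTransition T M.Q M.Γ M.k)
    (s t : M.Q × List T × (Fin M.k → ℕ) × List M.Γ) : Prop :=
  τ ∈ M.transitions ∧ s.1 = τ.src ∧ t.1 = τ.tgt ∧
    s.2.1 = τ.read.toList ++ t.2.1 ∧
    (∀ j, τ.test j = true ↔ 0 < s.2.2.1 j) ∧
    (∀ j, (t.2.2.1 j : ℤ) = (s.2.2.1 j : ℤ) + (τ.delta j : ℤ)) ∧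
    ∃ γ : List M.Γ, s.2.2.2 = τ.top :: γ ∧ t.2.2.2 = τ.push ++ γ

/-- The initial configuration on input `w`; all counters are zero. -/
def initial (w : List T) : M.Q × List T × (Fin M.k → ℕ) × List M.Γ :=
  (M.init, w, fun _ => 0, [M.bottom])

/-- For some `b`, no counter makes more than `b` reversals in any computation. -/
def IsReversalBounded : Prop :=
  ∃ b : ℕ, ∀ w τs s, LabelledRun M.Step τs (M.initial w) s →
    ∀ j, numReversals (τs.map fun τ => τ.delta j) ≤ b

/-- In every computation, after a move that pops (lowers the height of the pushdown) there is no
move that pushes (raises it). -/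
def IsOneReversalPushdown : Prop :=
  ∀ w τs s, LabelledRun M.Step τs (M.initial w) s →
    τs.Pairwise fun τ τ' => τ.push.length < 1 → ¬ 1 < τ'.push.length

/-- The accepted language: the input is read completely and a final state is reached. -/
def language : Language T :=
  {w | ∃ (τs : List (PushdownCounterTransition T M.Q M.Γ M.k)) (f : M.Q)
      (c : Fin M.k → ℕ) (γ : List M.Γ),
    f ∈ M.final ∧ LabelledRun M.Step τs (M.initial w) (f, [], c, γ)}

end PushdownCounterMachine

/-! ### Families of languages over the alphabet `T` -/

/-- Languages of linear controlled state grammars. -/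
def familyCLGS (T : Type) : Set (Language T) :=
  {L | ∃ G : ControlledStateGrammar T, G.IsLinear ∧ G.language = L}

/-- Languages of right-linear controlled state grammars. -/
def familyCRLGS (T : Type) : Set (Language T) :=
  {L | ∃ G : ControlledStateGrammar T, G.IsRightLinear ∧ G.language = L}

/-- Languages of controlled state grammars with rules of the mirrored right-linear shape. -/
def familyCRLGSMirror (T : Type) : Set (Language T) :=
  {L | ∃ G : ControlledStateGrammar T, G.IsLeftLinear ∧ G.language = L}

/-- Languages of linear grammars with monotonic counters. -/
def familyLGMC (T : Type) : Set (Language T) :=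
  {L | ∃ G : MonotonicCounterGrammar T, G.IsLinear ∧ G.language = L}

/-- Languages of right-linear grammars with monotonic counters. -/
def familyRLGMC (T : Type) : Set (Language T) :=
  {L | ∃ G : MonotonicCounterGrammar T, G.IsRightLinear ∧ G.language = L}

/-- Languages of grammars with monotonic counters and rules of the mirrored right-linear shape. -/
def familyRLGMCMirror (T : Type) : Set (Language T) :=
  {L | ∃ G : MonotonicCounterGrammar T, G.IsLeftLinear ∧ G.language = L}

/-- Languages of linear state grammars with reversal-bounded counters. -/
def familyLGSC (T : Type) : Set (Language T) :=
  {L | ∃ G : CounterStateGrammar T, G.IsReversalBounded ∧ G.IsLinear ∧ G.language = L}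

/-- Languages of right-linear state grammars with reversal-bounded counters. -/
def familyRLGSC (T : Type) : Set (Language T) :=
  {L | ∃ G : CounterStateGrammar T, G.IsReversalBounded ∧ G.IsRightLinear ∧ G.language = L}

/-- Languages of nondeterministic machines with reversal-bounded counters. -/
def familyNCM (T : Type) : Set (Language T) :=
  {L | ∃ M : CounterMachine T, M.IsReversalBounded ∧ M.language = L}

/-- Languages of nondeterministic machines with reversal-bounded counters and a pushdown that is
`1`-reversal-bounded. -/
def familyNPCM1 (T : Type) : Set (Language T) :=
  {L | ∃ M : PushdownCounterMachine T,
    M.IsReversalBounded ∧ M.IsOneReversalPushdown ∧ M.language = L}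

/-! ### Labelled runs -/

namespace LabelledRun

variable {S S' L M : Type}

/-! Every device is compared with one normal form: a finite graph whose edges emit a word on the
left and a word on the right of a gap (`LinearGraph`), together with a commutative side condition.
In `familyWeighted` the edges carry integer vectors, and every coordinate of the total must be zero
or must be positive, as the last vertex prescribes. In `familyMonotone` there are counters that grow
by `0` or `1` and must agree at the end. The `Shape` of the emitted words is preserved throughout,
so the linear, right-linear and left-linear grammars are treated at once. Each family lies in
`familyWeighted` and contains `familyMonotone` for its shape; `familyWeighted_subset_familyMonotone`
closes the circle.

Into weights. A reversal-bounded counter runs through boundedly many stretches on which it is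
monotone and either stays zero or stays positive. The kinds of the stretches are guessed in advance,
and weights record the value of the counter at both ends of each. Checking these values once, at the
very end, suffices: by monotonicity correct ends force correct tests in between (`stretch_sound`,
`stretch_complete`). A pushdown with one reversal is removed by following the part of a computation
before the turn forwards and the part after it backwards at the same time, which is how a linear
grammar grows (`PushdownGraph.twoSided_language`). In a controlled grammar only the numbers of the
symbols of `V₂` matter. The erasure condition makes each number first nondecreasing, then
nonincreasing, so reaching zero at the end already guarantees that every applied rule found its
symbol (`ControlledStateGrammar.phaseGraph_sound`).

From weights to monotone counters. A weight is the difference of two counters, edges are split into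
elementary actions, and positivity is reduced to equality by removing at least one unit at the end
(`LinearGraph.splitGraph_language`).

Out of monotone counters. Equality of counters is verified by decrementing all of them
simultaneously down to zero, or, in a controlled grammar, by erasing symbols in rounds that take one
symbol of each counter. The mirrored grammars are reached by reversing all edges
(`LinearGraph.reverse_monotoneLanguage`). -/

theorem append {step : L → S → S → Prop} {l₁ l₂ : List L} {a b c : S}
    (h₁ : LabelledRun step l₁ a b) (h₂ : LabelledRun step l₂ b c) :
    LabelledRun step (l₁ ++ l₂) a c := by
  induction h₁ with
  | nil => exact h₂
  | cons h _ ih => exact .cons h (ih h₂)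

theorem single {step : L → S → S → Prop} {l : L} {a b : S} (h : step l a b) :
    LabelledRun step [l] a b := .cons h (.nil _)

theorem invariant {step : L → S → S → Prop} {P : S → Prop}
    (h : ∀ l s t, step l s t → P s → P t) {ls : List L} {a b : S}
    (hr : LabelledRun step ls a b) (ha : P a) : P b := by
  induction hr with
  | nil => exact ha
  | cons hs _ ih => exact ih (h _ _ _ hs ha)

theorem with_invariant {step : L → S → S → Prop} {P : S → Prop}
    (h : ∀ l s t, step l s t → P s → P t) {ls : List L} {a b : S}
    (hr : LabelledRun step ls a b) (ha : P a) :
    LabelledRun (fun l s t => P s ∧ step l s t) ls a b := by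
  induction hr with
  | nil => exact .nil _
  | cons hs _ ih => exact .cons ⟨ha, hs⟩ (ih (h _ _ _ hs ha))

theorem mono {step : L → S → S → Prop} {step' : M → S' → S' → Prop} {f : L → M} {g : S → S'}
    (h : ∀ l s t, step l s t → step' (f l) (g s) (g t)) {ls : List L} {a b : S}
    (hr : LabelledRun step ls a b) : LabelledRun step' (ls.map f) (g a) (g b) := by
  induction hr with
  | nil => exact .nil _
  | cons hs _ ih => exact .cons (h _ _ _ hs) ih

/-- One step may be matched by several steps or by none, so an auxiliary phase of one device can be
absorbed into a single configuration of the other. -/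
theorem simulate {step : L → S → S → Prop} {step' : M → S' → S' → Prop} {R : S → S' → Prop}
    (h : ∀ l s t s', step l s t → R s s' → ∃ ls' t', LabelledRun step' ls' s' t' ∧ R t t')
    {ls : List L} {a b : S} {a' : S'} (hr : LabelledRun step ls a b) (ha : R a a') :
    ∃ ls' b', LabelledRun step' ls' a' b' ∧ R b b' := by
  induction hr generalizing a' with
  | nil => exact ⟨[], a', .nil _, ha⟩
  | cons hs _ ih =>
    obtain ⟨ls₁, t', h₁, ht⟩ := h _ _ _ _ hs ha
    obtain ⟨ls₂, b', h₂, hb⟩ := ih ht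
    exact ⟨ls₁ ++ ls₂, b', h₁.append h₂, hb⟩

theorem reflTransGen {step : L → S → S → Prop} {R : S' → S' → Prop} {g : S → S'}
    (h : ∀ l s t, step l s t → Relation.ReflTransGen R (g s) (g t)) {ls : List L} {a b : S}
    (hr : LabelledRun step ls a b) : Relation.ReflTransGen R (g a) (g b) := by
  induction hr with
  | nil => exact .refl
  | cons hs _ ih => exact (h _ _ _ hs).trans ih

theorem exists_of_reflTransGen {step : L → S → S → Prop} {a b : S}
    (h : Relation.ReflTransGen (fun s t => ∃ l, step l s t) a b) :
    ∃ ls, LabelledRun step ls a b := by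
  induction h with
  | refl => exact ⟨[], .nil _⟩
  | tail _ h ih =>
    obtain ⟨ls, hls⟩ := ih
    obtain ⟨l, hl⟩ := h
    exact ⟨ls ++ [l], hls.append (.single hl)⟩

/-- The components of a product share nothing but the labels. This separates control from counters
and recombines them after the counters have been treated. -/
theorem prod_iff {step₁ : L → S → S → Prop} {step₂ : M → S' → S' → Prop} {f : L → M}
    {ls : List L} {a b : S × S'} :
    LabelledRun (fun l p q => step₁ l p.1 q.1 ∧ step₂ (f l) p.2 q.2) ls a b ↔
      LabelledRun step₁ ls a.1 b.1 ∧ LabelledRun step₂ (ls.map f) a.2 b.2 := by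
  constructor
  · intro h
    induction h with
    | nil => exact ⟨.nil _, .nil _⟩
    | cons h _ ih => exact ⟨.cons h.1 ih.1, .cons h.2 ih.2⟩
  · obtain ⟨a₁, a₂⟩ := a
    obtain ⟨b₁, b₂⟩ := b
    rintro ⟨h₁, h₂⟩
    simp only at h₁ h₂
    induction h₁ generalizing a₂ with
    | nil => cases h₂; exact .nil _
    | cons h _ ih =>
      cases h₂ with
      | cons h' hs' => exact .cons (t := (_, _)) ⟨h, h'⟩ (ih _ hs')

theorem pi_iff {J : Type} {step : J → M → S → S → Prop} {f : J → L → M}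
    {ls : List L} {a b : J → S} :
    LabelledRun (fun l p q => ∀ j, step j (f j l) (p j) (q j)) ls a b ↔
      ∀ j, LabelledRun (step j) (ls.map (f j)) (a j) (b j) := by
  constructor
  · intro h j
    induction h with
    | nil => exact .nil _
    | cons h _ ih => exact .cons (h j) ih
  · intro h
    induction ls generalizing a with
    | nil =>
      have : a = b := by
        funext j
        have := h j
        generalize a j = x at this
        generalize b j = y at this
        cases this
        rfl
      exact this ▸ .nil _
    | cons l ls ih =>
      have : ∀ j, ∃ x, step j (f j l) (a j) x ∧ LabelledRun (step j) (ls.map (f j)) x (b j) := by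
        intro j
        have := h j
        generalize a j = x at this
        generalize b j = y at this
        cases this with
        | cons h₁ h₂ => exact ⟨_, h₁, h₂⟩
      choose x hx hx' using this
      exact .cons hx (ih hx')

end LabelledRun

/-! ### Switches of direction -/

/-- The number of switches of direction in a sequence of changes, when the last direction before
it was `d`. -/
def switches : SignType → List SignType → ℕ
  | _, [] => 0
  | d, e :: l => if e = 0 ∨ e = d then switches d l else switches e l + 1

theorem switches_filter (d : SignType) (l : List SignType) :
    switches d (l.filter (· ≠ 0)) = switches d l := by
  induction l generalizing d with
  | nil => rfl
  | cons e l ih =>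
    by_cases he : e = 0
    · simp [he, switches, ← ih]
    · simp only [ne_eq, decide_not] at ih
      simp [he, switches, ih]

theorem length_destutter' (d : SignType) (l : List SignType) (h : ∀ e ∈ l, e ≠ 0) :
    (l.destutter' (· ≠ ·) d).length = switches d l + 1 := by
  induction l generalizing d with
  | nil => rfl
  | cons e l ih =>
    have he : e ≠ 0 := h e (by simp)
    have hl : ∀ e ∈ l, e ≠ 0 := fun x hx => h x (by simp [hx])
    rw [List.destutter'_cons, switches]
    by_cases hd : e = d
    · simp only [hd, ne_eq, not_true_eq_false, if_false, or_true, if_true]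
      exact ih d hl
    · rw [if_pos (Ne.symm hd), if_neg (by simp [he, hd])]
      simp [ih e hl]

/-- The remembered direction matters only up to the first nonzero change; from there on both counts
agree. -/
theorem switches_le_switches_succ (d e : SignType) (l : List SignType) :
    switches d l ≤ switches e l + 1 := by
  induction l with
  | nil => simp [switches]
  | cons x l ih =>
    simp only [switches]
    split_ifs <;> first | omega | (simp_all; try omega)

/-- Only the first nonzero change is compared with `d`, which accounts for the one extra switch. -/
theorem switches_le (d : SignType) (l : List SignType) : switches d l ≤ numReversals l + 1 := by
  rw [← switches_filter, numReversals]
  have hl : ∀ e ∈ l.filter (· ≠ 0), e ≠ 0 := by simp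
  cases h : l.filter (· ≠ 0) with
  | nil => simp [switches]
  | cons e l' =>
    rw [h] at hl
    rw [List.destutter_cons', length_destutter' e l' fun x hx => hl x (by simp [hx])]
    have := switches_le_switches_succ d e l'
    simp only [switches]
    split_ifs <;> omega

theorem numReversals_le (d : SignType) (l : List SignType) : numReversals l ≤ switches d l := by
  rw [← switches_filter, numReversals]
  have hl : ∀ e ∈ l.filter (· ≠ 0), e ≠ 0 := by simp
  cases h : l.filter (· ≠ 0) with
  | nil => simp
  | cons e l' =>
    rw [h] at hl
    rw [List.destutter_cons', length_destutter' e l' fun x hx => hl x (by simp [hx])]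
    simp only [switches]
    split_ifs with hc
    · rcases hc with hc | hc
      · exact absurd hc (hl e (by simp))
      · simp [hc]
    · omega

/-- A counter that only increases before the predicate `P` holds, and only decreases once it
holds, makes at most one reversal. -/
theorem LabelledRun.numReversals_le_one {S L : Type} {step : L → S → S → Prop} (P : S → Prop)
    (δ : L → SignType) (h₁ : ∀ l s t, step l s t → P s → P t ∧ δ l ≤ 0)
    (h₂ : ∀ l s t, step l s t → ¬ P s → 0 ≤ δ l) {ls : List L} {a b : S}
    (hr : LabelledRun step ls a b) : numReversals (ls.map δ) ≤ 1 := by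
  have key : ∀ x : SignType, x ≤ 0 → x = 0 ∨ x = -1 := by decide
  have key' : ∀ x : SignType, 0 ≤ x → x = 0 ∨ x = 1 := by decide
  -- Once `P` holds, all changes are `0` or `-1`, so with remembered direction `-1` nothing counts
  -- as a switch.
  have down : ∀ {ls : List L} {a b : S}, LabelledRun step ls a b → P a →
      switches (-1) (ls.map δ) = 0 := by
    intro ls a b hr ha
    induction hr with
    | nil => rfl
    | cons h _ ih =>
      rw [List.map_cons, switches, if_pos (key _ (h₁ _ _ _ h ha).2), ih (h₁ _ _ _ h ha).1]
  refine (numReversals_le 1 _).trans ?_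
  induction hr with
  | nil => simp [switches]
  | @cons l ls s t u h hs ih =>
    by_cases ha : P s
    · have h0 := down (.cons h hs) ha
      exact (switches_le_switches_succ 1 (-1) _).trans (by omega)
    · rw [List.map_cons, switches, if_pos (key' _ (h₂ _ _ _ h ha))]
      exact ih

/-! ### Elimination of tests of reversal-bounded counters -/

/-- The integer `z` is positive if `b = true`, and zero if `b = false`. -/
def Meets (b : Bool) (z : ℤ) : Prop := if b then 0 < z else z = 0

/-- A step of a counter on a letter consisting of a test and a change. -/
def CounterStep (l : Bool × SignType) (c c' : ℕ) : Prop :=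
  (l.1 = true ↔ 0 < c) ∧ (c' : ℤ) = (c : ℤ) + (l.2 : ℤ)

/-- `y` is reached from `x` by moving in the direction `h`. -/
def Toward (h : SignType) (x y : ℤ) : Prop := (h = 1 ∧ x ≤ y) ∨ (h = -1 ∧ y ≤ x) ∨ x = y

theorem Toward.trans {h : SignType} {x y z : ℤ} (h₁ : Toward h x y) (h₂ : Toward h y z) :
    Toward h x z := by
  rcases h₁ with ⟨rfl, h₁⟩ | ⟨rfl, h₁⟩ | rfl <;> rcases h₂ with ⟨h, h₂⟩ | ⟨h, h₂⟩ | rfl <;>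
    first | exact absurd h (by decide) | (simp_all [Toward]; done) | (simp [Toward]; omega)

/-- `{0}` and the set of positive integers are convex, and `y` lies between `x` and `z`. -/
theorem Toward.meets {h : SignType} {g : Bool} {x y z : ℤ} (h₁ : Toward h x y)
    (h₂ : Toward h y z) (hx : Meets g x) (hz : Meets g z) : Meets g y := by
  unfold Meets at *
  rcases h₁ with ⟨rfl, h₁⟩ | ⟨rfl, h₁⟩ | rfl
  · rcases h₂ with ⟨h, h₂⟩ | ⟨h, h₂⟩ | rfl
    · cases g <;> simp_all <;> omega
    · exact absurd h (by decide)
    · exact hz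
  · rcases h₂ with ⟨h, h₂⟩ | ⟨h, h₂⟩ | rfl
    · exact absurd h (by decide)
    · cases g <;> simp_all <;> omega
    · exact hz
  · exact hx

/-- The contribution of a change `δ`, made when passing from stretch `m` to stretch `m'`, to the
values of the counter at the beginning (`false`) and the end (`true`) of every stretch. -/
def stretchWt {B : ℕ} (m m' : Fin B) (δ : SignType) (p : Fin B × Bool) : ℤ :=
  if (if p.2 then m' ≤ p.1 else m < p.1) then (δ : ℤ) else 0

/-- A step of a counter whose computation is divided into stretches. In stretch `i` the counter is
positive or zero as given by `(D i).1`, and it moves in the direction `(D i).2`. -/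
def StretchStep {B : ℕ} (D : Fin B → Bool × SignType) (l : Bool × SignType)
    (s t : Fin B × (Fin B × Bool → ℤ)) : Prop :=
  l.1 = (D s.1).1 ∧
    ((t.1 = s.1 ∧ (l.2 = 0 ∨ l.2 = (D s.1).2)) ∨ (t.1 : ℕ) = s.1 + 1) ∧
    t.2 = s.2 + stretchWt s.1 t.1 l.2

theorem toward_add {h δ : SignType} (hδ : δ = 0 ∨ δ = h) (x : ℤ) : Toward h x (x + (δ : ℤ)) := by
  rcases hδ with rfl | rfl
  · simp [Toward]
  · cases δ <;> simp [Toward]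

/-- A step made in stretch `m` touches no coordinate of an earlier stretch, nor the start value of
`m`, and the index never goes back. Hence the start value of the current stretch is already
definitive, while its end value can still move, but only in the prescribed direction. -/
theorem stretch_frozen {B : ℕ} {D : Fin B → Bool × SignType} {ls : List (Bool × SignType)}
    {s t : Fin B × (Fin B × Bool → ℤ)} (hr : LabelledRun (StretchStep D) ls s t) :
    (∀ i < s.1, ∀ b, t.2 (i, b) = s.2 (i, b)) ∧ t.2 (s.1, false) = s.2 (s.1, false) ∧
      Toward (D s.1).2 (s.2 (s.1, true)) (t.2 (s.1, true)) := by
  induction hr with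
  | nil => exact ⟨fun _ _ _ => rfl, rfl, .inr (.inr rfl)⟩
  | @cons l ls s t u h _ ih =>
    obtain ⟨-, h, hw⟩ := h
    obtain ⟨ih₁, ih₂, ih₃⟩ := ih
    rcases h with ⟨hm, hδ⟩ | hm
    · rw [hm] at ih₁ ih₂ ih₃
      rw [hw, hm] at ih₁ ih₂ ih₃
      refine ⟨fun i hi b => ?_, ?_, ?_⟩
      · rw [ih₁ i hi b]
        cases b <;> simp [stretchWt, not_le.mpr hi, hi.le]
      · simp [ih₂, stretchWt]
      · refine Toward.trans ?_ ih₃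
        simpa [stretchWt] using toward_add hδ _
    -- The change made on leaving a stretch is credited to the next one, so the end value of the
    -- stretch that is left remains as it was.
    · have hlt : s.1 < t.1 := Fin.lt_def.mpr (by omega)
      rw [hw] at ih₁
      refine ⟨fun i hi b => ?_, ?_, ?_⟩
      · rw [ih₁ i (hi.trans hlt) b]
        cases b <;> simp [stretchWt, not_le.mpr (hi.trans hlt), hi.le]
      · rw [ih₁ s.1 hlt]
        simp [stretchWt]
      · rw [ih₁ s.1 hlt]
        simp [stretchWt, not_le.mpr hlt, Toward]

/-- Coordinates not yet frozen, apart from the start of the current stretch, carry the current value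
`c`. This `c` lies between the recorded start of the stretch and the end that will finally be
recorded; both have the prescribed sign and the motion is monotone, so the guessed test is correct.
In particular no value is negative, and the integers come from natural numbers. -/
theorem stretch_sound {B : ℕ} {D : Fin B → Bool × SignType} {ls : List (Bool × SignType)}
    {s t : Fin B × (Fin B × Bool → ℤ)} (hr : LabelledRun (StretchStep D) ls s t)
    (ht : ∀ i b, Meets (D i).1 (t.2 (i, b))) (c : ℤ) (hc : ∀ i ≥ s.1, s.2 (i, true) = c)
    (hc' : ∀ i > s.1, s.2 (i, false) = c) (hs : Meets (D s.1).1 (s.2 (s.1, false)))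
    (hs' : Toward (D s.1).2 (s.2 (s.1, false)) c) :
    ∃ n n' : ℕ, (n : ℤ) = c ∧ LabelledRun CounterStep ls n n' := by
  induction hr generalizing c with
  | nil s =>
    have := ht s.1 true
    rw [hc _ le_rfl] at this
    refine ⟨c.toNat, _, Int.toNat_of_nonneg ?_, .nil _⟩
    unfold Meets at this
    split_ifs at this <;> omega
  | @cons l ls s t u h hr ih =>
    have hfr := (stretch_frozen (.cons h hr)).2.2
    rw [hc _ le_rfl] at hfr
    have hm := hs'.meets hfr hs (ht _ _)
    obtain ⟨hl, h, hw⟩ := h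
    have : ∃ n n' : ℕ, (n : ℤ) = c + (l.2 : ℤ) ∧ LabelledRun CounterStep ls n n' := by
      rcases h with ⟨htm, hδ⟩ | htm
      · apply ih ht
        · intro i hi
          rw [htm] at hi
          rw [hw, Pi.add_apply, hc i hi]
          simp [stretchWt, htm, hi.le]
        · intro i hi
          rw [htm] at hi
          rw [hw, Pi.add_apply, hc' i hi]
          simp [stretchWt, hi]
        · simpa [htm, hw, stretchWt] using hs
        · simpa [htm, hw, stretchWt] using hs'.trans (toward_add hδ c)
      · have hlt : s.1 < t.1 := Fin.lt_def.mpr (by omega)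
        -- The start coordinate of a stretch follows the counter until the stretch is entered, the
        -- entering step included.
        have e : t.2 (t.1, false) = c + (l.2 : ℤ) := by
          rw [hw, Pi.add_apply, hc' _ hlt]
          simp [stretchWt, hlt]
        apply ih ht
        · intro i hi
          rw [hw, Pi.add_apply, hc i (hlt.le.trans hi)]
          simp [stretchWt, hi.le]
        · intro i hi
          rw [hw, Pi.add_apply, hc' i (hlt.trans hi)]
          simp [stretchWt, hlt.trans hi]
        · rw [← (stretch_frozen hr).2.1]
          exact ht _ _
        · rw [e]
          exact .inr (.inr rfl)
    obtain ⟨n, n', hn, hrun⟩ := this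
    have hc0 : 0 ≤ c := by unfold Meets at hm; split_ifs at hm <;> omega
    refine ⟨c.toNat, n', Int.toNat_of_nonneg hc0, .cons ⟨?_, ?_⟩ hrun⟩
    · rw [hl]
      unfold Meets at hm
      split_ifs at hm with hg
      · simp [hg, hm]
      · simp [hg, hm]
    · rw [hn, Int.toNat_of_nonneg hc0]

/-- Since the index never goes back, the guess for earlier stretches may be altered afterwards. This
allows `stretch_complete` to build `D` from the last stretch to the first. -/
theorem LabelledRun.stretch_congr {B : ℕ} {D D' : Fin B → Bool × SignType}
    {ls : List (Bool × SignType)} {s t : Fin B × (Fin B × Bool → ℤ)}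
    (hr : LabelledRun (StretchStep D) ls s t) (h : ∀ i ≥ s.1, D i = D' i) :
    LabelledRun (StretchStep D') ls s t := by
  induction hr with
  | nil => exact .nil _
  | @cons l ls s t u hst _ ih =>
    have hle : s.1 ≤ t.1 := by
      rcases hst.2.1 with ⟨e, -⟩ | e
      · exact e.ge
      · exact Fin.le_def.mpr (by omega)
    refine .cons ?_ (ih fun i hi => h i (hle.trans hi))
    unfold StretchStep at hst ⊢
    rwa [← h s.1 le_rfl]

/-- Whether a counter with value `n` moving in direction `d` may still pass between zero and
positive values. -/
def mayCross (d : SignType) (n : ℕ) : ℕ :=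
  if (d = 1 ∧ n = 0) ∨ (d = -1 ∧ 0 < n) then 1 else 0

theorem meets_natCast (n : ℕ) : Meets (decide (0 < n)) (n : ℤ) := by
  unfold Meets
  split_ifs with h <;> simp_all

/-- A new stretch begins when the counter turns or passes between zero and positive values. In a
fixed direction such a passage happens at most once, hence the budget: two stretches per turn, and
`mayCross` for the present direction. `D` is determined before `W`, because in the recursion the
tail starts from values recorded by the head. -/
theorem stretch_complete {B : ℕ} {ls : List (Bool × SignType)} {n n' : ℕ}
    (hr : LabelledRun CounterStep ls n n') (d : SignType) (hd : d ≠ 0) (m : Fin B)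
    (hm : m + 2 * switches d (ls.map Prod.snd) + mayCross d n < B) :
    ∃ D : Fin B → Bool × SignType, D m = (decide (0 < n), d) ∧
      ∀ W : Fin B × Bool → ℤ, (∀ i ≥ m, W (i, true) = n) → (∀ i > m, W (i, false) = n) →
        Meets (decide (0 < n)) (W (m, false)) →
        ∃ t, LabelledRun (StretchStep D) ls (m, W) t ∧
          ∀ i ≥ m, ∀ b, Meets (D i).1 (t.2 (i, b)) := by
  induction hr generalizing d m with
  | nil n =>
    -- Stretches that are never entered have start and end value `n`, so they are given the sign of
    -- `n`.
    refine ⟨fun _ => (decide (0 < n), d), rfl, fun W h₁ h₂ h₃ => ⟨_, .nil _, fun i hi b => ?_⟩⟩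
    cases b
    · rcases eq_or_lt_of_le hi with rfl | hi
      · exact h₃
      · simp only [h₂ i hi]
        exact meets_natCast n
    · simp only [h₁ i hi]
      exact meets_natCast n
  | @cons l ls n c n' h _ ih =>
    obtain ⟨hl, hc⟩ := h
    obtain ⟨t, δ⟩ := l
    simp only at hl hc
    have ht : t = decide (0 < n) := by simp [← hl]
    simp only [List.map_cons] at hm
    by_cases hstay : (δ = 0 ∨ δ = d) ∧ decide (0 < c) = decide (0 < n)
    · obtain ⟨hδ, hpos⟩ := hstay
      have hcr : mayCross d c ≤ mayCross d n := by
        have : 0 < c ↔ 0 < n := by simpa using hpos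
        have : c = 0 ↔ n = 0 := by omega
        simp [mayCross, *]
      rw [switches, if_pos hδ] at hm
      obtain ⟨D, hD, hD'⟩ := ih d hd m (by omega)
      refine ⟨D, by rw [hD, hpos], fun W h₁ h₂ h₃ => ?_⟩
      obtain ⟨t', hrun, ht'⟩ := hD' (W + stretchWt m m δ)
        (fun i hi => by simp [stretchWt, h₁ i hi, hi.le, hc])
        (fun i hi => by simp [stretchWt, h₂ i hi, hi, hc])
        (by simpa [stretchWt, hpos] using h₃)
      refine ⟨t', .cons (t := (m, W + stretchWt m m δ)) ⟨?_, .inl ⟨rfl, ?_⟩, rfl⟩ hrun, ht'⟩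
      · simp [hD, hpos, ht]
      · simpa [hD] using hδ
    -- Without a turn the stretch is ended by a crossing, which uses up `mayCross`. A turn frees two
    -- units: one for the new stretch, one for a possible crossing in the new direction.
    · obtain ⟨d', hd', hjump⟩ : ∃ d' : SignType, d' ≠ 0 ∧
          m + 1 + 2 * switches d' (ls.map Prod.snd) + mayCross d' c < B := by
        have hle : ∀ d, mayCross d c ≤ 1 := fun d => by unfold mayCross; split_ifs <;> omega
        by_cases hδ : δ = 0 ∨ δ = d
        · refine ⟨d, hd, ?_⟩
          have hne : ¬ (0 < c ↔ 0 < n) := by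
            intro h
            exact hstay ⟨hδ, by simpa using h⟩
          rw [switches, if_pos hδ] at hm
          rcases hδ with rfl | rfl
          · simp at hc
            omega
          · have : mayCross δ n = 1 ∧ mayCross δ c = 0 := by
              cases δ
              · exact absurd rfl hd
              · simp [mayCross] at hc ⊢
                omega
              · simp [mayCross] at hc ⊢
                omega
            omega
        · rw [switches, if_neg hδ] at hm
          refine ⟨δ, fun h => hδ (.inl h), ?_⟩
          have := hle δ
          omega
      obtain ⟨D, hD, hD'⟩ := ih d' hd' ⟨m + 1, by omega⟩ (by simpa using hjump)
      set m' : Fin B := ⟨m + 1, by omega⟩ with hm'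
      have hlt : m < m' := Fin.lt_def.mpr (by simp [hm'])
      refine ⟨Function.update D m (decide (0 < n), d), by simp, fun W h₁ h₂ h₃ => ?_⟩
      have e : (W + stretchWt m m' δ) (m', false) = c := by
        simp [h₂ _ hlt, stretchWt, hlt, hc]
      obtain ⟨t', hrun, ht'⟩ := hD' (W + stretchWt m m' δ)
        (fun i hi => by
          have hi : m' ≤ i := hi
          simp [stretchWt, h₁ i (hlt.le.trans hi), hi, hc])
        (fun i hi => by
          have hi : m' < i := hi
          simp [stretchWt, h₂ i (hlt.trans hi), hlt.trans hi, hc])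
        (e ▸ meets_natCast c)
      have hfr := (stretch_frozen hrun).1 m hlt
      refine ⟨t', .cons (t := (m', W + stretchWt m m' δ)) ⟨?_, .inr rfl, rfl⟩
        (hrun.stretch_congr fun i hi => ?_), ?_⟩
      · simp [ht]
      · rw [Function.update_of_ne (hlt.trans_le hi).ne']
      · intro i hi b
        rcases eq_or_lt_of_le hi with rfl | hi
        · rw [hfr b, Function.update_self]
          cases b
          · simpa [stretchWt] using h₃
          · simp only [Pi.add_apply, h₁ _ le_rfl, stretchWt, if_true, not_le.mpr hlt, if_false,
              add_zero]
            exact meets_natCast n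
        · rw [Function.update_of_ne hi.ne']
          exact ht' i (Fin.le_def.mpr (by simpa [hm'] using hi)) b

/-- A step of `k` counters on a letter consisting of tests and changes. -/
def CountersStep {k : ℕ} (l : (Fin k → Bool) × (Fin k → SignType)) (c c' : Fin k → ℕ) : Prop :=
  (∀ j, l.1 j = true ↔ 0 < c j) ∧ ∀ j, (c' j : ℤ) = (c j : ℤ) + (l.2 j : ℤ)

/-- A step of `k` counters whose computations are divided into stretches. -/
def StretchesStep {k B : ℕ} (D : Fin k → Fin B → Bool × SignType)
    (l : (Fin k → Bool) × (Fin k → SignType))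
    (s t : (Fin k → Fin B) × (Fin k × Fin B × Bool → ℤ)) : Prop :=
  ∀ j, StretchStep (D j) (l.1 j, l.2 j) (s.1 j, fun p => s.2 (j, p)) (t.1 j, fun p => t.2 (j, p))

theorem LabelledRun.counters_iff {k : ℕ} {ls : List ((Fin k → Bool) × (Fin k → SignType))}
    {c c' : Fin k → ℕ} : LabelledRun CountersStep ls c c' ↔
      ∀ j, LabelledRun CounterStep (ls.map fun l => (l.1 j, l.2 j)) (c j) (c' j) := by
  rw [← LabelledRun.pi_iff (step := fun _ => CounterStep)]
  have : @CountersStep k = fun l a b => ∀ j, CounterStep (l.1 j, l.2 j) (a j) (b j) := by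
    funext l a b
    simp [CountersStep, CounterStep, forall_and]
  rw [this]

theorem stretches_complete {k b : ℕ} {ls : List ((Fin k → Bool) × (Fin k → SignType))}
    {c : Fin k → ℕ} (hr : LabelledRun CountersStep ls (fun _ => 0) c)
    (hb : ∀ j, numReversals (ls.map fun l => l.2 j) ≤ b) :
    ∃ (D : Fin k → Fin (2 * b + 4) → Bool × SignType) (t : _ × (_ → ℤ)),
      LabelledRun (StretchesStep D) ls (fun _ => 0, 0) t ∧
        ∀ j i b, Meets (D j i).1 (t.2 (j, i, b)) := by
  rw [LabelledRun.counters_iff] at hr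
  have : ∀ j, ∃ (D : Fin (2 * b + 4) → Bool × SignType) (t : _ × (_ → ℤ)),
      LabelledRun (StretchStep D) (ls.map fun l => (l.1 j, l.2 j)) (0, 0) t ∧
        ∀ i b, Meets (D i).1 (t.2 (i, b)) := by
    intro j
    -- The assumed initial direction `1` may add a switch to the `b` reversals, and the initial
    -- value `0` allows one crossing: `2 * (b + 1) + 1 < 2 * b + 4`.
    have hlt : ((0 : Fin (2 * b + 4)) : ℕ) + 2 * switches 1 (((ls.map fun l =>
        (l.1 j, l.2 j))).map Prod.snd) + mayCross 1 0 < 2 * b + 4 := by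
      have := (switches_le 1 (ls.map fun l => l.2 j)).trans (Nat.succ_le_succ (hb j))
      rw [List.map_map]
      have h₂ : mayCross 1 0 = 1 := by simp [mayCross]
      rw [h₂]
      have e : (Prod.snd ∘ fun l : (Fin k → Bool) × (Fin k → SignType) => (l.1 j, l.2 j)) =
        fun l => l.2 j := rfl
      rw [e]
      simp only [Fin.val_zero]
      omega
    obtain ⟨D, -, hD⟩ := stretch_complete (hr j) 1 (by decide) 0 hlt
    obtain ⟨t, ht, ht'⟩ := hD 0 (by simp) (by simp) (by simp [Meets])
    exact ⟨D, t, ht, fun i b => ht' i (Fin.zero_le i) b⟩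
  choose D t ht ht' using this
  refine ⟨D, (fun j => (t j).1, fun p => (t p.1).2 p.2), ?_, fun j i b => ht' j i b⟩
  have := LabelledRun.pi_iff (J := Fin k)
    (f := fun j (l : (Fin k → Bool) × (Fin k → SignType)) => (l.1 j, l.2 j))
    (step := fun j => StretchStep (D j)) (a := fun _ => (0, 0)) (b := t) |>.mpr ht
  have := this.mono (step' := StretchesStep D) (f := id)
    (g := fun s : Fin k → _ × (_ → ℤ) => (fun j => (s j).1, fun p => (s p.1).2 p.2))
    fun l s t h => h
  rw [List.map_id] at this
  exact this

theorem stretches_sound {k B : ℕ} [NeZero B] {ls : List ((Fin k → Bool) × (Fin k → SignType))}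
    {D : Fin k → Fin B → Bool × SignType} {t : (Fin k → Fin B) × (Fin k × Fin B × Bool → ℤ)}
    (hr : LabelledRun (StretchesStep D) ls (fun _ => 0, 0) t)
    (ht : ∀ j i b, Meets (D j i).1 (t.2 (j, i, b))) :
    ∃ c, LabelledRun CountersStep ls (fun _ => 0) c := by
  have h₁ := hr.mono (f := id)
    (step' := fun (l : (Fin k → Bool) × (Fin k → SignType))
      (p q : Fin k → Fin B × (Fin B × Bool → ℤ)) =>
      ∀ j, StretchStep (D j) (l.1 j, l.2 j) (p j) (q j))
    (g := fun (s : (Fin k → Fin B) × (Fin k × Fin B × Bool → ℤ)) j =>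
      (s.1 j, fun p => s.2 (j, p))) fun l s t h => h
  rw [List.map_id, LabelledRun.pi_iff (J := Fin k)
    (f := fun j (l : (Fin k → Bool) × (Fin k → SignType)) => (l.1 j, l.2 j))
    (step := fun j => StretchStep (D j))] at h₁
  have h₂ : ∀ j, ∃ c, LabelledRun CounterStep (ls.map fun l => (l.1 j, l.2 j)) 0 c := by
    intro j
    -- The start value of stretch `0` is frozen from the beginning, so its final constraint says
    -- that `0` has the guessed sign.
    have hf : t.2 (j, 0, false) = 0 := (stretch_frozen (h₁ j)).2.1
    have h0 : Meets (D j 0).1 0 := hf ▸ ht j 0 false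
    obtain ⟨n, n', hn, hrun⟩ := stretch_sound (h₁ j) (ht j) 0 (by simp) (by simp) h0
      (.inr (.inr rfl))
    obtain rfl : n = 0 := by exact_mod_cast hn
    exact ⟨n', hrun⟩
  choose c hc using h₂
  exact ⟨c, LabelledRun.counters_iff.mpr hc⟩

/-! ### Two-sided automata -/

/-- The three shapes of linear right-hand sides. -/
inductive Shape
  | linear
  | rightLinear
  | leftLinear

/-- The terminal words that may stand to the left and to the right of the nonterminal. -/
def Shape.Allows {T : Type} : Shape → List T → List T → Prop
  | .linear, _, _ => True
  | .rightLinear, _, y => y = []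
  | .leftLinear, x, _ => x = []

/-- A finite graph whose edges emit a word on the left and a word on the right. -/
structure LinearGraph (T : Type) where
  V : Type
  E : Type
  finite_V : Finite V
  finite_E : Finite E
  init : Set V
  final : Set V
  src : E → V
  tgt : E → V
  left : E → List T
  right : E → List T

namespace LinearGraph

attribute [instance] finite_V finite_E

variable {T : Type} (G : LinearGraph T)

/-- Following the edge `e`: words on the left grow to the right, those on the right grow to the
left. -/
def Step (e : G.E) (s t : G.V × List T × List T) : Prop :=
  s.1 = G.src e ∧ t.1 = G.tgt e ∧ t.2.1 = s.2.1 ++ G.left e ∧ t.2.2 = G.right e ++ s.2.2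

def HasShape (s : Shape) : Prop := ∀ e, s.Allows (G.left e) (G.right e)

def WeightedStep {ι : Type} (wt : G.E → ι → ℤ) (e : G.E)
    (s t : (G.V × List T × List T) × (ι → ℤ)) : Prop :=
  G.Step e s.1 t.1 ∧ t.2 = s.2 + wt e

/-- The words emitted by runs whose weights meet the constraint belonging to the last vertex. -/
def weightedLanguage {ι : Type} (wt : G.E → ι → ℤ) (con : G.V → ι → Bool) : Language T :=
  {w | ∃ es, ∃ i ∈ G.init, ∃ f ∈ G.final, ∃ X Y W, w = X ++ Y ∧
    LabelledRun (G.WeightedStep wt) es ((i, [], []), 0) ((f, X, Y), W) ∧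
    ∀ j, Meets (con f j) (W j)}

def CounterStep {k : ℕ} (lab : G.E → (Fin k → Bool) × (Fin k → SignType)) (e : G.E)
    (s t : (G.V × List T × List T) × (Fin k → ℕ)) : Prop :=
  G.Step e s.1 t.1 ∧ CountersStep (lab e) s.2 t.2

def counterLanguage {k : ℕ} (lab : G.E → (Fin k → Bool) × (Fin k → SignType)) : Language T :=
  {w | ∃ es, ∃ i ∈ G.init, ∃ f ∈ G.final, ∃ X Y c, w = X ++ Y ∧
    LabelledRun (G.CounterStep lab) es ((i, [], []), fun _ => 0) ((f, X, Y), c)}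

def MonotoneStep {k : ℕ} (inc : G.E → Fin k → Bool) (e : G.E)
    (s t : (G.V × List T × List T) × (Fin k → ℕ)) : Prop :=
  G.Step e s.1 t.1 ∧ ∀ j, t.2 j = s.2 j + (inc e j).toNat

/-- The words emitted by runs at the end of which all counters are equal. -/
def monotoneLanguage {k : ℕ} (inc : G.E → Fin k → Bool) : Language T :=
  {w | ∃ es, ∃ i ∈ G.init, ∃ f ∈ G.final, ∃ X Y, ∃ n : ℕ, w = X ++ Y ∧
    LabelledRun (G.MonotoneStep inc) es ((i, [], []), fun _ => 0) ((f, X, Y), fun _ => n)}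

end LinearGraph

/-- Languages of two-sided automata with integer weights. -/
def familyWeighted (T : Type) (s : Shape) : Set (Language T) :=
  {L | ∃ (G : LinearGraph T) (ι : Type) (_ : Finite ι) (wt : G.E → ι → ℤ) (con : G.V → ι → Bool),
    G.HasShape s ∧ G.weightedLanguage wt con = L}

/-- Languages of two-sided automata with monotone counters that emit single letters. -/
def familyMonotone (T : Type) (s : Shape) : Set (Language T) :=
  {L | ∃ (G : LinearGraph T) (k : ℕ) (inc : G.E → Fin k → Bool) (i : G.V),
    G.init = {i} ∧ (∀ e, (G.left e).length ≤ 1) ∧ (∀ e, (G.right e).length ≤ 1) ∧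
    G.HasShape s ∧ G.monotoneLanguage inc = L}

/-- The guess `D` is made by choosing the initial vertex and is carried along unchanged, next to the
current stretch of each counter. The recorded ends of stretches become weights, and the guessed
signs become the final constraints. -/
theorem LinearGraph.counterLanguage_mem_weighted {T : Type} (G : LinearGraph T) {s : Shape}
    (hs : G.HasShape s) {k : ℕ} (lab : G.E → (Fin k → Bool) × (Fin k → SignType)) (b : ℕ)
    (hb : ∀ es, ∀ i ∈ G.init, ∀ t, LabelledRun (G.CounterStep lab) es ((i, [], []), fun _ => 0) t →
      ∀ j, numReversals (es.map fun e => (lab e).2 j) ≤ b) :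
    G.counterLanguage lab ∈ familyWeighted T s := by
  let D := Fin k → Fin (2 * b + 4) → Bool × SignType
  let P := Fin k → Fin (2 * b + 4)
  let G' : LinearGraph T :=
    { V := G.V × D × P
      -- With recorded value `0` before the step, the last clause of `StretchStep` is automatic;
      -- only the conditions on the test and on the stretch indices remain.
      E := {x : G.E × D × P × P // ∀ j, StretchStep (x.2.1 j) ((lab x.1).1 j, (lab x.1).2 j)
        (x.2.2.1 j, 0) (x.2.2.2 j, stretchWt (x.2.2.1 j) (x.2.2.2 j) ((lab x.1).2 j))}
      finite_V := inferInstance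
      finite_E := inferInstance
      init := {v | v.1 ∈ G.init ∧ v.2.2 = fun _ => 0}
      final := {v | v.1 ∈ G.final}
      src := fun x => (G.src x.1.1, x.1.2.1, x.1.2.2.1)
      tgt := fun x => (G.tgt x.1.1, x.1.2.1, x.1.2.2.2)
      left := fun x => G.left x.1.1
      right := fun x => G.right x.1.1 }
  let wt : G'.E → Fin k × Fin (2 * b + 4) × Bool → ℤ := fun x p =>
    stretchWt (x.1.2.2.1 p.1) (x.1.2.2.2 p.1) ((lab x.1.1).2 p.1) p.2
  refine ⟨G', _, inferInstance, wt, fun v p => (v.2.1 p.1 p.2.1).1, fun e => hs e.1.1, ?_⟩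
  ext w
  constructor
  · rintro ⟨es, ⟨i, d, p⟩, ⟨hi, rfl⟩, ⟨f, d', p'⟩, hf, X, Y, W, rfl, hr, hW⟩
    simp only at hi
    have hinv : ∀ l s t, G'.WeightedStep wt l s t → s.1.1.2.1 = d → t.1.1.2.1 = d := by
      rintro l s t ⟨⟨h₁, h₂, -⟩, -⟩ h
      rw [h₁] at h
      rw [h₂]
      exact h
    have hd : d' = d := hr.invariant hinv rfl
    subst hd
    have h₁ := hr.mono (f := fun x => x.1.1) (g := fun s => (s.1.1.1, s.1.2)) (step' := G.Step) (by
      rintro l s t ⟨⟨h₁, h₂, h₃⟩, -⟩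
      exact ⟨by rw [h₁], by rw [h₂], h₃⟩)
    have h₂ : LabelledRun (StretchesStep d') (es.map fun x => lab x.1.1) (fun _ => 0, 0)
        (p', W) := by
      have := hr.with_invariant hinv rfl
      refine this.mono (f := fun x : G'.E => lab x.1.1) (g := fun s => (s.1.1.2.2, s.2)) ?_
      rintro ⟨⟨e, D, p, q⟩, hx⟩ ⟨⟨v, Z⟩, W₁⟩ ⟨⟨v', Z'⟩, W₂⟩ ⟨hD, ⟨h₁, h₂, -⟩, h₃⟩ j
      obtain rfl : v = (G.src e, D, p) := h₁
      obtain rfl : v' = (G.tgt e, D, q) := h₂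
      obtain rfl : D = d' := hD
      obtain rfl := h₃
      exact ⟨(hx j).1, (hx j).2.1, rfl⟩
    obtain ⟨c, hc⟩ := stretches_sound h₂ fun j i b => hW (j, i, b)
    refine ⟨es.map fun x => x.1.1, i, hi, f, hf, X, Y, c, rfl, ?_⟩
    have := LabelledRun.prod_iff (step₁ := G.Step) (step₂ := CountersStep) (f := lab)
      (a := ((i, [], []), fun _ => 0)) (b := ((f, X, Y), c)) (ls := es.map fun x => x.1.1)
    refine this.mpr ⟨h₁, ?_⟩
    rw [List.map_map]
    exact hc
  · rintro ⟨es, i, hi, f, hf, X, Y, c, rfl, hr⟩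
    have hb' := hb es i hi _ hr
    obtain ⟨h₁, h₂⟩ := (LabelledRun.prod_iff (step₁ := G.Step) (step₂ := CountersStep)
      (f := lab)).mp hr
    obtain ⟨d, ⟨p', W⟩, ht, hW⟩ := stretches_complete h₂ (b := b) (by
      intro j
      rw [List.map_map]
      exact hb' j)
    have h₃ := (LabelledRun.prod_iff (step₁ := G.Step) (step₂ := StretchesStep d)
      (f := lab) (a := ((i, [], []), (fun _ => 0, 0))) (b := ((f, X, Y), (p', W)))).mpr ⟨h₁, ht⟩
    have h₄ := h₃.reflTransGen (R := fun s t => ∃ e, G'.WeightedStep wt e s t)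
      (g := fun s => (((s.1.1, d, s.2.1), s.1.2), s.2.2)) (by
        rintro e ⟨⟨v, X, Y⟩, p, W⟩ ⟨⟨v', X', Y'⟩, p', W'⟩ ⟨⟨h₁, h₂, h₃⟩, h₄⟩
        refine .single ⟨⟨(e, d, p, p'), fun j => ?_⟩, ⟨?_, ?_, h₃⟩, ?_⟩
        · exact ⟨(h₄ j).1, (h₄ j).2.1, by simp⟩
        · simp [G', ← h₁]
        · simp [G', ← h₂]
        · funext ⟨j, q⟩
          exact congrFun (h₄ j).2.2 q)
    obtain ⟨es', hes'⟩ := LabelledRun.exists_of_reflTransGen h₄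
    exact ⟨es', (i, d, fun _ => 0), ⟨hi, rfl⟩, (f, d, p'), hf, X, Y, W, rfl, hes',
      fun q => hW q.1 q.2.1 q.2.2⟩

/-! ### Reversal of runs -/

namespace LinearGraph

variable {T : Type} (G : LinearGraph T)

/-- The graph with all edges, and their two sides, reversed. -/
def reverse : LinearGraph T where
  V := Option G.V
  E := G.E ⊕ G.final
  finite_V := inferInstance
  finite_E := inferInstance
  init := {none}
  final := {v | ∃ i ∈ G.init, v = some i}
  src := Sum.elim (fun e => some (G.tgt e)) fun _ => none
  tgt := Sum.elim (fun e => some (G.src e)) fun f => some f.1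
  left := Sum.elim G.right fun _ => []
  right := Sum.elim G.left fun _ => []

/-- The increments of the counters along the edges of the reversed graph. -/
def reverseInc {k : ℕ} (inc : G.E → Fin k → Bool) : G.reverse.E → Fin k → Bool :=
  Sum.elim inc fun _ _ => false

variable {G}

/-- Backwards, the edges are met in the opposite order and the two sides grow in opposite
directions, so `X` and `Y` themselves reappear, not their mirror images, but with sides exchanged.
-/
theorem reverse_run {k : ℕ} {inc : G.E → Fin k → Bool} {es : List G.E}
    {s t : (G.V × List T × List T) × (Fin k → ℕ)} (hr : LabelledRun (G.MonotoneStep inc) es s t) :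
    ∃ X Y c, t.1.2.1 = s.1.2.1 ++ X ∧ t.1.2.2 = Y ++ s.1.2.2 ∧ t.2 = s.2 + c ∧
      ((∀ e, G.left e = []) → X = []) ∧ ((∀ e, G.right e = []) → Y = []) ∧
      ∀ P Q d, ∃ es, LabelledRun (G.reverse.MonotoneStep (G.reverseInc inc)) es
        ((some t.1.1, P, Q), d) ((some s.1.1, P ++ Y, X ++ Q), d + c) := by
  induction hr with
  | nil s => exact ⟨[], [], 0, by simp, by simp, by simp, by simp, by simp, fun P Q d => by
      simpa using ⟨[], LabelledRun.nil _⟩⟩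
  | @cons e es s t u h _ ih =>
    obtain ⟨X, Y, c, hX, hY, hc, hX', hY', hrun⟩ := ih
    obtain ⟨⟨h₁, h₂, h₃, h₄⟩, h₅⟩ := h
    have h₅ : t.2 = s.2 + fun j => (inc e j).toNat := funext h₅
    refine ⟨G.left e ++ X, Y ++ G.right e, (fun j => (inc e j).toNat) + c, ?_, ?_, ?_, ?_, ?_, ?_⟩
    · rw [hX, h₃, List.append_assoc]
    · rw [hY, h₄, List.append_assoc]
    · rw [hc, h₅, add_assoc]
    · intro h
      simp [h e, hX' h]
    · intro h
      simp [h e, hY' h]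
    · intro P Q d
      obtain ⟨es, hes⟩ := hrun P Q d
      refine ⟨_, hes.append (.single (l := Sum.inl e) ⟨⟨?_, ?_, ?_, ?_⟩, ?_⟩)⟩
      · rw [h₂]; rfl
      · rw [h₁]; rfl
      · simp [reverse]
      · simp [reverse]
      · intro j
        simp [reverseInc]
        ring

theorem run_of_reverse_run {k : ℕ} {inc : G.E → Fin k → Bool} {es : List G.reverse.E}
    {s t : (G.reverse.V × List T × List T) × (Fin k → ℕ)}
    (hr : LabelledRun (G.reverse.MonotoneStep (G.reverseInc inc)) es s t)
    (v : G.V) (hv : s.1.1 = some v) :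
    ∃ u X Y c, t.1.1 = some u ∧ t.1.2.1 = s.1.2.1 ++ X ∧ t.1.2.2 = Y ++ s.1.2.2 ∧ t.2 = s.2 + c ∧
      ((∀ e, G.left e = []) → Y = []) ∧ ((∀ e, G.right e = []) → X = []) ∧
      ∀ P Q d, ∃ es, LabelledRun (G.MonotoneStep inc) es
        ((u, P, Q), d) ((v, P ++ Y, X ++ Q), d + c) := by
  induction hr generalizing v with
  | nil s => exact ⟨v, [], [], 0, hv, by simp, by simp, by simp, by simp, by simp, fun P Q d => by
      simpa using ⟨[], LabelledRun.nil _⟩⟩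
  | @cons e es s t w h _ ih =>
    obtain ⟨⟨h₁, h₂, h₃, h₄⟩, h₅⟩ := h
    rcases e with e | f
    · obtain ⟨u, X, Y, c, hu, hX, hY, hc, hX', hY', hrun⟩ := ih (G.src e) h₂
      have h₅ : t.2 = s.2 + fun j => (inc e j).toNat := funext h₅
      have hve : v = G.tgt e := by
        rw [h₁] at hv
        exact (Option.some.inj hv).symm
      simp only [reverse, Sum.elim_inl] at h₃ h₄
      refine ⟨u, G.right e ++ X, Y ++ G.left e, (fun j => (inc e j).toNat) + c, hu, ?_, ?_, ?_, ?_,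
        ?_, ?_⟩
      · rw [hX, h₃, List.append_assoc]
      · rw [hY, h₄, List.append_assoc]
      · rw [hc, h₅, add_assoc]
      · intro h
        simp [h e, hX' h]
      · intro h
        simp [h e, hY' h]
      · intro P Q d
        obtain ⟨es, hes⟩ := hrun P Q d
        refine ⟨es ++ [e], hes.append (.single ⟨⟨rfl, hve, ?_, ?_⟩, ?_⟩)⟩
        · simp
        · simp
        · intro j
          simp
          ring
    · rw [h₁] at hv
      simp [reverse] at hv

/-- Reversal turns an emitted word `X ++ Y` into `Y ++ X`; these agree because one of the two is
empty. -/
theorem reverse_monotoneLanguage {k : ℕ} {inc : G.E → Fin k → Bool}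
    (h : (∀ e, G.left e = []) ∨ (∀ e, G.right e = [])) :
    G.reverse.monotoneLanguage (G.reverseInc inc) = G.monotoneLanguage inc := by
  ext w
  constructor
  · rintro ⟨es, i, rfl, f, ⟨j, hj, rfl⟩, X, Y, n, rfl, hr⟩
    cases hr with
    | @cons e es s t u h₀ hr =>
      obtain ⟨⟨h₁, h₂, h₃, h₄⟩, h₅⟩ := h₀
      rcases e with e | f
      · simp [reverse] at h₁
      · obtain ⟨u, X', Y', c, hu, hX, hY, hc, hX', hY', hrun⟩ := run_of_reverse_run hr f.1 h₂
        obtain rfl : j = u := Option.some.inj hu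
        obtain ⟨es, hes⟩ := hrun [] [] 0
        have h₅ : t.2 = fun _ => 0 := funext fun j => by simpa [reverseInc] using h₅ j
        simp only [reverse, Sum.elim_inr, List.append_nil] at h₃ h₄
        obtain rfl : X = X' := by simpa [h₃] using hX
        obtain rfl : Y = Y' := by simpa [h₄] using hY
        rw [h₅] at hc
        refine ⟨es, j, hj, f.1, f.2, Y, X, n, ?_, ?_⟩
        · rcases h with h | h
          · simp [hX' h]
          · simp [hY' h]
        · obtain rfl : (fun _ => n) = c := hc.trans (zero_add c)
          simp only [List.nil_append, List.append_nil, zero_add] at hes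
          exact hes
  · rintro ⟨es, i, hi, f, hf, X, Y, n, rfl, hr⟩
    obtain ⟨X', Y', c, hX, hY, hc, hX', hY', hrun⟩ := reverse_run hr
    obtain ⟨es', hes'⟩ := hrun [] [] 0
    simp only [List.nil_append, List.append_nil] at hes' hX hY
    refine ⟨Sum.inr ⟨f, hf⟩ :: es', none, rfl, some i, ⟨i, hi, rfl⟩, Y', X', n,
      ?_, .cons (t := ((some f, [], []), fun _ => 0)) ⟨⟨rfl, rfl, rfl, rfl⟩, fun j => rfl⟩ ?_⟩
    · rcases h with h | h
      · simp [hX, hY, hX' h]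
      · simp [hX, hY, hY' h]
    · rw [show (fun _ => n) = 0 + c from hc]
      exact hes'

end LinearGraph

/-- Counter machines are compared with right-linear graphs only; the mirrored grammars reach them
through this equality. -/
theorem familyMonotone_rightLinear_eq_leftLinear (T : Type) :
    familyMonotone T .rightLinear = familyMonotone T .leftLinear := by
  apply Set.Subset.antisymm
  · rintro _ ⟨G, k, inc, i, hi, h₁, h₂, hs, rfl⟩
    refine ⟨G.reverse, k, G.reverseInc inc, none, rfl, ?_, ?_, ?_,
      LinearGraph.reverse_monotoneLanguage (.inr hs)⟩
    · rintro (e | e)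
      exacts [h₂ e, Nat.zero_le _]
    · rintro (e | e)
      exacts [h₁ e, Nat.zero_le _]
    · rintro (e | e)
      exacts [hs e, rfl]
  · rintro _ ⟨G, k, inc, i, hi, h₁, h₂, hs, rfl⟩
    refine ⟨G.reverse, k, G.reverseInc inc, none, rfl, ?_, ?_, ?_,
      LinearGraph.reverse_monotoneLanguage (.inl hs)⟩
    · rintro (e | e)
      exacts [h₂ e, Nat.zero_le _]
    · rintro (e | e)
      exacts [h₁ e, Nat.zero_le _]
    · rintro (e | e)
      exacts [hs e, rfl]

/-! ### Splitting of edges into single letters and unit increments -/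

/-- The elementary actions of which an edge is composed. -/
inductive Atom (T ι : Type)
  | left (a : T)
  | right (a : T)
  | up (j : ι)
  | down (j : ι)

namespace Atom

variable {T ι : Type}

instance [Finite T] [Finite ι] : Finite (Atom T ι) := by
  refine Finite.of_surjective (α := (T ⊕ T) ⊕ (ι ⊕ ι))
    (Sum.elim (Sum.elim left right) (Sum.elim up down)) ?_
  rintro (a | a | j | j)
  exacts [⟨.inl (.inl a), rfl⟩, ⟨.inl (.inr a), rfl⟩, ⟨.inr (.inl j), rfl⟩, ⟨.inr (.inr j), rfl⟩]

def leftWord : Atom T ι → List T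
  | left a => [a]
  | _ => []

def rightWord : Atom T ι → List T
  | right a => [a]
  | _ => []

theorem length_leftWord_le (a : Atom T ι) : a.leftWord.length ≤ 1 := by
  cases a <;> simp [leftWord]

theorem length_rightWord_le (a : Atom T ι) : a.rightWord.length ≤ 1 := by
  cases a <;> simp [rightWord]

/-- The counters increased by an action: `(j, true)` counts the increments of the weight `j`, and
`(j, false)` its decrements. -/
def inc [DecidableEq ι] : Atom T ι → ι × Bool → Bool
  | up j, p => p = (j, true)
  | down j, p => p = (j, false)
  | _, _ => false

/-- Monotone counters cannot decrease, so a weight is encoded as the excess of an increment counter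
over a decrement counter. -/
def weight [DecidableEq ι] (a : Atom T ι) (j : ι) : ℤ :=
  (a.inc (j, true)).toNat - (a.inc (j, false)).toNat

/-- The effect of a list of actions. -/
def perform [DecidableEq ι] : List (Atom T ι) → List T × List T × (ι → ℤ) →
    List T × List T × (ι → ℤ)
  | [], z => z
  | a :: p, z => perform p (z.1 ++ a.leftWord, a.rightWord ++ z.2.1, z.2.2 + a.weight)

theorem perform_append [DecidableEq ι] (p q : List (Atom T ι)) (z : List T × List T × (ι → ℤ)) :
    perform (p ++ q) z = perform q (perform p z) := by
  induction p generalizing z with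
  | nil => rfl
  | cons a p ih => exact ih _

/-- Some list of actions emits `x` on the left, `y` on the right, and adds the weight `w`. -/
def Realizes [DecidableEq ι] (s : Shape) (x y : List T) (w : ι → ℤ) : Prop :=
  ∃ p : List (Atom T ι), (∀ a ∈ p, s.Allows a.leftWord a.rightWord) ∧
    ∀ X Y W, perform p (X, Y, W) = (X ++ x, y ++ Y, W + w)

variable [DecidableEq ι] {s : Shape}

theorem Realizes.append {x y x' y' : List T} {w w' : ι → ℤ} (h : Realizes s x y w)
    (h' : Realizes s x' y' w') : Realizes s (x ++ x') (y' ++ y) (w + w') := by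
  obtain ⟨p, hp, hp'⟩ := h
  obtain ⟨q, hq, hq'⟩ := h'
  refine ⟨p ++ q, fun a ha => (List.mem_append.mp ha).elim (hp a) (hq a), fun X Y W => ?_⟩
  rw [perform_append, hp', hq']
  simp [add_assoc]

theorem realizes_atom (a : Atom T ι) (h : s.Allows a.leftWord a.rightWord) :
    Realizes s a.leftWord a.rightWord a.weight :=
  ⟨[a], by simpa using h, fun _ _ _ => rfl⟩

theorem realizes_nil : Realizes s ([] : List T) [] (0 : ι → ℤ) :=
  ⟨[], by simp, by simp [perform]⟩

theorem allows_nil (s : Shape) : s.Allows ([] : List T) [] := by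
  cases s <;> simp [Shape.Allows]

theorem realizes_left (hs : s ≠ .leftLinear) (x : List T) :
    Realizes s x [] (0 : ι → ℤ) := by
  induction x with
  | nil => exact realizes_nil
  | cons a x ih =>
    have h : Realizes s [a] [] (0 : ι → ℤ) := by
      have := realizes_atom (s := s) (left a : Atom T ι) (by
        cases s <;> simp_all [Shape.Allows, rightWord])
      have hw : (left a : Atom T ι).weight = 0 := by funext j; simp [weight, inc]
      rwa [hw] at this
    simpa using h.append ih

theorem realizes_right (hs : s ≠ .rightLinear) (y : List T) :
    Realizes s [] y (0 : ι → ℤ) := by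
  induction y with
  | nil => exact realizes_nil
  | cons a y ih =>
    have h : Realizes s [] [a] (0 : ι → ℤ) := by
      have := realizes_atom (s := s) (right a : Atom T ι) (by
        cases s <;> simp_all [Shape.Allows, leftWord])
      have hw : (right a : Atom T ι).weight = 0 := by funext j; simp [weight, inc]
      rwa [hw] at this
    simpa using ih.append h

/-- The vectors realizable without emission are closed under addition and contain the unit vectors
and their negatives. -/
theorem realizes_weight [Finite ι] (w : ι → ℤ) : Realizes s ([] : List T) [] w := by
  have hadd : ∀ {w w' : ι → ℤ}, Realizes s ([] : List T) [] w → Realizes s ([] : List T) [] w' →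
      Realizes s ([] : List T) [] (w + w') := fun h h' => by simpa using h.append h'
  have hup : ∀ j, (up j : Atom T ι).weight = Pi.single j 1 := by
    intro j
    funext i
    by_cases h : i = j <;> simp [weight, inc, h]
  have hdown : ∀ j, (down j : Atom T ι).weight = Pi.single j (-1) := by
    intro j
    funext i
    by_cases h : i = j <;> simp [weight, inc, h]
  have hsingle : ∀ (j : ι) (n : ℤ), Realizes s ([] : List T) [] (Pi.single j n) := by
    intro j n
    induction n using Int.induction_on with
    | zero => simpa using realizes_nil
    | succ n ih =>
      rw [Pi.single_add]
      exact hadd ih (hup j ▸ realizes_atom (up j) (allows_nil s))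
    | pred n ih =>
      rw [sub_eq_add_neg, Pi.single_add]
      exact hadd ih (hdown j ▸ realizes_atom (down j) (allows_nil s))
  have := Fintype.ofFinite ι
  rw [← Finset.univ_sum_single w]
  exact Finset.sum_induction _ (Realizes s ([] : List T) []) (fun _ _ => hadd) realizes_nil
    fun j _ => hsingle j _

theorem realizes [Finite ι] {x y : List T} (h : s.Allows x y) (w : ι → ℤ) : Realizes s x y w := by
  have hx : Realizes s x [] (0 : ι → ℤ) := by
    by_cases hs : s = .leftLinear
    · subst hs
      obtain rfl : x = [] := h
      exact realizes_nil
    · exact realizes_left hs x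
  have hy : Realizes s [] y (0 : ι → ℤ) := by
    by_cases hs : s = .rightLinear
    · subst hs
      obtain rfl : y = [] := h
      exact realizes_nil
    · exact realizes_right hs y
  simpa using (hx.append hy).append (realizes_weight w)

end Atom

namespace LinearGraph

open Relation

variable {T : Type} (G : LinearGraph T)

/-- Vertices of `splitGraph`: the initial vertex; a vertex together with the actions that remain
to be done; a constraint to be met. -/
abbrev SplitVertex (ι : Type) (B : ℕ) : Type :=
  Option ((G.V × {p : List (Atom T ι) // p.length ≤ B}) ⊕ (ι → Bool))

/-- Edges of `splitGraph`: entering an initial vertex; loading the actions of an edge; doing an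
action; leaving a final vertex; incrementing the counters at the end. -/
inductive SplitEdge (s : Shape) (ι : Type) (B : ℕ) : Type
  | enter (i : G.init)
  | load (e : G.E)
  | act (v : G.V) (a : Atom T ι) (ha : s.Allows a.leftWord a.rightWord)
    (p : {p : List (Atom T ι) // p.length + 1 ≤ B})
  | leave (f : G.final)
  | fill (g : ι → Bool) (j : ι) (both : Bool)

instance {α : Type} [Finite α] (B : ℕ) : Finite {p : List α // p.length ≤ B} :=
  List.finite_length_le α B

instance {s : Shape} {ι : Type} [Finite ι] [Finite T] {B : ℕ} : Finite (G.SplitEdge s ι B) := by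
  have : Finite {p : List (Atom T ι) // p.length + 1 ≤ B} :=
    Finite.of_injective (β := {p : List (Atom T ι) // p.length ≤ B})
      (fun p => ⟨p.1, by have := p.2; omega⟩) fun p q h => by
        simpa [Subtype.ext_iff] using h
  refine Finite.of_surjective (α := (G.init ⊕ G.E) ⊕ ((G.V ×
    {a : Atom T ι // s.Allows a.leftWord a.rightWord} ×
    {p : List (Atom T ι) // p.length + 1 ≤ B}) ⊕ G.final) ⊕ ((ι → Bool) × ι × Bool))
    (Sum.elim (Sum.elim .enter .load) (Sum.elim
      (Sum.elim (fun x => .act x.1 x.2.1.1 x.2.1.2 x.2.2) .leave)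
      fun x => .fill x.1 x.2.1 x.2.2)) ?_
  rintro (i | e | ⟨v, a, ha, p⟩ | f | ⟨g, j, b⟩)
  exacts [⟨.inl (.inl i), rfl⟩, ⟨.inl (.inr e), rfl⟩, ⟨.inr (.inl (.inl (v, ⟨a, ha⟩, p))), rfl⟩,
    ⟨.inr (.inl (.inr f)), rfl⟩, ⟨.inr (.inr (g, j, b)), rfl⟩]

section

variable (s : Shape) {ι : Type} {B : ℕ} (prog : G.E → {p : List (Atom T ι) // p.length ≤ B})
  (con : G.V → ι → Bool)

/-- The graph in which the edges of `G` are split into elementary actions. -/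
def splitGraph [Finite T] [Finite ι] : LinearGraph T where
  V := G.SplitVertex ι B
  E := G.SplitEdge s ι B
  finite_V := inferInstance
  finite_E := inferInstance
  init := {none}
  final := {v | ∃ g, v = some (.inr g)}
  src
    | .enter _ => none
    | .load e => some (.inl (G.src e, ⟨[], Nat.zero_le _⟩))
    | .act v a _ p => some (.inl (v, ⟨a :: p.1, p.2⟩))
    | .leave f => some (.inl (f, ⟨[], Nat.zero_le _⟩))
    | .fill g _ _ => some (.inr g)
  tgt
    | .enter i => some (.inl (i, ⟨[], Nat.zero_le _⟩))
    | .load e => some (.inl (G.tgt e, prog e))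
    | .act v _ _ p => some (.inl (v, ⟨p.1, Nat.le_of_succ_le p.2⟩))
    | .leave f => some (.inr (con f))
    | .fill g _ _ => some (.inr g)
  left
    | .act _ a _ _ => a.leftWord
    | _ => []
  right
    | .act _ a _ _ => a.rightWord
    | _ => []

variable {s} in
/-- The increments along the edges of `splitGraph`. The counters `(j, true)` and `(j, false)`
count increments and decrements of the weight `j`. -/
def splitInc [DecidableEq ι] : G.SplitEdge s ι B → ι × Bool → Bool
  | .act _ a _ _, p => a.inc p
  -- One unit is taken off every weight that has to be positive, so that afterwards it only has to
  -- be nonnegative.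
  | .leave f, p => !p.2 && con f p.1
  -- With `both`, the two counters of `j` grow together and the weight is kept. Otherwise only the
  -- decrement counter grows, and only for a weight that has to be positive.
  | .fill g j both, p => p.1 = j && (if p.2 then both else both || g j)
  | _, _ => false

variable [Finite T] [Finite ι] [DecidableEq ι] {k : ℕ} (ε : Fin k ≃ ι × Bool)

/-- The steps of `splitGraph`. -/
def SplitStep (x y : (G.SplitVertex ι B × List T × List T) × (Fin k → ℕ)) : Prop :=
  ∃ e, (G.splitGraph s prog con).MonotoneStep (fun e i => G.splitInc con e (ε i)) e x y

/-- The weight represented by the counters. -/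
def counted (n : Fin k → ℕ) (j : ι) : ℤ := (n (ε.symm (j, true)) : ℤ) - n (ε.symm (j, false))

theorem splitStep_intro {e : G.SplitEdge s ι B} {u v : G.SplitVertex ι B} {X Y X' Y' : List T}
    {n : Fin k → ℕ}
    (hu : u = (G.splitGraph s prog con).src e) (hv : v = (G.splitGraph s prog con).tgt e)
    (hX : X' = X ++ (G.splitGraph s prog con).left e)
    (hY : Y' = (G.splitGraph s prog con).right e ++ Y) :
    G.SplitStep s prog con ε ((u, X, Y), n)
      ((v, X', Y'), fun i => n i + (G.splitInc con e (ε i)).toNat) :=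
  ⟨e, ⟨hu, hv, hX, hY⟩, fun _ => rfl⟩

theorem split_perform (v : G.V) (p : List (Atom T ι)) (hp : p.length ≤ B)
    (hs : ∀ a ∈ p, s.Allows a.leftWord a.rightWord) (X Y : List T)
    (n : Fin k → ℕ) : ∃ n' : Fin k → ℕ,
      ReflTransGen (G.SplitStep s prog con ε) ((some (.inl (v, ⟨p, hp⟩)), X, Y), n)
        ((some (.inl (v, ⟨[], Nat.zero_le _⟩)), (Atom.perform p (X, Y, counted ε n)).1,
          (Atom.perform p (X, Y, counted ε n)).2.1), n') ∧
      counted ε n' = (Atom.perform p (X, Y, counted ε n)).2.2 := by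
  induction p generalizing X Y n with
  | nil => exact ⟨n, .refl, rfl⟩
  | cons a p ih =>
    have ha := hs a (by simp)
    obtain ⟨n', h, h'⟩ := ih (Nat.le_of_succ_le hp) (fun a h => hs a (by simp [h]))
      (X ++ a.leftWord) (a.rightWord ++ Y)
      fun i => n i + (G.splitInc con (.act v a ha ⟨p, hp⟩ : G.SplitEdge s ι B) (ε i)).toNat
    have hc : counted ε (fun i => n i +
          (G.splitInc con (.act v a ha ⟨p, hp⟩ : G.SplitEdge s ι B) (ε i)).toNat) =
        counted ε n + a.weight := by
      funext j
      simp [counted, splitInc, Atom.weight]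
      ring
    rw [hc] at h h'
    exact ⟨n', .head (G.splitStep_intro s prog con ε (e := .act v a ha ⟨p, hp⟩)
      rfl rfl rfl rfl) h, h'⟩

/-- As long as the two counters of `j` differ, only the decrement counter is raised; once they agree
they are raised together. Each step lowers the total deficit relative to `m`. -/
theorem split_fill (g : ι → Bool) (X Y : List T) (m N : ℕ) (n : Fin k → ℕ) (hn : ∀ i, n i ≤ m)
    (hN : ∑ i, (m - n i) = N)
    (hle : ∀ j, n (ε.symm (j, false)) ≤ n (ε.symm (j, true)))
    (heq : ∀ j, g j = false → n (ε.symm (j, false)) = n (ε.symm (j, true))) :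
    ReflTransGen (G.SplitStep s prog con ε) ((some (.inr g), X, Y), n)
      ((some (.inr g), X, Y), fun _ => m) := by
  induction N using Nat.strong_induction_on generalizing n with
  | _ N ih =>
    by_cases hall : ∀ i, n i = m
    · rw [show n = fun _ => m from funext hall]
    · push Not at hall
      obtain ⟨i, hi⟩ := hall
      -- A decrement counter never exceeds its partner, so any deficit at all yields a deficit of a
      -- decrement counter.
      obtain ⟨j, hj⟩ : ∃ j, n (ε.symm (j, false)) < m := by
        rcases h : ε i with ⟨j, b⟩
        obtain rfl : i = ε.symm (j, b) := by rw [← h, Equiv.symm_apply_apply]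
        refine ⟨j, lt_of_le_of_ne (hn _) fun h => hi ?_⟩
        have := hle j
        have := hn (ε.symm (j, true))
        cases b <;> omega
      let both : Bool := decide (n (ε.symm (j, false)) = n (ε.symm (j, true)))
      have hg : both = false → g j = true := by
        intro h
        by_contra hg
        simp [both, heq j (by simpa using hg)] at h
      have hb : both = true → n (ε.symm (j, false)) = n (ε.symm (j, true)) := by simp [both]
      have hb' : both = false → n (ε.symm (j, false)) ≠ n (ε.symm (j, true)) := by simp [both]
      have inc_true : ∀ i, G.splitInc con (.fill g j both : G.SplitEdge s ι B) (i, true) =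
          (decide (i = j) && both) := fun i => by simp [splitInc]
      have inc_false : ∀ i, G.splitInc con (.fill g j both : G.SplitEdge s ι B) (i, false) =
          decide (i = j) := by
        intro i
        cases h : both <;> simp_all [splitInc]
      clear_value both
      refine .head (G.splitStep_intro s prog con ε (e := .fill g j both) rfl rfl
        (List.append_nil _).symm rfl) ?_
      have hn' : ∀ i,
          n i + (G.splitInc con (.fill g j both : G.SplitEdge s ι B) (ε i)).toNat ≤ m := by
        intro i
        rcases h : ε i with ⟨j', b⟩
        obtain rfl : i = ε.symm (j', b) := by rw [← h, Equiv.symm_apply_apply]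
        have := hn (ε.symm (j', b))
        by_cases hjj : j' = j
        · subst hjj
          cases b
          · simp [inc_false]
            omega
          · cases both
            · simpa [inc_true] using this
            · have := hb rfl
              simp [inc_true]
              omega
        · cases b <;> simpa [inc_true, inc_false, hjj] using this
      refine ih _ ?_ _ hn' rfl ?_ ?_
      · rw [← hN]
        apply Finset.sum_lt_sum
        · intro i _
          omega
        · refine ⟨ε.symm (j, false), Finset.mem_univ _, ?_⟩
          simp [inc_false]
          omega
      · intro i
        have := hle i
        by_cases hij : i = j
        · subst hij
          cases both
          · have := hb' rfl
            simp [inc_false, inc_true]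
            omega
          · simp [inc_false, inc_true]
            omega
        · simpa [inc_false, inc_true, hij] using this
      · intro i hgi
        have := heq i hgi
        by_cases hij : i = j
        · subst hij
          cases both
          · simp [hg rfl] at hgi
          · simp [inc_false, inc_true]
            omega
        · simpa [inc_false, inc_true, hij] using this

/-- What a configuration of `splitGraph` says about runs of `G`. -/
def SplitInvariant (wt : G.E → ι → ℤ) (x : (G.SplitVertex ι B × List T × List T) × (Fin k → ℕ)) :
    Prop :=
  match x with
  | ((none, X, Y), n) => X = [] ∧ Y = [] ∧ ∀ i, n i = 0
  -- An edge counts as followed as soon as it is loaded: the run of `G` ends where the pending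
  -- actions `p` will lead.
  | ((some (.inl (v, p)), X, Y), n) => ∃ i ∈ G.init, ∃ es, LabelledRun (G.WeightedStep wt) es
      ((i, [], []), 0) ((v, (Atom.perform p.1 (X, Y, counted ε n)).1,
        (Atom.perform p.1 (X, Y, counted ε n)).2.1), (Atom.perform p.1 (X, Y, counted ε n)).2.2)
  -- At least one unit has been taken off each weight that must be positive, hence the strict
  -- inequality; the other weights are still exact.
  | ((some (.inr g), X, Y), n) => ∃ i ∈ G.init, ∃ f ∈ G.final, ∃ es W, con f = g ∧
      LabelledRun (G.WeightedStep wt) es ((i, [], []), 0) ((f, X, Y), W) ∧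
      ∀ j, if g j then counted ε n j < W j else counted ε n j = W j

variable {G prog con} in
theorem splitInvariant_step {wt : G.E → ι → ℤ}
    (hprog : ∀ e X Y W, Atom.perform (prog e).1 (X, Y, W) =
      (X ++ G.left e, G.right e ++ Y, W + wt e))
    {e : G.SplitEdge s ι B} {x y : (G.SplitVertex ι B × List T × List T) × (Fin k → ℕ)}
    (h : (G.splitGraph s prog con).MonotoneStep (fun e i => G.splitInc con e (ε i)) e x y)
    (hs : G.SplitInvariant con ε wt x) : G.SplitInvariant con ε wt y := by
  obtain ⟨⟨u, X, Y⟩, n⟩ := x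
  obtain ⟨⟨v, X', Y'⟩, n'⟩ := y
  obtain ⟨⟨h₁, h₂, h₃, h₄⟩, h₅⟩ := h
  simp only at h₁ h₂ h₃ h₄ h₅
  obtain rfl : n' = _ := funext h₅
  subst h₁ h₂ h₃ h₄
  rcases e with i | e | ⟨v, a, ha, p⟩ | f | ⟨g, j, both⟩
  · obtain ⟨rfl, rfl, hn⟩ := hs
    refine ⟨i, i.2, [], ?_⟩
    have : counted ε (fun j => n j +
        (G.splitInc con (.enter i : G.SplitEdge s ι B) (ε j)).toNat) =
        0 := by
      funext j
      simp [counted, hn, splitInc]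
    rw [this]
    exact .nil _
  · obtain ⟨i, hi, es, hes⟩ := hs
    refine ⟨i, hi, es ++ [e], hes.append (.single ⟨⟨rfl, rfl, ?_, ?_⟩, ?_⟩)⟩
    · simp [hprog, splitGraph, Atom.perform]
    · simp [hprog, splitGraph, Atom.perform]
    · rw [hprog]
      funext j
      simp [splitInc, counted, Atom.perform]
  · obtain ⟨i, hi, es, hes⟩ := hs
    refine ⟨i, hi, es, ?_⟩
    have : counted ε (fun j => n j +
        (G.splitInc con (.act v a ha p : G.SplitEdge s ι B) (ε j)).toNat) =
        counted ε n + a.weight := by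
      funext j
      simp [counted, splitInc, Atom.weight]
      ring
    rw [this]
    exact hes
  · obtain ⟨i, hi, es, hes⟩ := hs
    refine ⟨i, hi, f, f.2, es, counted ε n, rfl, ?_, fun j => ?_⟩
    · simp only [splitGraph, List.append_nil, List.nil_append]
      exact hes
    · cases h : con f j <;> simp [counted, splitInc, h]
  · obtain ⟨i, hi, f, hf, es, W, hg, hes, hW⟩ := hs
    refine ⟨i, hi, f, hf, es, W, hg, ?_, fun i => ?_⟩
    · simpa [splitGraph] using hes
    · have := hW i
      by_cases hij : i = j
      · subst hij
        cases h : g i <;> cases both <;> (simp_all [counted, splitInc]; try omega)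
      · simpa [counted, splitInc, hij] using this

-- Equal counters represent weight zero. Since the closing moves lower exactly the weights that must
-- be positive, each by at least one and by as much as desired, equality at the end expresses the
-- original constraints.
variable {G prog con} in
theorem splitGraph_language {wt : G.E → ι → ℤ}
    (hs : ∀ e, ∀ a ∈ (prog e).1, s.Allows a.leftWord a.rightWord)
    (hprog : ∀ e X Y W, Atom.perform (prog e).1 (X, Y, W) =
      (X ++ G.left e, G.right e ++ Y, W + wt e)) :
    (G.splitGraph s prog con).monotoneLanguage (fun e i => G.splitInc con e (ε i)) =
      G.weightedLanguage wt con := by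
  ext w
  constructor
  · rintro ⟨es, _, rfl, _, ⟨g, rfl⟩, X, Y, n, rfl, hr⟩
    obtain ⟨i, hi, f, hf, es, W, rfl, hes, hW⟩ := hr.invariant (P := G.SplitInvariant con ε wt)
      (fun _ _ _ => splitInvariant_step s ε hprog) ⟨rfl, rfl, fun _ => rfl⟩
    refine ⟨es, i, hi, f, hf, X, Y, W, rfl, hes, fun j => ?_⟩
    have := hW j
    cases h : con f j <;> simp [h, Meets, counted] at this ⊢ <;> omega
  · rintro ⟨es, i, hi, f, hf, X, Y, W, rfl, hr, hW⟩
    obtain ⟨n, hn, rfl⟩ : ∃ n : Fin k → ℕ, ReflTransGen (G.SplitStep s prog con ε)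
        ((none, [], []), fun _ => 0) ((some (.inl (f, ⟨[], Nat.zero_le _⟩)), X, Y), n) ∧
        counted ε n = W := by
      refine hr.invariant (P := fun x => ∃ n : Fin k → ℕ, ReflTransGen (G.SplitStep s prog con ε)
        ((none, [], []), fun _ => 0) ((some (.inl (x.1.1, ⟨[], Nat.zero_le _⟩)), x.1.2), n) ∧
        counted ε n = x.2) ?_ ⟨fun _ => 0, ?_, ?_⟩
      · rintro e ⟨⟨u, X, Y⟩, W⟩ ⟨⟨v, X', Y'⟩, W'⟩ ⟨⟨h₁, h₂, h₃, h₄⟩, h₅⟩ ⟨n, hn, hnW⟩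
        simp only at h₁ h₂ h₃ h₄ h₅ hn hnW
        subst h₁ h₂ h₃ h₄ h₅ hnW
        have hc : counted ε (fun j => n j +
            (G.splitInc con (.load e : G.SplitEdge s ι B) (ε j)).toNat) = counted ε n := by
          funext j
          simp [counted, splitInc]
        obtain ⟨n', hn', hnW'⟩ := G.split_perform s prog con ε (G.tgt e) (prog e).1 (prog e).2
          (hs e) X Y
          fun j => n j + (G.splitInc con (.load e : G.SplitEdge s ι B) (ε j)).toNat
        rw [hc, hprog] at hn' hnW'
        refine ⟨n', (hn.tail ?_).trans hn', hnW'⟩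
        exact G.splitStep_intro s prog con ε (e := .load e) rfl rfl (List.append_nil _).symm rfl
      · refine .single ?_
        exact G.splitStep_intro s prog con ε (e := .enter ⟨i, hi⟩) rfl rfl rfl rfl
      · funext j
        simp [counted]
    have h₁ := hn.tail (G.splitStep_intro s prog con ε (e := .leave ⟨f, hf⟩) rfl rfl
      (List.append_nil _).symm rfl)
    set n' : Fin k → ℕ := fun i => n i + (G.splitInc con (.leave ⟨f, hf⟩ : G.SplitEdge s ι B)
      (ε i)).toNat with hn'
    -- The sum of all counters serves as the common target; any upper bound for them would do.
    have h₂ := G.split_fill s prog con ε (con f) X Y (∑ i, n' i) _ n'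
      (fun i => Finset.single_le_sum (fun _ _ => Nat.zero_le _) (Finset.mem_univ i)) rfl
      (fun j => by
        have := hW j
        cases h : con f j <;> simp [h, Meets, counted, hn', splitInc] at this ⊢ <;> omega)
      (fun j hj => by
        have := hW j
        simp [hj, Meets, counted, hn', splitInc] at this ⊢
        omega)
    obtain ⟨es', hes'⟩ := LabelledRun.exists_of_reflTransGen (h₁.trans h₂)
    exact ⟨es', none, rfl, _, ⟨_, rfl⟩, X, Y, _, rfl, hes'⟩

end

end LinearGraph

/-- Each letter is an elementary action and contributes edges of its own, so finiteness of the
alphabet is needed for the split graph. -/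
theorem familyWeighted_subset_familyMonotone (T : Type) [Finite T] (s : Shape) :
    familyWeighted T s ⊆ familyMonotone T s := by
  classical
  rintro _ ⟨G, ι, _, wt, con, hs, rfl⟩
  have hprog := fun e => Atom.realizes (ι := ι) (hs e) (wt e)
  choose prog hprog hprog' using hprog
  have := Fintype.ofFinite G.E
  -- A crude common bound on the lists of actions, which keeps the set of vertices finite.
  let B := ∑ e, (prog e).length
  have hB : ∀ e, (prog e).length ≤ B := fun e =>
    Finset.single_le_sum (f := fun e => (prog e).length) (fun _ _ => Nat.zero_le _)
      (Finset.mem_univ e)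
  obtain ⟨k, ⟨ε⟩⟩ := Finite.exists_equiv_fin (ι × Bool)
  refine ⟨G.splitGraph s (fun e => ⟨prog e, hB e⟩) con, k, fun e i => G.splitInc con e (ε.symm i),
    none, rfl, ?_, ?_, ?_, LinearGraph.splitGraph_language s ε.symm hprog hprog'⟩
  · rintro (i | e | ⟨v, a, ha, p⟩ | f | ⟨g, j, both⟩) <;>
      first | exact Nat.zero_le _ | exact a.length_leftWord_le
  · rintro (i | e | ⟨v, a, ha, p⟩ | f | ⟨g, j, both⟩) <;>
      first | exact Nat.zero_le _ | exact a.length_rightWord_le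
  · rintro (i | e | ⟨v, a, ha, p⟩ | f | ⟨g, j, both⟩) <;>
      first | exact Atom.allows_nil s | exact ha

/-! ### Sentential forms of linear grammars -/

section Sentential

variable {T N : Type}

/-- The word `X A Y`, or `X Y` if there is no nonterminal. -/
def sentential (X : List T) (A : Option N) (Y : List T) : List (Symbol T N) :=
  X.map Symbol.terminal ++ (A.toList.map Symbol.nonterminal ++ Y.map Symbol.terminal)

theorem nonterminal_not_mem_map {X : List T} {A : N} :
    (Symbol.nonterminal A : Symbol T N) ∉ X.map Symbol.terminal := by
  simp

theorem map_terminal_injective :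
    Function.Injective (List.map (Symbol.terminal (T := T) (N := N))) :=
  List.map_injective_iff.mpr fun _ _ h => by cases h; rfl

theorem sentential_none {X Y : List T} :
    (sentential X none Y : List (Symbol T N)) = (X ++ Y).map Symbol.terminal := by
  simp [sentential]

theorem sentential_append_nil {X Y : List T} {A : Option N} :
    sentential (X ++ []) A ([] ++ Y) = sentential X A Y := by
  simp

theorem terminal_eq_sentential {w X Y : List T} {A : Option N}
    (h : w.map Symbol.terminal = sentential X A Y) : A = none ∧ w = X ++ Y := by
  cases A with
  | none => exact ⟨rfl, map_terminal_injective (h.trans sentential_none)⟩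
  | some A =>
    have : (Symbol.nonterminal A : Symbol T N) ∈ w.map Symbol.terminal := by
      rw [h]; simp [sentential]
    exact absurd this nonterminal_not_mem_map

/-- `X` and `Y` contain no nonterminals, so the only possible place of the cut is the single
nonterminal in the middle. -/
theorem sentential_eq_append {X Y : List T} {A : Option N} {B : N} {u v : List (Symbol T N)}
    (h : sentential X A Y = u ++ [Symbol.nonterminal B] ++ v) :
    A = some B ∧ u = X.map Symbol.terminal ∧ v = Y.map Symbol.terminal := by
  cases A with
  | none =>
    have : (Symbol.nonterminal B : Symbol T N) ∈ (X ++ Y).map Symbol.terminal := by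
      rw [← sentential_none, h]; simp
    exact absurd this nonterminal_not_mem_map
  | some A =>
    simp only [sentential, Option.toList_some, List.map_cons, List.map_nil, List.append_assoc,
      List.cons_append, List.nil_append] at h
    induction X generalizing u with
    | nil =>
      cases u with
      | nil => simp_all
      | cons a u =>
        simp only [List.map_nil, List.nil_append, List.cons_append, List.cons.injEq] at h
        have : (Symbol.nonterminal B : Symbol T N) ∈ Y.map Symbol.terminal := by
          rw [h.2]; simp
        exact absurd this nonterminal_not_mem_map
    | cons x X ih =>
      cases u with
      | nil => simp at h
      | cons a u =>
        simp only [List.map_cons, List.cons_append, List.cons.injEq] at h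
        obtain ⟨h₁, h₂, h₃⟩ := ih h.2
        exact ⟨h₁, by simp [h₂, h.1], h₃⟩

theorem map_append_sentential {X Y x y : List T} {A : Option N} :
    X.map Symbol.terminal ++ sentential x A y ++ Y.map Symbol.terminal =
      sentential (X ++ x) A (y ++ Y) := by
  simp [sentential]

/-- With at most one nonterminal present, a rule determines the rewriting step; this turns
derivations into runs of a graph. -/
theorem rewrite_sentential {X Y x y : List T} {A C : Option N} {B : N} {b : List (Symbol T N)} :
    (∃ u v, sentential X A Y = u ++ [Symbol.nonterminal B] ++ v ∧ b = u ++ sentential x C y ++ v) ↔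
      A = some B ∧ b = sentential (X ++ x) C (y ++ Y) := by
  constructor
  · rintro ⟨u, v, h, rfl⟩
    obtain ⟨_, rfl, rfl⟩ := sentential_eq_append h
    exact ⟨‹_›, map_append_sentential⟩
  · rintro ⟨rfl, rfl⟩
    exact ⟨_, _, by simp [sentential], map_append_sentential.symm⟩

/-- The right-hand sides of a given shape. -/
def Shape.Word : Shape → List (Symbol T N) → Prop
  | .linear => IsLinearWord
  | .rightLinear => IsRightLinearWord
  | .leftLinear => IsLeftLinearWord

theorem Shape.word_iff {s : Shape} {w : List (Symbol T N)} :
    s.Word w ↔ ∃ x A y, s.Allows x y ∧ w = sentential x A y := by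
  constructor
  · intro h
    cases s
    · rcases h with ⟨x, rfl⟩ | ⟨x, A, y, rfl⟩
      · exact ⟨x, none, [], trivial, by simp [sentential]⟩
      · exact ⟨x, some A, y, trivial, by simp [sentential]⟩
    · rcases h with ⟨x, rfl⟩ | ⟨x, A, rfl⟩
      · exact ⟨x, none, [], rfl, by simp [sentential]⟩
      · exact ⟨x, some A, [], rfl, by simp [sentential]⟩
    · rcases h with ⟨y, rfl⟩ | ⟨A, y, rfl⟩
      · exact ⟨[], none, y, rfl, by simp [sentential]⟩
      · exact ⟨[], some A, y, rfl, by simp [sentential]⟩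
  · rintro ⟨x, _ | A, y, h, rfl⟩
    · cases s <;> exact .inl ⟨x ++ y, sentential_none⟩
    · cases s
      · exact .inr ⟨x, A, y, by simp [sentential]⟩
      · obtain rfl : y = [] := h
        exact .inr ⟨x, A, by simp [sentential]⟩
      · obtain rfl : x = [] := h
        exact .inr ⟨A, y, by simp [sentential]⟩

end Sentential

/-! ### Grammars with monotonic counters -/

/-- Languages of grammars with monotonic counters and right-hand sides of a given shape. -/
def familyMC (T : Type) (s : Shape) : Set (Language T) :=
  {L | ∃ G : MonotonicCounterGrammar T, (∀ r ∈ G.rules, s.Word r.rhs) ∧ G.language = L}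

/-- The counters agree exactly when all pairwise differences vanish; these differences are the
weights. -/
theorem LinearGraph.monotoneLanguage_mem_weighted {T : Type} (G : LinearGraph T) {s : Shape}
    (hs : G.HasShape s) {k : ℕ} (inc : G.E → Fin k → Bool) :
    G.monotoneLanguage inc ∈ familyWeighted T s := by
  refine ⟨G, Fin k × Fin k, inferInstance,
    fun e p => ((inc e p.1).toNat : ℤ) - (inc e p.2).toNat, fun _ _ => false, hs, ?_⟩
  ext w
  constructor
  · rintro ⟨es, i, hi, f, hf, X, Y, W, rfl, hr, hW⟩
    obtain ⟨es', ⟨Z, c⟩, hr', hZ, hc⟩ := hr.simulate (step' := G.MonotoneStep inc)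
      (R := fun a b => a.1 = b.1 ∧ a.2 = fun p => (b.2 p.1 : ℤ) - b.2 p.2)
      (a' := ((i, [], []), fun _ => 0)) (by
        rintro e ⟨Z, W⟩ ⟨Z', W'⟩ ⟨Z₁, c⟩ ⟨h, hW⟩ ⟨hZ, hc⟩
        dsimp only at h hW hZ hc
        subst hW hZ hc
        refine ⟨[e], (Z', fun j => c j + (inc e j).toNat), .single ⟨h, fun j => rfl⟩, rfl, ?_⟩
        funext p
        simp
        ring) ⟨rfl, by funext; simp⟩
    dsimp only at hZ hc
    subst hZ hc
    obtain ⟨n, hn⟩ : ∃ n, c = fun _ => n := by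
      -- Without counters the common value is arbitrary, and `0` is taken.
      rcases isEmpty_or_nonempty (Fin k) with h | ⟨⟨j⟩⟩
      · exact ⟨0, funext fun j => h.elim j⟩
      · refine ⟨c j, funext fun i => ?_⟩
        have := hW (i, j)
        simp [Meets] at this
        omega
    subst hn
    exact ⟨es', i, hi, f, hf, X, Y, n, rfl, hr'⟩
  · rintro ⟨es, i, hi, f, hf, X, Y, n, rfl, hr⟩
    refine ⟨es, i, hi, f, hf, X, Y, 0, rfl, ?_, fun j => ?_⟩
    · have := hr.mono (f := id)
        (g := fun a => (a.1, fun p : Fin k × Fin k => (a.2 p.1 : ℤ) - a.2 p.2))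
        (step' := G.WeightedStep fun e (p : Fin k × Fin k) =>
          ((inc e p.1).toNat : ℤ) - (inc e p.2).toNat) (by
          rintro e ⟨Z, c⟩ ⟨Z', c'⟩ ⟨h, hc⟩
          refine ⟨h, ?_⟩
          funext p
          simp only at hc
          simp [hc]
          ring)
      rw [List.map_id] at this
      simp only [sub_self, Nat.cast_zero] at this
      exact this
    · simp [Meets]

/-- Vertices are the possible nonterminals of a sentential form, with `none` once it has become
terminal. -/
theorem familyMC_subset_familyWeighted (T : Type) (s : Shape) :
    familyMC T s ⊆ familyWeighted T s := by
  rintro _ ⟨G, hG, rfl⟩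
  have hG := fun r : G.rules => Shape.word_iff.mp (hG r r.2)
  choose x A y hs hrhs using hG
  have := G.finite_V
  have := G.finite_rules.to_subtype
  let H : LinearGraph T :=
    { V := Option G.V
      E := G.rules
      finite_V := inferInstance
      finite_E := inferInstance
      init := {some G.start}
      final := {none}
      src := fun r => some r.1.lhs
      tgt := A
      left := x
      right := y }
  have hlang : H.monotoneLanguage (fun r => r.1.inc) = G.language := by
    ext w
    constructor
    · rintro ⟨es, _, rfl, _, rfl, X, Y, n, rfl, hr⟩
      have := hr.mono (f := fun r => r.1) (step' := G.Step)
        (g := fun s => (s.2, sentential s.1.2.1 s.1.1 s.1.2.2)) (by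
          rintro r ⟨⟨A', X, Y⟩, c⟩ ⟨⟨C, X', Y'⟩, c'⟩ ⟨⟨h₁, h₂, h₃, h₄⟩, h₅⟩
          simp only at h₁ h₂ h₃ h₄ h₅
          subst h₁ h₂ h₃ h₄
          refine ⟨r.2, h₅, ?_⟩
          rw [hrhs]
          exact rewrite_sentential.mpr ⟨rfl, rfl⟩)
      simp only [sentential_none] at this
      exact ⟨_, n, this⟩
    · rintro ⟨rs, n, hr⟩
      obtain ⟨es, ⟨⟨A', X, Y⟩, c⟩, hes, hc, h⟩ := hr.simulate
        (step' := H.MonotoneStep fun r => r.1.inc)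
        (R := fun a b => a.1 = b.2 ∧ a.2 = sentential b.1.2.1 b.1.1 b.1.2.2)
        (a' := ((some G.start, [], []), fun _ => 0)) (by
          rintro r ⟨c, z⟩ ⟨c', z'⟩ ⟨⟨A', X, Y⟩, _⟩ ⟨hr, hc, h⟩ ⟨hcc, hz⟩
          dsimp only at h hc hcc hz
          subst hcc hz
          obtain rfl : c' = _ := funext hc
          rw [hrhs ⟨r, hr⟩] at h
          obtain ⟨rfl, rfl⟩ := rewrite_sentential.mp h
          exact ⟨[⟨r, hr⟩], ((A ⟨r, hr⟩, X ++ x ⟨r, hr⟩, y ⟨r, hr⟩ ++ Y), _),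
            .single ⟨⟨rfl, rfl, rfl, rfl⟩, fun _ => rfl⟩, rfl, rfl⟩) ⟨rfl, by simp [sentential]⟩
      dsimp only at hc h
      subst hc
      obtain ⟨rfl, rfl⟩ := terminal_eq_sentential h
      exact ⟨es, _, rfl, _, rfl, X, Y, n, rfl, hes⟩
  rw [← hlang]
  exact H.monotoneLanguage_mem_weighted hs _

/-- Stopping in a final vertex becomes a rule that erases the nonterminal and increments nothing. -/
theorem familyMonotone_subset_familyMC (T : Type) (s : Shape) :
    familyMonotone T s ⊆ familyMC T s := by
  rintro _ ⟨G, k, inc, i, hi, -, -, hs, rfl⟩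
  let H : MonotonicCounterGrammar T :=
    { V := G.V
      k := k
      finite_V := inferInstance
      start := i
      rules := Set.range (fun e : G.E =>
          ⟨G.src e, inc e, sentential (G.left e) (some (G.tgt e)) (G.right e)⟩) ∪
        Set.range fun f : G.final => ⟨f.1, fun _ => false, sentential [] none []⟩
      finite_rules := (Set.finite_range _).union (Set.finite_range _) }
  refine ⟨H, ?_, ?_⟩
  · rintro r (⟨e, rfl⟩ | ⟨f, rfl⟩)
    exacts [Shape.word_iff.mpr ⟨_, _, _, hs e, rfl⟩,
      Shape.word_iff.mpr ⟨_, _, _, Atom.allows_nil s, rfl⟩]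
  ext w
  constructor
  · rintro ⟨rs, n, hr⟩
    obtain ⟨es, ⟨⟨v, X, Y⟩, c⟩, hes, hc, h⟩ := hr.simulate (step' := G.MonotoneStep inc)
      (R := fun a b => a.1 = b.2 ∧ (a.2 = sentential b.1.2.1 (some b.1.1) b.1.2.2 ∨
        b.1.1 ∈ G.final ∧ a.2 = sentential b.1.2.1 none b.1.2.2))
      (a' := ((i, [], []), fun _ => 0)) (by
        rintro r ⟨c, z⟩ ⟨c', z'⟩ ⟨⟨v, X, Y⟩, _⟩ ⟨hr, hc, h⟩ ⟨hcc, hz⟩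
        dsimp only at h hc hcc hz
        subst hcc
        obtain rfl : c' = _ := funext hc
        rcases hr with ⟨e, rfl⟩ | ⟨f, rfl⟩
        · rcases hz with rfl | ⟨-, rfl⟩
          · obtain ⟨hv, rfl⟩ := rewrite_sentential.mp h
            obtain rfl := Option.some.inj hv
            exact ⟨[e], ((G.tgt e, X ++ G.left e, G.right e ++ Y), _),
              .single ⟨⟨rfl, rfl, rfl, rfl⟩, fun _ => rfl⟩, rfl, .inl rfl⟩
          · simpa using (rewrite_sentential.mp h).1
        · rcases hz with rfl | ⟨-, rfl⟩
          · obtain ⟨hv, rfl⟩ := rewrite_sentential.mp h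
            obtain rfl := Option.some.inj hv
            exact ⟨[], _, .nil _, by funext; simp, .inr ⟨f.2, by simp⟩⟩
          · simpa using (rewrite_sentential.mp h).1) ⟨rfl, .inl (by simp [sentential, H])⟩
    dsimp only at hc h
    subst hc
    rcases h with h | ⟨hf, h⟩
    · simpa using (terminal_eq_sentential h).1
    · obtain ⟨-, rfl⟩ := terminal_eq_sentential h
      exact ⟨es, i, hi ▸ rfl, v, hf, X, Y, n, rfl, hes⟩
  · rintro ⟨es, i', hi', f, hf, X, Y, n, rfl, hr⟩
    rw [hi] at hi'
    obtain rfl : i' = i := hi'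
    have := hr.mono (f := fun e => ⟨G.src e, inc e, sentential (G.left e) (some (G.tgt e))
      (G.right e)⟩) (step' := H.Step)
      (g := fun s => (s.2, sentential s.1.2.1 (some s.1.1) s.1.2.2)) (by
        rintro e ⟨⟨u, X, Y⟩, c⟩ ⟨⟨v, X', Y'⟩, c'⟩ ⟨⟨h₁, h₂, h₃, h₄⟩, h₅⟩
        simp only at h₁ h₂ h₃ h₄ h₅
        subst h₁ h₂ h₃ h₄
        exact ⟨.inl ⟨e, rfl⟩, h₅, rewrite_sentential.mpr ⟨rfl, rfl⟩⟩)
    refine ⟨_, n, this.append (.single (l := ⟨f, fun _ => false, sentential [] none []⟩)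
      ⟨.inr ⟨⟨f, hf⟩, rfl⟩, fun _ => rfl, ?_⟩)⟩
    exact rewrite_sentential.mpr ⟨rfl, by simp [sentential]⟩

/-! ### State grammars with reversal-bounded counters -/

/-- The change of a counter that is incremented if `b` holds. -/
def boolSign (b : Bool) : SignType := if b then 1 else 0

theorem boolSign_cast (b : Bool) : (boolSign b : ℤ) = b.toNat := by cases b <;> rfl

theorem boolSign_nonneg (b : Bool) : 0 ≤ boolSign b := by cases b <;> decide

/-- Languages of reversal-bounded state grammars with right-hand sides of a given shape. -/
def familySC (T : Type) (s : Shape) : Set (Language T) :=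
  {L | ∃ G : CounterStateGrammar T, G.IsReversalBounded ∧ (∀ r ∈ G.rules, s.Word r.rhs) ∧
    G.language = L}

theorem familySC_subset_familyWeighted (T : Type) (s : Shape) :
    familySC T s ⊆ familyWeighted T s := by
  rintro _ ⟨G, ⟨b, hb⟩, hG, rfl⟩
  have hG := fun r : G.rules => Shape.word_iff.mp (hG r r.2)
  choose x A y hs hrhs using hG
  have := G.finite_V
  have := G.finite_Q
  have := G.finite_rules.to_subtype
  let H : LinearGraph T :=
    { V := G.Q × Option G.V
      E := G.rules
      finite_V := inferInstance
      finite_E := inferInstance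
      init := {(G.init, some G.start)}
      final := {v | v.1 ∈ G.final ∧ v.2 = none}
      src := fun r => (r.1.src, some r.1.lhs)
      tgt := fun r => (r.1.tgt, A r)
      left := x
      right := y }
  let lab : H.E → (Fin G.k → Bool) × (Fin G.k → SignType) := fun r => (r.1.test, r.1.delta)
  have hrun : ∀ {es s t}, LabelledRun (H.CounterStep lab) es s t → LabelledRun G.Step
      (es.map Subtype.val) (s.1.1.1, s.2, sentential s.1.2.1 s.1.1.2 s.1.2.2)
      (t.1.1.1, t.2, sentential t.1.2.1 t.1.1.2 t.1.2.2) := by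
    intro es s t hr
    refine hr.mono (g := fun s : (H.V × List T × List T) × _ =>
      (s.1.1.1, s.2, sentential s.1.2.1 s.1.1.2 s.1.2.2)) ?_
    rintro r ⟨⟨⟨q, A'⟩, X, Y⟩, c⟩ ⟨⟨⟨p, C⟩, X', Y'⟩, c'⟩ ⟨⟨h₁, h₂, h₃, h₄⟩, h₅, h₆⟩
    dsimp only at h₁ h₂ h₃ h₄ h₅ h₆
    obtain ⟨rfl, rfl⟩ := Prod.mk.inj h₁
    obtain ⟨rfl, rfl⟩ := Prod.mk.inj h₂
    subst h₃ h₄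
    refine ⟨r.2, rfl, rfl, h₅, h₆, ?_⟩
    rw [hrhs]
    exact rewrite_sentential.mpr ⟨rfl, rfl⟩
  have hlang : H.counterLanguage lab = G.language := by
    ext w
    constructor
    · rintro ⟨es, _, rfl, ⟨f, _⟩, ⟨hf, rfl⟩, X, Y, c, rfl, hr⟩
      have := hrun hr
      simp only [sentential_none] at this
      exact ⟨_, f, c, hf, this⟩
    · rintro ⟨rs, f, c, hf, hr⟩
      obtain ⟨es, ⟨⟨⟨q, A'⟩, X, Y⟩, c'⟩, hes, hq, hc, h⟩ := hr.simulate
        (step' := H.CounterStep lab)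
        (R := fun a b => a.1 = b.1.1.1 ∧ a.2.1 = b.2 ∧
          a.2.2 = sentential b.1.2.1 b.1.1.2 b.1.2.2)
        (a' := (((G.init, some G.start), [], []), fun _ => 0)) (by
          rintro r ⟨q, c, z⟩ ⟨q', c', z'⟩ ⟨⟨⟨p, A'⟩, X, Y⟩, _⟩ ⟨hr, hq, hq', ht, hc, h⟩
            ⟨hp, hcc, hz⟩
          dsimp only at h hc hcc hz hq hq' hp ht
          subst hcc hz hp hq hq'
          rw [hrhs ⟨r, hr⟩] at h
          obtain ⟨rfl, rfl⟩ := rewrite_sentential.mp h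
          exact ⟨[⟨r, hr⟩], (((r.tgt, A ⟨r, hr⟩), X ++ x ⟨r, hr⟩, y ⟨r, hr⟩ ++ Y), c'),
            .single ⟨⟨rfl, rfl, rfl, rfl⟩, ht, hc⟩, rfl, rfl, rfl⟩)
        ⟨rfl, rfl, by simp [sentential, CounterStateGrammar.initial]⟩
      dsimp only at hq hc h
      subst hq hc
      obtain ⟨rfl, rfl⟩ := terminal_eq_sentential h
      exact ⟨es, _, rfl, (f, none), ⟨hf, rfl⟩, X, Y, c, rfl, hes⟩
  rw [← hlang]
  refine H.counterLanguage_mem_weighted hs _ b fun es i hi t hr j => ?_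
  obtain rfl : i = (G.init, some G.start) := hi
  have h := hrun hr
  have h' := hb (es.map Subtype.val) _ h j
  rw [List.map_map] at h'
  exact h'

/-! ### Simulation of monotone counters by state grammars -/

namespace LinearGraph

variable {T : Type} (G : LinearGraph T) {k : ℕ} (inc : G.E → Fin k → Bool)

/-- The rules that simulate a graph with monotone counters: following an edge; leaving a final
vertex; decrementing all counters; erasing the nonterminal when all counters are zero. -/
def stateRules : Set (CounterStateRule T G.V Bool k) :=
  (Set.range (fun x : G.E × (Fin k → Bool) => ⟨false, x.2, G.src x.1, false,
      fun j => boolSign (inc x.1 j),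
      sentential (G.left x.1) (some (G.tgt x.1)) (G.right x.1)⟩) ∪
    Set.range fun x : G.final × (Fin k → Bool) => ⟨false, x.2, x.1.1, true, fun _ => 0,
      sentential [] (some x.1.1) []⟩) ∪
  (Set.range (fun v : G.V => ⟨true, fun _ => true, v, true, fun _ => -1,
      sentential [] (some v) []⟩) ∪
    Set.range fun v : G.V => ⟨true, fun _ => false, v, true, fun _ => 0,
      sentential [] none []⟩)

/-- The state grammar that simulates a graph with monotone counters. -/
def stateGrammar (i : G.V) : CounterStateGrammar T where
  V := G.V
  Q := Bool
  k := k
  finite_V := inferInstance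
  finite_Q := inferInstance
  start := i
  init := false
  final := {true}
  rules := G.stateRules inc
  finite_rules := ((Set.finite_range _).union (Set.finite_range _)).union
    ((Set.finite_range _).union (Set.finite_range _))

/-- Counters do not decrease in the state `false` and do not increase in the state `true`, which is
never left. -/
theorem stateGrammar_isReversalBounded (i : G.V) : (G.stateGrammar inc i).IsReversalBounded := by
  refine ⟨1, fun rs s hr j => hr.numReversals_le_one (fun s => s.1 = true) (fun r => r.delta j)
    ?_ ?_⟩
  · rintro r s t ⟨hr, h₁, h₂, -⟩ hs
    rw [hs] at h₁
    rw [h₂]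
    rcases hr with (⟨e, rfl⟩ | ⟨f, rfl⟩) | (⟨v, rfl⟩ | ⟨v, rfl⟩)
    · exact absurd h₁ (by simp)
    · exact absurd h₁ (by simp)
    · exact ⟨rfl, show (-1 : SignType) ≤ 0 by decide⟩
    · exact ⟨rfl, le_rfl⟩
  · rintro r s t ⟨hr, h₁, -⟩ hs
    rw [h₁] at hs
    rcases hr with (⟨e, rfl⟩ | ⟨f, rfl⟩) | (⟨v, rfl⟩ | ⟨v, rfl⟩)
    · exact boolSign_nonneg _
    · exact le_rfl
    · exact absurd rfl hs
    · exact absurd rfl hs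

theorem stateGrammar_empty (i v : G.V) (X Y : List T) (n : ℕ) :
    ∃ rs, LabelledRun (G.stateGrammar inc i).Step rs
      (true, fun _ => n, sentential X (some v) Y) (true, fun _ => 0, sentential X none Y) := by
  induction n with
  | zero =>
    refine ⟨_, .single ⟨.inr (.inr ⟨v, rfl⟩), rfl, rfl, by simp, by simp, ?_⟩⟩
    exact rewrite_sentential.mpr ⟨rfl, sentential_append_nil.symm⟩
  | succ n ih =>
    obtain ⟨rs, hrs⟩ := ih
    refine ⟨_, .cons (t := (true, fun _ => n, sentential X (some v) Y))
      ⟨.inr (.inl ⟨v, rfl⟩), rfl, rfl, by simp, by simp, ?_⟩ hrs⟩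
    exact rewrite_sentential.mpr ⟨rfl, sentential_append_nil.symm⟩

/-- The relation between the derivations of `stateGrammar` and the runs of the graph. -/
def StateSimulation (a : Bool × (Fin k → ℕ) × List (Symbol T G.V))
    (b : (G.V × List T × List T) × (Fin k → ℕ)) : Prop :=
  if a.1 then b.1.1 ∈ G.final ∧ (∃ d, ∀ j, b.2 j = a.2.1 j + d) ∧
      (a.2.2 = sentential b.1.2.1 (some b.1.1) b.1.2.2 ∨
        a.2.2 = sentential b.1.2.1 none b.1.2.2 ∧ ∀ j, a.2.1 j = 0)
    else b.2 = a.2.1 ∧ a.2.2 = sentential b.1.2.1 (some b.1.1) b.1.2.2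

/-- Decrements hit all counters simultaneously, so the counters of the graph exceed those of the
grammar by a common amount. Since the nonterminal is erased only when all counters are zero, they
must have been equal. -/
theorem stateSimulation_step (i : G.V) {r : CounterStateRule T G.V Bool k}
    {s t : Bool × (Fin k → ℕ) × List (Symbol T G.V)}
    {s' : (G.V × List T × List T) × (Fin k → ℕ)}
    (h : (G.stateGrammar inc i).Step r s t) (hs : G.StateSimulation s s') :
    ∃ es t', LabelledRun (G.MonotoneStep inc) es s' t' ∧ G.StateSimulation t t' := by
  obtain ⟨q, c, z⟩ := s
  obtain ⟨q', c', z'⟩ := t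
  obtain ⟨⟨v, X, Y⟩, d⟩ := s'
  obtain ⟨hr, h₁, h₂, ht, hc, h⟩ := h
  dsimp only at h₁ h₂ ht hc h
  subst h₁ h₂
  rcases hr with (⟨⟨e, t⟩, rfl⟩ | ⟨⟨f, t⟩, rfl⟩) | (⟨u, rfl⟩ | ⟨u, rfl⟩)
  · obtain ⟨hd, hz⟩ := hs
    dsimp only at hd hz
    subst hd hz
    obtain ⟨hv, rfl⟩ := rewrite_sentential.mp h
    obtain rfl := Option.some.inj hv
    refine ⟨[e], ((G.tgt e, X ++ G.left e, G.right e ++ Y), c'), .single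
      ⟨⟨rfl, rfl, rfl, rfl⟩, fun j => ?_⟩, rfl, rfl⟩
    have := hc j
    rw [boolSign_cast] at this
    exact_mod_cast this
  · obtain ⟨hd, hz⟩ := hs
    dsimp only at hd hz
    subst hd hz
    obtain ⟨hv, rfl⟩ := rewrite_sentential.mp h
    obtain rfl := Option.some.inj hv
    refine ⟨[], ((f.1, X, Y), d), .nil _, f.2, ⟨0, fun j => ?_⟩, .inl sentential_append_nil⟩
    have := hc j
    simp at this
    simp [this]
  · obtain ⟨hf, ⟨m, hm⟩, hz⟩ := hs
    dsimp only at hf hm hz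
    rcases hz with rfl | ⟨rfl, hz⟩
    · obtain ⟨hv, rfl⟩ := rewrite_sentential.mp h
      refine ⟨[], ((v, X, Y), d), .nil _, hf, ⟨m + 1, fun j => ?_⟩, .inl ?_⟩
      · have := hc j
        simp at this
        have := hm j
        dsimp only
        omega
      · rw [hv]
        exact sentential_append_nil
    · simpa using (rewrite_sentential.mp h).1
  · obtain ⟨hf, ⟨m, hm⟩, hz⟩ := hs
    dsimp only at hf hm hz
    rcases hz with rfl | ⟨rfl, hz⟩
    · obtain ⟨hv, rfl⟩ := rewrite_sentential.mp h
      have h0 : ∀ j : Fin k, c j = 0 := fun j => by simpa using ht j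
      have h0' : ∀ j : Fin k, c' j = 0 := fun j => by simpa [h0 j] using hc j
      refine ⟨[], ((v, X, Y), d), .nil _, hf, ⟨m, fun j => ?_⟩, .inr ⟨sentential_append_nil, h0'⟩⟩
      have := hm j
      dsimp only
      rw [this, h0, h0']
    · simpa using (rewrite_sentential.mp h).1

end LinearGraph

theorem familyMonotone_subset_familySC (T : Type) (s : Shape) :
    familyMonotone T s ⊆ familySC T s := by
  rintro _ ⟨G, k, inc, i, hi, -, -, hs, rfl⟩
  refine ⟨G.stateGrammar inc i, G.stateGrammar_isReversalBounded inc i, ?_, ?_⟩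
  · rintro r ((⟨⟨e, t⟩, rfl⟩ | ⟨⟨f, t⟩, rfl⟩) | (⟨u, rfl⟩ | ⟨u, rfl⟩))
    exacts [Shape.word_iff.mpr ⟨_, _, _, hs e, rfl⟩,
      Shape.word_iff.mpr ⟨_, _, _, Atom.allows_nil s, rfl⟩,
      Shape.word_iff.mpr ⟨_, _, _, Atom.allows_nil s, rfl⟩,
      Shape.word_iff.mpr ⟨_, _, _, Atom.allows_nil s, rfl⟩]
  ext w
  constructor
  · rintro ⟨rs, f, c, rfl, hr⟩
    obtain ⟨es, ⟨⟨v, X, Y⟩, d⟩, hes, hf, ⟨n, hn⟩, h⟩ := hr.simulate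
      (R := G.StateSimulation) (fun _ _ _ _ h hs => G.stateSimulation_step inc i h hs)
      (a' := ((i, [], []), fun _ => 0)) ⟨rfl, rfl⟩
    dsimp only at hf hn h
    rcases h with h | ⟨h, h0⟩
    · simpa using (terminal_eq_sentential h).1
    · obtain ⟨-, rfl⟩ := terminal_eq_sentential h
      have : d = fun _ => n := funext fun j => by rw [hn, h0, zero_add]
      subst this
      exact ⟨es, i, hi ▸ rfl, v, hf, X, Y, n, rfl, hes⟩
  · rintro ⟨es, i', hi', f, hf, X, Y, n, rfl, hr⟩
    rw [hi] at hi'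
    obtain rfl : i' = i := hi'
    obtain ⟨rs, t, hrs, rfl⟩ := hr.simulate (step' := (G.stateGrammar inc i').Step)
      (R := fun a b => b = (false, a.2, sentential a.1.2.1 (some a.1.1) a.1.2.2))
      (a' := (G.stateGrammar inc i').initial) (by
        rintro e ⟨⟨u, X, Y⟩, c⟩ ⟨⟨v, X', Y'⟩, c'⟩ _ ⟨⟨h₁, h₂, h₃, h₄⟩, h₅⟩ rfl
        dsimp only at h₁ h₂ h₃ h₄ h₅
        subst h₁ h₂ h₃ h₄
        refine ⟨_, _, .single ⟨.inl (.inl ⟨(e, fun j => decide (0 < c j)), rfl⟩), rfl, rfl,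
          ?_, ?_, ?_⟩, rfl⟩
        · simp
        · intro j
          have := h₅ j
          simp only [boolSign_cast]
          exact_mod_cast this
        · exact rewrite_sentential.mpr ⟨rfl, rfl⟩)
      rfl
    obtain ⟨rs', hrs'⟩ := G.stateGrammar_empty inc i' f X Y n
    rw [sentential_none] at hrs'
    refine ⟨_, true, fun _ => 0, rfl, hrs.append (.cons (l := ⟨false, fun j => decide (0 < n), f,
      true, fun _ => 0, sentential [] (some f) []⟩) ?_ hrs')⟩
    · refine ⟨.inl (.inr ⟨(⟨f, hf⟩, _), rfl⟩), rfl, rfl, by simp, by simp, ?_⟩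
      exact rewrite_sentential.mpr ⟨rfl, sentential_append_nil.symm⟩

/-! ### Counter machines -/

theorem familyNCM_subset_familyWeighted (T : Type) :
    familyNCM T ⊆ familyWeighted T .rightLinear := by
  rintro _ ⟨M, ⟨b, hb⟩, rfl⟩
  have := M.finite_Q
  have := M.finite_transitions.to_subtype
  let H : LinearGraph T :=
    { V := M.Q
      E := M.transitions
      finite_V := inferInstance
      finite_E := inferInstance
      init := {M.init}
      final := M.final
      src := fun τ => τ.1.src
      tgt := fun τ => τ.1.tgt
      left := fun τ => τ.1.read.toList
      right := fun _ => [] }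
  let lab : H.E → (Fin M.k → Bool) × (Fin M.k → SignType) := fun τ => (τ.1.test, τ.1.delta)
  -- The graph has no unread input; what it emits on the left is what the machine consumes, whatever
  -- rest `u` follows.
  have hrun : ∀ {es s t}, LabelledRun (H.CounterStep lab) es s t → t.1.2.2 = s.1.2.2 ∧
      ∃ x, t.1.2.1 = s.1.2.1 ++ x ∧ ∀ u, LabelledRun M.Step (es.map Subtype.val)
        (s.1.1, x ++ u, s.2) (t.1.1, u, t.2) := by
    intro es s t hr
    induction hr with
    | nil s => exact ⟨rfl, [], by simp, fun u => .nil _⟩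
    | @cons e es s t u h _ ih =>
      obtain ⟨⟨h₁, h₂, h₃, h₄⟩, h₅, h₆⟩ := h
      obtain ⟨hY, x, hX, hx⟩ := ih
      refine ⟨hY.trans h₄, e.1.read.toList ++ x, ?_, fun u => .cons (t := (t.1.1, x ++ u, t.2))
        ⟨e.2, h₁, h₂, by simp, h₅, h₆⟩ (hx u)⟩
      rw [hX, h₃, List.append_assoc]
  have hlang : H.counterLanguage lab = M.language := by
    ext w
    constructor
    · rintro ⟨es, _, rfl, f, hf, X, Y, c, rfl, hr⟩
      obtain ⟨hY, x, hX, hx⟩ := hrun hr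
      dsimp only at hY hX
      subst hY hX
      have hx := hx []
      simp only [List.append_nil] at hx ⊢
      exact ⟨_, f, c, hf, hx⟩
    · rintro ⟨τs, f, c, hf, hr⟩
      obtain ⟨es, ⟨⟨q, X, Y⟩, c'⟩, hes, hq, hc, hY, hX⟩ := hr.simulate
        (step' := H.CounterStep lab)
        (R := fun a b => b.1.1 = a.1 ∧ b.2 = a.2.2 ∧ b.1.2.2 = [] ∧ w = b.1.2.1 ++ a.2.1)
        (a' := ((M.init, [], []), fun _ => 0)) (by
          rintro τ ⟨q, u, c⟩ ⟨q', u', c'⟩ ⟨⟨p, X, Y⟩, d⟩ ⟨hτ, h₁, h₂, h₃, h₄, h₅⟩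
            ⟨hp, hd, hY, hX⟩
          dsimp only at h₁ h₂ h₃ h₄ h₅ hp hd hY hX
          subst h₁ h₂ hp hd hY h₃
          exact ⟨[⟨τ, hτ⟩], ((τ.tgt, X ++ τ.read.toList, []), c'),
            .single ⟨⟨rfl, rfl, rfl, rfl⟩, h₄, h₅⟩, rfl, rfl, rfl, by simp [hX]⟩)
        ⟨rfl, rfl, rfl, rfl⟩
      dsimp only at hq hc hY hX
      subst hq hc hY
      exact ⟨es, _, rfl, q, hf, X, [], c', by simpa using hX, hes⟩
  rw [← hlang]
  refine H.counterLanguage_mem_weighted (s := .rightLinear) (fun _ => rfl) _ b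
    fun es i hi t hr j => ?_
  obtain rfl : i = M.init := hi
  -- The reversal bound concerns computations on an input; the word emitted by this run is taken as
  -- that input.
  obtain ⟨-, x, -, hx⟩ := hrun hr
  have h := hb _ _ _ (hx []) j
  rw [List.map_map] at h
  exact h

/-! ### Simulation of monotone counters by counter machines -/

namespace LinearGraph

variable {T : Type} (G : LinearGraph T) {k : ℕ} (inc : G.E → Fin k → Bool)

/-- The transitions that simulate a graph with monotone counters: following an edge; leaving a
final vertex; decrementing all counters; accepting when all counters are zero. -/
def machineTransitions : Set (CounterTransition T (G.V ⊕ Bool) k) :=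
  (Set.range (fun x : G.E × (Fin k → Bool) => ⟨.inl (G.src x.1), (G.left x.1).head?, x.2,
      .inl (G.tgt x.1), fun j => boolSign (inc x.1 j)⟩) ∪
    Set.range fun x : G.final × (Fin k → Bool) => ⟨.inl x.1.1, none, x.2, .inr false,
      fun _ => 0⟩) ∪
  ({⟨.inr false, none, fun _ => true, .inr false, fun _ => -1⟩} ∪
    {⟨.inr false, none, fun _ => false, .inr true, fun _ => 0⟩})

/-- The counter machine that simulates a graph with monotone counters. -/
def machine (i : G.V) : CounterMachine T where
  Q := G.V ⊕ Bool
  k := k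
  finite_Q := inferInstance
  init := .inl i
  final := {.inr true}
  transitions := G.machineTransitions inc
  finite_transitions := ((Set.finite_range _).union (Set.finite_range _)).union
    ((Set.finite_singleton _).union (Set.finite_singleton _))

theorem machine_isReversalBounded (i : G.V) : (G.machine inc i).IsReversalBounded := by
  refine ⟨1, fun w rs s hr j => hr.numReversals_le_one (fun s => Sum.isRight s.1 = true)
    (fun r => r.delta j) ?_ ?_⟩
  · rintro r s t ⟨hr, h₁, h₂, -⟩ hs
    rw [h₁] at hs
    rw [h₂]
    rcases hr with (⟨e, rfl⟩ | ⟨f, rfl⟩) | (rfl | rfl)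
    · exact absurd hs (by simp)
    · exact absurd hs (by simp)
    · exact ⟨rfl, show (-1 : SignType) ≤ 0 by decide⟩
    · exact ⟨rfl, le_rfl⟩
  · rintro r s t ⟨hr, h₁, -⟩ hs
    rw [h₁] at hs
    rcases hr with (⟨e, rfl⟩ | ⟨f, rfl⟩) | (rfl | rfl)
    · exact boolSign_nonneg _
    · exact le_rfl
    · exact absurd rfl hs
    · exact absurd rfl hs

theorem machine_empty (i : G.V) (n : ℕ) :
    ∃ τs, LabelledRun (G.machine inc i).Step τs
      (.inr false, [], fun _ => n) (.inr true, [], fun _ => 0) := by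
  induction n with
  | zero =>
    exact ⟨_, .single ⟨.inr (.inr rfl), rfl, rfl, rfl, by simp, by simp⟩⟩
  | succ n ih =>
    obtain ⟨τs, hτs⟩ := ih
    exact ⟨_, .cons (t := (.inr false, [], fun _ => n))
      ⟨.inr (.inl rfl), rfl, rfl, rfl, by simp, by simp⟩ hτs⟩

/-- The relation between the computations of `machine` on `w` and the runs of the graph. -/
def MachineSimulation (w : List T) (a : (G.V ⊕ Bool) × List T × (Fin k → ℕ))
    (b : (G.V × List T × List T) × (Fin k → ℕ)) : Prop :=
  w = b.1.2.1 ++ a.2.1 ∧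
    match a.1 with
    | .inl v => b.1.1 = v ∧ b.2 = a.2.2
    | .inr false => b.1.1 ∈ G.final ∧ ∃ d, ∀ j, b.2 j = a.2.2 j + d
    | .inr true => b.1.1 ∈ G.final ∧ ∃ d, ∀ j, b.2 j = d

theorem machineSimulation_step (hl : ∀ e, (G.left e).length ≤ 1) (i : G.V) {w : List T}
    {τ : CounterTransition T (G.V ⊕ Bool) k} {s t : (G.V ⊕ Bool) × List T × (Fin k → ℕ)}
    {s' : (G.V × List T × List T) × (Fin k → ℕ)}
    (h : (G.machine inc i).Step τ s t) (hs : G.MachineSimulation w s s') :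
    ∃ es t', LabelledRun (G.MonotoneStep inc) es s' t' ∧ G.MachineSimulation w t t' := by
  obtain ⟨q, u, c⟩ := s
  obtain ⟨q', u', c'⟩ := t
  obtain ⟨⟨v, X, Y⟩, d⟩ := s'
  obtain ⟨hr, h₁, h₂, hu, ht, hc⟩ := h
  dsimp only at h₁ h₂ ht hc hu
  subst h₁ h₂ hu
  obtain ⟨hw, hs⟩ := hs
  dsimp only at hw
  rcases hr with (⟨⟨e, t⟩, rfl⟩ | ⟨⟨f, t⟩, rfl⟩) | (rfl | rfl)
  · obtain ⟨hv, hd⟩ := hs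
    dsimp only at hv hd
    subst hv hd
    refine ⟨[e], ((G.tgt e, X ++ G.left e, G.right e ++ Y), c'), .single
      ⟨⟨rfl, rfl, rfl, rfl⟩, fun j => ?_⟩, ?_, rfl, rfl⟩
    · have := hc j
      rw [boolSign_cast] at this
      exact_mod_cast this
    -- A transition reads at most one letter; since left words have length at most one, the head is
    -- the whole word.
    · rw [hw]
      have := hl e
      dsimp only
      rcases h : G.left e with _ | ⟨a, _ | _⟩
      · simp
      · simp
      · simp [h] at this
  · obtain ⟨hv, hd⟩ := hs
    dsimp only at hv hd
    subst hv hd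
    refine ⟨[], ((f.1, X, Y), d), .nil _, hw, f.2, 0, fun j => ?_⟩
    have := hc j
    simp at this
    simp [this]
  · obtain ⟨hf, m, hm⟩ := hs
    refine ⟨[], ((v, X, Y), d), .nil _, hw, hf, m + 1, fun j => ?_⟩
    have := hc j
    simp at this
    have := hm j
    dsimp only at this ⊢
    omega
  · obtain ⟨hf, m, hm⟩ := hs
    refine ⟨[], ((v, X, Y), d), .nil _, hw, hf, m, fun j => ?_⟩
    have h0 : c j = 0 := by simpa using ht j
    have := hm j
    dsimp only at this ⊢
    omega

end LinearGraph

theorem familyMonotone_subset_familyNCM (T : Type) :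
    familyMonotone T .rightLinear ⊆ familyNCM T := by
  rintro _ ⟨G, k, inc, i, hi, hl, -, hs, rfl⟩
  refine ⟨G.machine inc i, G.machine_isReversalBounded inc i, ?_⟩
  ext w
  constructor
  · rintro ⟨τs, _, c, rfl, hr⟩
    obtain ⟨es, ⟨⟨v, X, Y⟩, d⟩, hes, ⟨hw, hf, n, hn⟩, hY⟩ := hr.simulate
      (R := fun a b => G.MachineSimulation w a b ∧ b.1.2.2 = [])
      (fun _ _ _ _ h hR => by
        obtain ⟨es, t', hes, ht'⟩ := G.machineSimulation_step inc hl i h hR.1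
        refine ⟨es, t', hes, ht', hes.invariant (P := fun b => b.1.2.2 = []) ?_ hR.2⟩
        rintro e s t ⟨⟨-, -, -, h⟩, -⟩ hs'
        rw [h, hs', hs e, List.append_nil])
      (a' := ((i, [], []), fun _ => 0)) ⟨⟨rfl, rfl, rfl⟩, rfl⟩
    dsimp only at hw hf hn hY
    subst hY
    obtain rfl : d = fun _ => n := funext hn
    exact ⟨es, i, hi ▸ rfl, v, hf, X, [], n, hw, hes⟩
  · rintro ⟨es, i', hi', f, hf, X, Y, n, rfl, hr⟩
    rw [hi] at hi'
    obtain rfl : i' = i := hi'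
    have : ∀ {es s t}, LabelledRun (G.MonotoneStep inc) es s t → t.1.2.2 = s.1.2.2 ∧
        ∃ x, t.1.2.1 = s.1.2.1 ++ x ∧ ∀ u, ∃ τs, LabelledRun (G.machine inc i').Step τs
          (.inl s.1.1, x ++ u, s.2) (.inl t.1.1, u, t.2) := by
      intro es s t hr
      induction hr with
      | nil s => exact ⟨rfl, [], by simp, fun u => ⟨_, .nil _⟩⟩
      | @cons e es s t u h _ ih =>
        obtain ⟨⟨h₁, h₂, h₃, h₄⟩, h₅⟩ := h
        obtain ⟨hY, x, hX, hx⟩ := ih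
        rw [hs e, List.nil_append] at h₄
        refine ⟨hY.trans h₄, G.left e ++ x, ?_, fun u => ?_⟩
        · rw [hX, h₃, List.append_assoc]
        · obtain ⟨τs, hτs⟩ := hx u
          refine ⟨_, .cons (t := (.inl t.1.1, x ++ u, t.2))
            ⟨.inl (.inl ⟨(e, fun j => decide (0 < s.2 j)), rfl⟩), ?_, ?_, ?_, ?_, ?_⟩ hτs⟩
          · exact congrArg Sum.inl h₁
          · exact congrArg Sum.inl h₂
          · have := hl e
            rcases h : G.left e with _ | ⟨a, _ | _⟩
            · simp [h]
            · simp [h]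
            · simp [h] at this
          · simp
          · intro j
            have := h₅ j
            simp only [boolSign_cast]
            exact_mod_cast this
    obtain ⟨hY, x, hX, hx⟩ := this hr
    dsimp only at hY hX
    subst hY hX
    obtain ⟨τs, hτs⟩ := hx []
    obtain ⟨τs', hτs'⟩ := G.machine_empty inc i' n
    rw [List.append_nil] at hτs ⊢
    refine ⟨_, .inr true, fun _ => 0, rfl, (hτs.append (.cons (l := ⟨.inl f, none,
      fun j => decide (0 < n), .inr false, fun _ => 0⟩) ?_ hτs'))⟩
    exact ⟨.inl (.inr ⟨(⟨f, hf⟩, _), rfl⟩), rfl, rfl, rfl, by simp, by simp⟩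

/-! ### Pushdown automata with one reversal of the pushdown -/

/-- A finite graph whose edges read a word and replace the topmost symbol of a pushdown. -/
structure PushdownGraph (T : Type) where
  V : Type
  Γ : Type
  E : Type
  finite_V : Finite V
  finite_Γ : Finite Γ
  finite_E : Finite E
  init : Set V
  bottom : Γ
  final : Set V
  src : E → V
  tgt : E → V
  read : E → List T
  top : E → Γ
  push : E → List Γ

namespace PushdownGraph

open Relation

attribute [instance] finite_V finite_Γ finite_E

variable {T : Type} (P : PushdownGraph T) {ι : Type} (wt : P.E → ι → ℤ)

/-- `Pushes v σ X W`: without popping one can reach the vertex `v` with pushdown `σ`, reading `X`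
and adding the weight `W`. -/
inductive Pushes : P.V → List P.Γ → List T → (ι → ℤ) → Prop
  | init {i : P.V} (hi : i ∈ P.init) : Pushes i [P.bottom] [] 0
  | snoc {e : P.E} {γ : List P.Γ} {X : List T} {W : ι → ℤ} (he : P.push e ≠ [])
      (h : Pushes (P.src e) (P.top e :: γ) X W) :
      Pushes (P.tgt e) (P.push e ++ γ) (X ++ P.read e) (W + wt e)

/-- `Pops v σ Y W f`: from the vertex `v` with pushdown `σ` one can reach the vertex `f` with empty
pushdown without ever raising the pushdown, reading `Y` and adding the weight `W`. -/
inductive Pops : P.V → List P.Γ → List T → (ι → ℤ) → P.V → Prop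
  | nil (f : P.V) : Pops f [] [] 0 f
  | cons {e : P.E} {γ : List P.Γ} {Y : List T} {W : ι → ℤ} {f : P.V}
      (he : (P.push e).length ≤ 1) (h : Pops (P.tgt e) (P.push e ++ γ) Y W f) :
      Pops (P.src e) (P.top e :: γ) (P.read e ++ Y) (wt e + W) f

/-- The language accepted with empty pushdown and at most one reversal of the pushdown. -/
def oneTurnLanguage (con : P.V → ι → Bool) : Language T :=
  {w | ∃ v σ X W Y W' f, P.Pushes wt v σ X W ∧ P.Pops wt v σ Y W' f ∧ f ∈ P.final ∧ w = X ++ Y ∧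
    ∀ j, Meets (con f j) (W j + W' j)}

variable {P wt}

/-- The cut is made when the last symbol above `γ` has disappeared; up to then `γ` is untouched. -/
theorem Pops.split {v f : P.V} {σ β γ : List P.Γ} {Y : List T} {W : ι → ℤ}
    (h : P.Pops wt v σ Y W f) (hσ : σ = β ++ γ) : ∃ u Y₁ W₁ Y₂ W₂, P.Pops wt v β Y₁ W₁ u ∧
      P.Pops wt u γ Y₂ W₂ f ∧ Y = Y₁ ++ Y₂ ∧ W = W₁ + W₂ := by
  induction h generalizing β with
  | nil f =>
    obtain ⟨rfl, rfl⟩ := List.append_eq_nil_iff.mp hσ.symm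
    exact ⟨f, [], 0, [], 0, .nil _, .nil _, rfl, by simp⟩
  | @cons e γ' Y W f he h ih =>
    cases β with
    | nil =>
      rw [List.nil_append] at hσ
      subst hσ
      exact ⟨_, [], 0, _, _, .nil _, .cons he h, rfl, by simp⟩
    | cons b β =>
      obtain ⟨rfl, rfl⟩ := List.cons.inj hσ
      obtain ⟨u, Y₁, W₁, Y₂, W₂, h₁, h₂, rfl, rfl⟩ := ih (β := P.push e ++ β) (by simp)
      exact ⟨u, _, _, Y₂, W₂, .cons he h₁, h₂, by simp, by simp [add_assoc]⟩

/-- The constraint can therefore be read off at the turn, where runs of `twoSided` end, instead of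
at the accepting vertex. -/
theorem Pops.con_eq {con : P.V → ι → Bool} (hcon : ∀ e, con (P.src e) = con (P.tgt e))
    {v f : P.V} {σ : List P.Γ} {Y : List T} {W : ι → ℤ} (h : P.Pops wt v σ Y W f) :
    con v = con f := by
  induction h with
  | nil => rfl
  | cons _ _ ih => rw [hcon, ih]

variable (P) in
/-- The graph that follows the part of a computation before the reversal of the pushdown forwards,
and the part after it backwards. In `(p, A, q, β)`, the first part has reached `p` with `A` on top
of some `γ`, and the second part starts from `q` with `β` on top of `γ`. -/
def twoSided (B : ℕ) : LinearGraph T where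
  V := P.V × P.Γ × P.V × {β : List P.Γ // β.length ≤ B}
  E := ({e : P.E // P.push e ≠ [] ∧ (P.push e).length ≤ B} × P.V) ⊕
    (P.V × P.Γ × {x : P.E × {β : List P.Γ // β.length ≤ B} //
      (P.push x.1).length ≤ 1 ∧ x.2.1.length + 1 ≤ B})
  finite_V := inferInstance
  finite_E := inferInstance
  -- The first part is at its beginning and the second part at its end, where the pushdown is empty;
  -- the common `γ` is empty.
  init := {v | v.1 ∈ P.init ∧ v.2.1 = P.bottom ∧ v.2.2.1 ∈ P.final ∧ v.2.2.2.1 = []}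
  -- The two parts meet at the turn: same vertex, same pushdown `A :: γ`.
  final := {v | v.1 = v.2.2.1 ∧ v.2.2.2.1 = [v.2.1]}
  src
    -- The first part buries the tail of `push e`. Before this step the second part must hold
    -- exactly this tail above the old `γ`; afterwards the tail belongs to the new `γ` and nothing
    -- is left above it.
    | .inl (e, q) => (P.src e, P.top e, q, ⟨(P.push e).tail, by have := e.2.2; simp; omega⟩)
    | .inr (p, A, x) => (p, A, P.tgt x.1.1, ⟨P.push x.1.1 ++ x.1.2.1, by
        have := x.2; simp; omega⟩)
  tgt
    | .inl (e, q) => (P.tgt e, (P.push e).head e.2.1, q, ⟨[], Nat.zero_le _⟩)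
    | .inr (p, A, x) => (p, A, P.src x.1.1, ⟨P.top x.1.1 :: x.1.2.1, x.2.2⟩)
  left
    | .inl (e, _) => P.read e
    | .inr _ => []
  right
    | .inl _ => []
    | .inr (_, _, x) => P.read x.1.1

variable (P wt) in
/-- The weights of the edges of `twoSided`. -/
def twoSidedWt (B : ℕ) : (P.twoSided B).E → ι → ℤ
  | .inl (e, _) => wt e
  | .inr (_, _, x) => wt x.1.1

variable (P wt) in
/-- The vertex `(p, A, q, β)` of `twoSided` can be reached with emitted words `X` and `Y` and
weight `W`. -/
def Reaches {B : ℕ} (p : P.V) (A : P.Γ) (q : P.V) (β : List P.Γ) (X Y : List T) (W : ι → ℤ) :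
    Prop :=
  ∃ hβ, ∃ es, ∃ i ∈ (P.twoSided B).init,
    LabelledRun ((P.twoSided B).WeightedStep (P.twoSidedWt wt B)) es ((i, [], []), 0)
      (((p, A, q, ⟨β, hβ⟩), X, Y), W)

/-- The second part is followed backwards from `u` to `q`. It never raises the pushdown, so no
intermediate `β` is longer than the one at `q`; this is why a bounded `β` suffices. -/
theorem Pops.reaches {B : ℕ} {q u : P.V} {β : List P.Γ} {y : List T} {w : ι → ℤ}
    (h : P.Pops wt q β y w u) (hβ : β.length ≤ B) {p : P.V} {A : P.Γ} {X Y : List T} {W : ι → ℤ}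
    (hr : P.Reaches wt (B := B) p A u [] X Y W) :
    P.Reaches wt (B := B) p A q β X (y ++ Y) (W + w) := by
  induction h with
  | nil => simpa using hr
  | @cons e γ y w f he h ih =>
    simp only [List.length_cons] at hβ
    obtain ⟨hβ', es, i, hi, hes⟩ := ih (by simp; omega) hr
    refine ⟨hβ, es ++ [.inr (p, A, ⟨(e, ⟨γ, by omega⟩), he, hβ⟩)], i, hi,
      hes.append (.single ⟨⟨rfl, rfl, ?_, ?_⟩, ?_⟩)⟩
    · simp [twoSided]
    · simp [twoSided]
    · simp only [twoSidedWt]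
      abel

/-- The second part is cut into the removal of the tail buried by the last move and the removal of
everything below it. The latter is matched with the earlier moves by induction; the former is then
followed backwards, before the last move is made. -/
theorem Pushes.reaches {B : ℕ} (hB : ∀ e, (P.push e).length ≤ B) {p : P.V} {σ : List P.Γ}
    {X : List T} {W : ι → ℤ} (h : P.Pushes wt p σ X W) {A : P.Γ} {γ : List P.Γ}
    (hσ : σ = A :: γ) {q f : P.V} {Y : List T} {W' : ι → ℤ} (h' : P.Pops wt q γ Y W' f)
    (hf : f ∈ P.final) : P.Reaches wt (B := B) p A q [] X Y (W + W') := by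
  induction h generalizing A γ q Y W' with
  | @init i hi =>
    obtain ⟨rfl, rfl⟩ := List.cons.inj hσ
    cases h'
    exact ⟨Nat.zero_le _, [], _, ⟨hi, rfl, hf, rfl⟩, by simpa using .nil _⟩
  | @snoc e γ₀ X W he h ih =>
    obtain ⟨B', σ', hpush⟩ := List.exists_cons_of_ne_nil he
    rw [hpush] at hσ
    obtain ⟨rfl, rfl⟩ := List.cons.inj hσ
    obtain ⟨u, Y₁, W₁, Y₂, W₂, h₁, h₂, rfl, rfl⟩ := h'.split rfl
    have hlen := hB e
    rw [hpush, List.length_cons] at hlen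
    obtain ⟨hβ, es, i, hi, hes⟩ := h₁.reaches (by omega) (ih rfl h₂)
    refine ⟨Nat.zero_le _, es ++ [.inl (⟨e, he, hB e⟩, q)], i, hi,
      hes.append (.single ⟨⟨?_, ?_, ?_, ?_⟩, ?_⟩)⟩
    · simp [twoSided, hpush]
    · simp [twoSided, hpush]
    · simp [twoSided]
    · simp [twoSided]
    · simp only [twoSidedWt]
      abel

/-- For every reachable vertex some `γ` exists such that the first part has built `A :: γ` and the
second part accepts from `β ++ γ`; at a final vertex the two parts fit together. -/
theorem twoSided_language {con : P.V → ι → Bool} (hcon : ∀ e, con (P.src e) = con (P.tgt e))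
    {B : ℕ} (hB : ∀ e, (P.push e).length ≤ B) (hB' : 1 ≤ B) :
    (P.twoSided B).weightedLanguage (P.twoSidedWt wt B) (fun v => con v.1) =
      P.oneTurnLanguage wt con := by
  ext w
  constructor
  · rintro ⟨es, i, hi, ⟨p, A, q, β⟩, ⟨hpq, hβ⟩, X, Y, W, rfl, hr, hW⟩
    dsimp only at hpq hβ
    subst hpq
    obtain ⟨γ, W₁, W₂, f, hf, h₁, h₂, hW'⟩ := hr.invariant
      (P := fun s => ∃ γ W₁ W₂, ∃ f ∈ P.final, P.Pushes wt s.1.1.1 (s.1.1.2.1 :: γ) s.1.2.1 W₁ ∧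
        P.Pops wt s.1.1.2.2.1 (s.1.1.2.2.2.1 ++ γ) s.1.2.2 W₂ f ∧ s.2 = W₁ + W₂) (by
        rintro e ⟨⟨s, X, Y⟩, W⟩ ⟨⟨t, X', Y'⟩, W'⟩ ⟨⟨h₁, h₂, h₃, h₄⟩, h₅⟩
          ⟨γ, W₁, W₂, f, hf, hpush, hpop, hW⟩
        dsimp only at h₁ h₂ h₃ h₄ h₅ hpush hpop hW
        subst h₁ h₂ h₃ h₄ h₅ hW
        rcases e with ⟨e, q⟩ | ⟨p, A, ⟨e, β⟩, he, hβ⟩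
        · refine ⟨(P.push e).tail ++ γ, W₁ + wt e, W₂, f, hf, ?_, hpop, ?_⟩
          · have := Pushes.snoc e.2.1 hpush
            rw [← List.cons_head_tail e.2.1, List.cons_append] at this
            exact this
          · simp only [twoSidedWt]
            abel
        · refine ⟨γ, W₁, wt e + W₂, f, hf, ?_, Pops.cons he (by simpa [twoSided] using hpop), ?_⟩
          · simpa [twoSided] using hpush
          · simp only [twoSidedWt]
            abel)
      (by
        obtain ⟨h₁, h₂, h₃, h₄⟩ := hi
        refine ⟨[], 0, 0, _, h₃, ?_, ?_, by simp⟩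
        · rw [h₂]
          exact .init h₁
        · rw [h₄]
          exact .nil _)
    dsimp only at h₁ h₂ hW'
    rw [hβ] at h₂
    refine ⟨p, _, X, W₁, Y, W₂, f, h₁, h₂, hf, rfl, fun j => ?_⟩
    rw [← h₂.con_eq hcon]
    have := hW j
    rw [hW'] at this
    exact this
  · rintro ⟨v, σ, X, W, Y, W', f, h₁, h₂, hf, rfl, hW⟩
    obtain ⟨A, γ, rfl⟩ : ∃ A γ, σ = A :: γ := by
      apply List.exists_cons_of_ne_nil
      cases h₁ with
      | init => simp
      | snoc he => simp [he]
    -- The second part begins with the whole pushdown `A :: γ`; the moves that remove `A` are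
    -- followed last.
    obtain ⟨u, Y₁, W₁, Y₂, W₂, h₃, h₄, rfl, rfl⟩ := h₂.split (β := [A]) rfl
    obtain ⟨hβ, es, i, hi, hes⟩ := h₃.reaches (B := B) (by simpa using hB')
      (h₁.reaches hB rfl h₄ hf)
    refine ⟨es, i, hi, _, ⟨rfl, rfl⟩, X, _, _, rfl, hes, fun j => ?_⟩
    dsimp only
    rw [h₂.con_eq hcon]
    have := hW j
    simp only [Pi.add_apply] at this ⊢
    rwa [add_assoc, add_comm (W₂ j)]

theorem oneTurnLanguage_mem_weighted [Finite ι] (con : P.V → ι → Bool)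
    (hcon : ∀ e, con (P.src e) = con (P.tgt e)) :
    P.oneTurnLanguage wt con ∈ familyWeighted T .linear := by
  have := Fintype.ofFinite P.E
  -- The summand `1` leaves room for `β = [A]` at the meeting point.
  refine ⟨P.twoSided (1 + ∑ e, (P.push e).length), ι, inferInstance, _, _, fun _ => trivial,
    twoSided_language hcon (fun e => ?_) (by omega)⟩
  exact (Finset.single_le_sum (f := fun e => (P.push e).length) (fun _ _ => Nat.zero_le _)
    (Finset.mem_univ e)).trans (by omega)

end PushdownGraph

theorem LabelledRun.of_append {S L : Type} {step : L → S → S → Prop} {l₁ l₂ : List L} {a c : S}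
    (h : LabelledRun step (l₁ ++ l₂) a c) :
    ∃ b, LabelledRun step l₁ a b ∧ LabelledRun step l₂ b c := by
  induction l₁ generalizing a with
  | nil => exact ⟨a, .nil _, h⟩
  | cons l l₁ ih =>
    cases h with
    | cons h hs =>
      obtain ⟨b, h₁, h₂⟩ := ih hs
      exact ⟨b, .cons h h₁, h₂⟩

theorem LabelledRun.and_mem {S L : Type} {step : L → S → S → Prop} {p : L → Prop} {ls : List L}
    {a b : S} (h : LabelledRun step ls a b) (hp : ∀ l ∈ ls, p l) :
    LabelledRun (fun l s t => p l ∧ step l s t) ls a b := by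
  induction h with
  | nil => exact .nil _
  | cons h _ ih => exact .cons ⟨hp _ (by simp), h⟩ (ih fun l hl => hp l (by simp [hl]))

/-- The cut is made just before the first pop. -/
theorem exists_turn {T Q Γ : Type} {k : ℕ} {τs : List (PushdownCounterTransition T Q Γ k)}
    (h : τs.Pairwise fun τ τ' => τ.push.length < 1 → ¬ 1 < τ'.push.length) :
    ∃ l₁ l₂, τs = l₁ ++ l₂ ∧ (∀ τ ∈ l₁, τ.push ≠ []) ∧ ∀ τ ∈ l₂, τ.push.length ≤ 1 := by
  induction τs with
  | nil => exact ⟨[], [], rfl, by simp, by simp⟩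
  | cons τ τs ih =>
    rw [List.pairwise_cons] at h
    by_cases hτ : τ.push = []
    · refine ⟨[], τ :: τs, rfl, by simp, fun τ' hτ' => ?_⟩
      rcases List.mem_cons.mp hτ' with rfl | hτ'
      · simp [hτ]
      · simpa [hτ] using h.1 τ' hτ'
    · obtain ⟨l₁, l₂, rfl, h₁, h₂⟩ := ih h.2
      refine ⟨τ :: l₁, l₂, rfl, fun τ' hτ' => ?_, h₂⟩
      rcases List.mem_cons.mp hτ' with rfl | hτ'
      exacts [hτ, h₁ _ hτ']

/-! ### Reduction of pushdown counter machines to pushdown graphs -/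

namespace PushdownCounterMachine

variable {T : Type} (M : PushdownCounterMachine T)

/-- A move between configurations without counters. -/
def PlainStep (τ : PushdownCounterTransition T M.Q M.Γ M.k) (s t : M.Q × List T × List M.Γ) :
    Prop :=
  τ ∈ M.transitions ∧ s.1 = τ.src ∧ t.1 = τ.tgt ∧ s.2.1 = τ.read.toList ++ t.2.1 ∧
    ∃ γ : List M.Γ, s.2.2 = τ.top :: γ ∧ t.2.2 = τ.push ++ γ

variable {M} in
theorem run_iff {τs : List (PushdownCounterTransition T M.Q M.Γ M.k)}
    {s t : M.Q × List T × (Fin M.k → ℕ) × List M.Γ} :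
    LabelledRun M.Step τs s t ↔
      LabelledRun M.PlainStep τs (s.1, s.2.1, s.2.2.2) (t.1, t.2.1, t.2.2.2) ∧
      LabelledRun CountersStep (τs.map fun τ => (τ.test, τ.delta)) s.2.2.1 t.2.2.1 := by
  rw [← LabelledRun.prod_iff (a := ((s.1, s.2.1, s.2.2.2), s.2.2.1))
    (b := ((t.1, t.2.1, t.2.2.2), t.2.2.1))]
  constructor
  · intro h
    have := h.mono (f := fun τ => τ)
      (g := fun s : M.Q × List T × (Fin M.k → ℕ) × List M.Γ => ((s.1, s.2.1, s.2.2.2), s.2.2.1))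
      (step' := fun τ p q => M.PlainStep τ p.1 q.1 ∧ CountersStep (τ.test, τ.delta) p.2 q.2)
      fun τ s t ⟨h₁, h₂, h₃, h₄, h₅, h₆, h₇⟩ => ⟨⟨h₁, h₂, h₃, h₄, h₇⟩, h₅, h₆⟩
    rwa [List.map_id'] at this
  · intro h
    have := h.mono (f := fun τ => τ)
      (g := fun s : (M.Q × List T × List M.Γ) × (Fin M.k → ℕ) =>
        (s.1.1, s.1.2.1, s.2, s.1.2.2)) (step' := M.Step)
      fun τ s t ⟨⟨h₁, h₂, h₃, h₄, h₇⟩, h₅, h₆⟩ => ⟨h₁, h₂, h₃, h₄, h₅, h₆, h₇⟩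
    rwa [List.map_id'] at this

variable {K : ℕ}

/-- A move between configurations in which the computations of the counters are divided into
stretches. -/
def StretchedStep (D : Fin M.k → Fin K → Bool × SignType)
    (τ : PushdownCounterTransition T M.Q M.Γ M.k)
    (s t : (M.Q × List T × List M.Γ) × (Fin M.k → Fin K) × (Fin M.k × Fin K × Bool → ℤ)) : Prop :=
  M.PlainStep τ s.1 t.1 ∧ StretchesStep D (τ.test, τ.delta) s.2 t.2

/-- The pushdown graph of the machine, with the counters replaced by their stretches. At the end
of a computation the pushdown is emptied. -/
def graph [Finite M.transitions] [NeZero K] : PushdownGraph T where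
  V := (M.Q × Bool) × (Fin M.k → Fin K → Bool × SignType) × (Fin M.k → Fin K)
  Γ := M.Γ
  E := {x : M.transitions × (Fin M.k → Fin K → Bool × SignType) × (Fin M.k → Fin K) ×
      (Fin M.k → Fin K) // ∀ j, StretchStep (x.2.1 j) (x.1.1.test j, x.1.1.delta j)
        (x.2.2.1 j, 0) (x.2.2.2 j, stretchWt (x.2.2.1 j) (x.2.2.2 j) (x.1.1.delta j))} ⊕
    -- These edges empty the pushdown in a final state. Their target carries the flag `true`, where
    -- no genuine move starts.
    (M.final × Bool × (Fin M.k → Fin K → Bool × SignType) × (Fin M.k → Fin K) × M.Γ)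
  finite_V := by have := M.finite_Q; infer_instance
  finite_Γ := M.finite_Γ
  finite_E := by have := M.finite_Q; have := M.finite_Γ; infer_instance
  init := {v | v.1 = (M.init, false) ∧ v.2.2 = fun _ => 0}
  bottom := M.bottom
  final := {v | v.1.1 ∈ M.final}
  src
    | .inl x => ((x.1.1.1.src, false), x.1.2.1, x.1.2.2.1)
    | .inr (f, b, D, m, _) => ((f, b), D, m)
  tgt
    | .inl x => ((x.1.1.1.tgt, false), x.1.2.1, x.1.2.2.2)
    | .inr (f, _, D, m, _) => ((f, true), D, m)
  read
    | .inl x => x.1.1.1.read.toList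
    | .inr _ => []
  top
    | .inl x => x.1.1.1.top
    | .inr (_, _, _, _, A) => A
  push
    | .inl x => x.1.1.1.push
    | .inr _ => []

variable [Finite M.transitions] [NeZero K]

/-- The weights of the edges of `graph`. -/
def graphWt : (M.graph (K := K)).E → Fin M.k × Fin K × Bool → ℤ
  | .inl x, p => stretchWt (x.1.2.2.1 p.1) (x.1.2.2.2 p.1) (x.1.1.1.delta p.1) p.2
  | .inr _, _ => 0

/-- The constraints belonging to the vertices of `graph`. -/
def graphCon (v : (M.graph (K := K)).V) (p : Fin M.k × Fin K × Bool) : Bool := (v.2.1 p.1 p.2.1).1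

theorem graphCon_eq (e : (M.graph (K := K)).E) :
    M.graphCon (M.graph.src e) = M.graphCon (M.graph.tgt e) := by
  rcases e with x | ⟨f, b, D, m, A⟩ <;> rfl

variable {M}

/-- Edges that empty the pushdown are pops, so before the turn only genuine moves occur. -/
theorem run_of_pushes {v : (M.graph (K := K)).V} {σ : List M.Γ} {X : List T}
    {W : Fin M.k × Fin K × Bool → ℤ} (h : M.graph.Pushes M.graphWt v σ X W) :
    v.1.2 = false ∧ ∃ τs, ∀ u, LabelledRun (M.StretchedStep v.2.1) τs
      ((M.init, X ++ u, [M.bottom]), fun _ => 0, 0) ((v.1.1, u, σ), v.2.2, W) := by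
  induction h with
  | @init i hi =>
    obtain ⟨⟨q, b⟩, D, m⟩ := i
    obtain ⟨h, rfl⟩ := hi
    obtain ⟨rfl, rfl⟩ := Prod.mk.inj h
    exact ⟨rfl, [], fun u => .nil _⟩
  | @snoc e γ X W he h ih =>
    rcases e with ⟨⟨τ, D, m, m'⟩, hx⟩ | ⟨f, b, D, m, A⟩
    · obtain ⟨-, τs, hτs⟩ := ih
      refine ⟨rfl, τs ++ [τ.1], fun u => ?_⟩
      have := hτs (τ.1.read.toList ++ u)
      rw [← List.append_assoc] at this
      refine this.append (.single ⟨⟨τ.2, rfl, rfl, rfl, γ, rfl, rfl⟩, fun j => ?_⟩)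
      exact ⟨(hx j).1, (hx j).2.1, rfl⟩
    · exact absurd rfl he

/-- Once the flag is raised, only emptying moves remain, which read nothing and have weight zero;
the genuine computation stops there, with some pushdown `σ'` left. -/
theorem run_of_pops {v f : (M.graph (K := K)).V} {σ : List M.Γ} {Y : List T}
    {W : Fin M.k × Fin K × Bool → ℤ} (h : M.graph.Pops M.graphWt v σ Y W f) :
    (v.1.2 = true → v.1.1 = f.1.1 ∧ Y = [] ∧ W = 0) ∧ (v.1.2 = false → ∃ τs m σ', ∀ W₀,
      LabelledRun (M.StretchedStep v.2.1) τs
        ((v.1.1, Y, σ), v.2.2, W₀) ((f.1.1, [], σ'), m, W₀ + W)) := by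
  induction h with
  | nil f => exact ⟨fun _ => ⟨rfl, rfl, rfl⟩, fun _ => ⟨[], _, _, fun W₀ => by simpa using .nil _⟩⟩
  | @cons e γ Y W f he h ih =>
    rcases e with ⟨⟨τ, D, m, m'⟩, hx⟩ | ⟨f', b, D, m, A⟩
    · refine ⟨fun h => absurd h (by simp [graph]), fun _ => ?_⟩
      obtain ⟨τs, m'', σ', hτs⟩ := ih.2 rfl
      refine ⟨τ.1 :: τs, m'', σ', fun W₀ => ?_⟩
      have := hτs (W₀ + M.graphWt (.inl ⟨(τ, D, m, m'), hx⟩))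
      rw [add_assoc] at this
      refine .cons ⟨⟨τ.2, rfl, rfl, rfl, γ, rfl, rfl⟩, fun j => ?_⟩ this
      exact ⟨(hx j).1, (hx j).2.1, rfl⟩
    · obtain ⟨h₁, rfl, rfl⟩ := ih.1 rfl
      have hW : M.graphWt (K := K) (.inr (f', b, D, m, A)) + 0 = 0 := by
        funext p
        simp [graphWt]
      refine ⟨fun _ => ⟨h₁, rfl, hW⟩, fun _ => ⟨[], m, A :: γ, fun W₀ => ?_⟩⟩
      rw [hW, ← h₁, add_zero]
      exact .nil _

theorem pops_discard {f : M.Q} (hf : f ∈ M.final) (D : Fin M.k → Fin K → Bool × SignType)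
    (m : Fin M.k → Fin K) (σ : List M.Γ) (b : Bool) :
    ∃ b', (M.graph (K := K)).Pops M.graphWt ((f, b), D, m) σ [] 0 ((f, b'), D, m) := by
  induction σ generalizing b with
  | nil => exact ⟨b, .nil _⟩
  | cons A σ ih =>
    obtain ⟨b', h⟩ := ih true
    refine ⟨b', ?_⟩
    have := PushdownGraph.Pops.cons (P := M.graph (K := K)) (wt := M.graphWt)
      (e := .inr (⟨f, hf⟩, b, D, m, A)) (by simp [graph]) h
    have hW : M.graphWt (K := K) (.inr (⟨f, hf⟩, b, D, m, A)) + 0 = 0 := by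
      funext p
      simp [graphWt]
    rw [hW] at this
    exact this

/-- The edge of `graph` that belongs to a move. -/
theorem exists_edge {D : Fin M.k → Fin K → Bool × SignType}
    {τ : PushdownCounterTransition T M.Q M.Γ M.k}
    {s t : (M.Q × List T × List M.Γ) × (Fin M.k → Fin K) × (Fin M.k × Fin K × Bool → ℤ)}
    (h : M.StretchedStep D τ s t) : ∃ e : (M.graph (K := K)).E,
      M.graph.src e = ((s.1.1, false), D, s.2.1) ∧ M.graph.tgt e = ((t.1.1, false), D, t.2.1) ∧
      M.graph.push e = τ.push ∧ s.1.2.1 = M.graph.read e ++ t.1.2.1 ∧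
      t.2.2 = s.2.2 + M.graphWt e ∧
      ∃ γ : List (M.graph (K := K)).Γ, s.1.2.2 = M.graph.top e :: γ ∧
        t.1.2.2 = M.graph.push e ++ γ := by
  obtain ⟨⟨h₁, h₂, h₃, h₄, h₅⟩, h₆⟩ := h
  refine ⟨.inl ⟨(⟨τ, h₁⟩, D, s.2.1, t.2.1), fun j => ⟨(h₆ j).1, (h₆ j).2.1, by simp⟩⟩, ?_, ?_, rfl,
    h₄, ?_, h₅⟩
  · rw [h₂]; rfl
  · rw [h₃]; rfl
  · funext ⟨j, p⟩
    exact congrFun (h₆ j).2.2 p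

/-- The reversal bounds enter in passing from the machine to the graph: an accepting computation is
divided into stretches and cut at its turn, and what is left on the pushdown is discarded. -/
theorem oneTurnLanguage_graph (b : ℕ) (hK : K = 2 * b + 4)
    (hb : ∀ w τs s, LabelledRun M.Step τs (M.initial w) s →
      ∀ j, numReversals (τs.map fun τ => τ.delta j) ≤ b) (hM : M.IsOneReversalPushdown) :
    (M.graph (K := K)).oneTurnLanguage M.graphWt M.graphCon = M.language := by
  ext w
  constructor
  · rintro ⟨v, σ, X, W, Y, W', f, h₁, h₂, hf, rfl, hW⟩
    obtain ⟨hv, τs₁, hτs₁⟩ := run_of_pushes h₁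
    obtain ⟨τs₂, m, σ', hτs₂⟩ := (run_of_pops h₂).2 hv
    obtain ⟨h₃, h₄⟩ := LabelledRun.prod_iff.mp ((hτs₁ Y).append (hτs₂ W))
    rw [← h₂.con_eq M.graphCon_eq] at hW
    obtain ⟨c, hc⟩ := stretches_sound h₄ fun j i b => hW (j, i, b)
    exact ⟨_, f.1.1, c, σ', hf, run_iff.mpr ⟨h₃, hc⟩⟩
  · rintro ⟨τs, f, c, σ, hf, hr⟩
    have hturn := hM w τs _ hr
    obtain ⟨h₁, h₂⟩ := run_iff.mp hr
    subst hK
    obtain ⟨D, ⟨m, W⟩, h₃, hW⟩ := stretches_complete h₂ (b := b) fun j => by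
      rw [List.map_map]
      exact hb w τs _ hr j
    have h₄ : LabelledRun (M.StretchedStep D) τs ((M.init, w, [M.bottom]), fun _ => 0, 0)
        ((f, [], σ), m, W) := LabelledRun.prod_iff.mpr ⟨h₁, h₃⟩
    obtain ⟨l₁, l₂, rfl, hl₁, hl₂⟩ := exists_turn hturn
    obtain ⟨⟨⟨q, u, σ₁⟩, m₁, W₁⟩, h₅, h₆⟩ := h₄.of_append
    have h₇ := (h₅.and_mem hl₁).invariant (P := fun s => ∃ X, w = X ++ s.1.2.1 ∧
      (M.graph).Pushes M.graphWt ((s.1.1, false), D, s.2.1) s.1.2.2 X s.2.2) (by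
        rintro τ s t ⟨hτ, h⟩ ⟨X, hX, hs⟩
        obtain ⟨e, e₁, e₂, e₃, e₄, e₅, γ, e₆, e₇⟩ := exists_edge h
        rw [← e₁, e₆] at hs
        have := PushdownGraph.Pushes.snoc (e₃ ▸ hτ) hs
        rw [e₂, ← e₅, ← e₇] at this
        exact ⟨_, by rw [hX, e₄, List.append_assoc], this⟩)
      ⟨[], rfl, PushdownGraph.Pushes.init (P := M.graph (K := 2 * b + 4)) (wt := M.graphWt)
        (i := ((M.init, false), D, fun _ => 0)) ⟨rfl, rfl⟩⟩
    obtain ⟨X, rfl, hpush⟩ := h₇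
    have h₈ : ∃ b' W₂, (M.graph).Pops M.graphWt ((q, false), D, m₁) σ₁ u W₂ ((f, b'), D, m) ∧
        W = W₁ + W₂ := by
      have h₉ := h₆.and_mem hl₂
      clear h₆
      generalize hs : ((q, u, σ₁), m₁, W₁) = s at h₉
      generalize ht : ((f, ([] : List T), σ), m, W) = t at h₉
      suffices ∃ b' W₂, (M.graph).Pops M.graphWt ((s.1.1, false), D, s.2.1) s.1.2.2 s.1.2.1 W₂
          ((f, b'), D, m) ∧ W = s.2.2 + W₂ by
        rw [← hs] at this
        exact this
      clear hs hpush h₅ hr h₁ h₂ h₃ h₄ hturn hl₁ hl₂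
      induction h₉ with
      | nil =>
        subst ht
        obtain ⟨b', h⟩ := pops_discard hf D m σ false
        exact ⟨b', 0, h, by simp⟩
      | cons h _ ih =>
        obtain ⟨b', W₂, h', hW'⟩ := ih ht
        obtain ⟨e, e₁, e₂, e₃, e₄, e₅, γ, e₆, e₇⟩ := exists_edge h.2
        rw [← e₂, e₇] at h'
        have := PushdownGraph.Pops.cons (e₃ ▸ h.1) h'
        rw [e₁, ← e₄, ← e₆] at this
        exact ⟨b', _, this, by rw [hW', e₅, add_assoc]⟩
    obtain ⟨b', W₂, hpop, hW'⟩ := h₈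
    refine ⟨_, _, X, W₁, u, W₂, _, hpush, hpop, hf, rfl, fun p => ?_⟩
    have := hW p.1 p.2.1 p.2.2
    dsimp only at this
    rw [hW'] at this
    exact this

end PushdownCounterMachine

theorem familyNPCM1_subset_familyWeighted (T : Type) :
    familyNPCM1 T ⊆ familyWeighted T .linear := by
  rintro _ ⟨M, ⟨b, hb⟩, hM, rfl⟩
  have := M.finite_transitions.to_subtype
  rw [← M.oneTurnLanguage_graph b rfl hb hM]
  exact PushdownGraph.oneTurnLanguage_mem_weighted _ M.graphCon_eq

/-- A `p`-step leads into the region `P`, which is never left and in which no `q`-step is possible.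
-/
theorem LabelledRun.pairwise {S L : Type} {step : L → S → S → Prop} {p q : L → Prop} (P : S → Prop)
    (h₁ : ∀ l s t, step l s t → p l → P t) (h₂ : ∀ l s t, step l s t → P s → P t ∧ ¬ q l)
    {ls : List L} {a b : S} (hr : LabelledRun step ls a b) :
    ls.Pairwise fun l l' => p l → ¬ q l' := by
  have key : ∀ {ls : List L} {a b : S}, LabelledRun step ls a b → P a → ∀ l ∈ ls, ¬ q l := by
    intro ls a b hr ha
    induction hr with
    | nil => simp
    | cons h _ ih =>
      have := h₂ _ _ _ h ha
      simpa [this.2] using ih this.1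
  induction hr with
  | nil => exact .nil
  | cons h hs ih => exact .cons (fun l' hl' hp => key hs (h₁ _ _ _ h hp) l' hl') ih

theorem head?_toList_of_length_le_one {T : Type} {l : List T} (h : l.length ≤ 1) :
    l.head?.toList = l := by
  rcases l with _ | ⟨a, _ | _⟩
  · rfl
  · rfl
  · simp at h

/-! ### Simulation of monotone counters by pushdown machines -/

namespace LinearGraph

variable {T : Type} (G : LinearGraph T) {k : ℕ} (inc : G.E → Fin k → Bool)

/-- The transitions of a pushdown machine that simulate a graph with monotone counters: following
an edge, with the right words kept on the pushdown; leaving a final vertex; comparing the pushdown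
with the input; finding the pushdown empty; decrementing all counters; accepting when all counters
are zero. -/
inductive IsPushdownTransition :
    PushdownCounterTransition T (G.V ⊕ Option Bool) (Option T) k → Prop
  | edge (e : G.E) (t : Fin k → Bool) (g : Option T) : IsPushdownTransition
      ⟨.inl (G.src e), (G.left e).head?, g, t, .inl (G.tgt e), (G.right e).map some ++ [g],
        fun j => boolSign (inc e j)⟩
  | leave (f : G.final) (t : Fin k → Bool) (g : Option T) : IsPushdownTransition
      ⟨.inl f.1, none, g, t, .inr none, [g], fun _ => 0⟩
  | pop (t : Fin k → Bool) (a : T) : IsPushdownTransition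
      ⟨.inr none, some a, some a, t, .inr none, [], fun _ => 0⟩
  | bottom (t : Fin k → Bool) : IsPushdownTransition
      ⟨.inr none, none, none, t, .inr (some false), [none], fun _ => 0⟩
  | decrement : IsPushdownTransition
      ⟨.inr (some false), none, none, fun _ => true, .inr (some false), [none], fun _ => -1⟩
  | accept : IsPushdownTransition
      ⟨.inr (some false), none, none, fun _ => false, .inr (some true), [none], fun _ => 0⟩

theorem finite_isPushdownTransition [Finite T] : {τ | G.IsPushdownTransition inc τ}.Finite := by
  have h₁ := Set.finite_range fun x : G.E × (Fin k → Bool) × Option T =>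
    (⟨.inl (G.src x.1), (G.left x.1).head?, x.2.2, x.2.1, .inl (G.tgt x.1),
      (G.right x.1).map some ++ [x.2.2], fun j => boolSign (inc x.1 j)⟩ :
      PushdownCounterTransition T (G.V ⊕ Option Bool) (Option T) k)
  have h₂ := Set.finite_range fun x : G.final × (Fin k → Bool) × Option T =>
    (⟨.inl x.1.1, none, x.2.2, x.2.1, .inr none, [x.2.2], fun _ => 0⟩ :
      PushdownCounterTransition T (G.V ⊕ Option Bool) (Option T) k)
  have h₃ := Set.finite_range fun x : (Fin k → Bool) × T =>
    (⟨.inr none, some x.2, some x.2, x.1, .inr none, [], fun _ => 0⟩ :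
      PushdownCounterTransition T (G.V ⊕ Option Bool) (Option T) k)
  have h₄ := Set.finite_range fun t : Fin k → Bool =>
    (⟨.inr none, none, none, t, .inr (some false), [none], fun _ => 0⟩ :
      PushdownCounterTransition T (G.V ⊕ Option Bool) (Option T) k)
  have h₅ := Set.finite_range fun b : Bool =>
    (⟨.inr (some false), none, none, fun _ => b, .inr (some (!b)), [none],
      fun _ => -boolSign b⟩ : PushdownCounterTransition T (G.V ⊕ Option Bool) (Option T) k)
  refine ((((h₁.union h₂).union h₃).union h₄).union h₅).subset ?_
  rintro _ (⟨e, t, g⟩ | ⟨f, t, g⟩ | ⟨t, a⟩ | t | _ | _)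
  · exact .inl (.inl (.inl (.inl ⟨(e, t, g), rfl⟩)))
  · exact .inl (.inl (.inl (.inr ⟨(f, t, g), rfl⟩)))
  · exact .inl (.inl (.inr ⟨(t, a), rfl⟩))
  · exact .inl (.inr ⟨t, rfl⟩)
  · exact .inr ⟨true, rfl⟩
  · exact .inr ⟨false, rfl⟩

/-- The pushdown machine that simulates a graph with monotone counters. -/
def pushdownMachine [Finite T] (i : G.V) : PushdownCounterMachine T where
  Q := G.V ⊕ Option Bool
  Γ := Option T
  k := k
  finite_Q := inferInstance
  finite_Γ := inferInstance
  init := .inl i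
  bottom := none
  final := {.inr (some true)}
  transitions := {τ | G.IsPushdownTransition inc τ}
  finite_transitions := G.finite_isPushdownTransition inc

variable [Finite T]

theorem pushdownMachine_isReversalBounded (i : G.V) :
    (G.pushdownMachine inc i).IsReversalBounded := by
  refine ⟨1, fun w rs s hr j => hr.numReversals_le_one (fun s => Sum.isRight s.1 = true)
    (fun r => r.delta j) ?_ ?_⟩
  · rintro r s t ⟨hr, h₁, h₂, -⟩ hs
    rw [h₁] at hs
    rw [h₂]
    rcases hr with _ | _ | _ | _ | _ | _
    · exact absurd hs (by simp)
    · exact absurd hs (by simp)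
    · exact ⟨rfl, le_rfl⟩
    · exact ⟨rfl, le_rfl⟩
    · exact ⟨rfl, show (-1 : SignType) ≤ 0 by decide⟩
    · exact ⟨rfl, le_rfl⟩
  · rintro r s t ⟨hr, h₁, -⟩ hs
    rw [h₁] at hs
    rcases hr with _ | _ | _ | _ | _ | _
    · exact boolSign_nonneg _
    · exact le_rfl
    all_goals exact absurd rfl hs

/-- Letters are pushed only while edges are followed, and popped only in states from which no vertex
of the graph is reached again. -/
theorem pushdownMachine_isOneReversalPushdown (i : G.V) :
    (G.pushdownMachine inc i).IsOneReversalPushdown := by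
  refine fun w rs s hr => hr.pairwise (fun s => Sum.isRight s.1 = true) ?_ ?_
  · rintro r s t ⟨hr, -, h₂, -⟩ hs
    rw [h₂]
    rcases hr with _ | _ | _ | _ | _ | _
    · dsimp only [pushdownMachine] at hs
      simp at hs
    · simp at hs
    all_goals rfl
  · rintro r s t ⟨hr, h₁, h₂, -⟩ hs
    rw [h₁] at hs
    rw [h₂]
    rcases hr with _ | _ | _ | _ | _ | _
    · exact absurd hs (by simp)
    · exact absurd hs (by simp)
    all_goals exact ⟨rfl, by dsimp only [pushdownMachine]; simp⟩

/-- The relation between the computations of `pushdownMachine` on `w` and the runs of the graph. -/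
def PushdownSimulation (w : List T)
    (a : (G.V ⊕ Option Bool) × List T × (Fin k → ℕ) × List (Option T))
    (b : (G.V × List T × List T) × (Fin k → ℕ)) : Prop :=
  match a.1 with
  | .inl v => b.1.1 = v ∧ b.2 = a.2.2.1 ∧ w = b.1.2.1 ++ a.2.1 ∧
      a.2.2.2 = b.1.2.2.map some ++ [none]
  | .inr none => b.1.1 ∈ G.final ∧ b.2 = a.2.2.1 ∧ ∃ Y₁ Y₂, b.1.2.2 = Y₁ ++ Y₂ ∧
      w = b.1.2.1 ++ (Y₁ ++ a.2.1) ∧ a.2.2.2 = Y₂.map some ++ [none]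
  | .inr (some false) => b.1.1 ∈ G.final ∧ (∃ d, ∀ j, b.2 j = a.2.2.1 j + d) ∧
      w = b.1.2.1 ++ (b.1.2.2 ++ a.2.1)
  | .inr (some true) => b.1.1 ∈ G.final ∧ (∃ d, ∀ j, b.2 j = d) ∧
      w = b.1.2.1 ++ (b.1.2.2 ++ a.2.1)

/-- New right words go in front of older ones, on the pushdown as in the graph. Read from the top,
the pushdown spells out `Y`, and comparison with the rest of the input yields `X ++ Y`. -/
theorem pushdownSimulation_step (hl : ∀ e, (G.left e).length ≤ 1) (i : G.V) {w : List T}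
    {τ : PushdownCounterTransition T (G.V ⊕ Option Bool) (Option T) k}
    {s t : (G.V ⊕ Option Bool) × List T × (Fin k → ℕ) × List (Option T)}
    {s' : (G.V × List T × List T) × (Fin k → ℕ)}
    (h : (G.pushdownMachine inc i).Step τ s t) (hs : G.PushdownSimulation w s s') :
    ∃ es t', LabelledRun (G.MonotoneStep inc) es s' t' ∧ G.PushdownSimulation w t t' := by
  obtain ⟨q, u, c, σ⟩ := s
  obtain ⟨q', u', c', σ'⟩ := t
  obtain ⟨⟨v, X, Y⟩, d⟩ := s'
  obtain ⟨hr, h₁, h₂, hu, ht, hc, (γ : List (Option T)), hσ, hσ'⟩ := h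
  dsimp only [pushdownMachine] at h₁ h₂ ht hc hu hσ hσ'
  subst h₁ h₂ hu hσ hσ'
  have keep : τ.delta = (fun _ => 0) → c' = c := by
    intro h
    funext j
    have := hc j
    simpa [h] using this
  rcases hr with ⟨e, t, g⟩ | ⟨f, t, g⟩ | ⟨t, a⟩ | t | _ | _
  · obtain ⟨hv, hd, hw, hY⟩ := hs
    dsimp only at hv hd hw hY
    subst hv hd
    refine ⟨[e], ((G.tgt e, X ++ G.left e, G.right e ++ Y), c'), .single
      ⟨⟨rfl, rfl, rfl, rfl⟩, fun j => ?_⟩, rfl, rfl, ?_, ?_⟩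
    · have := hc j
      rw [boolSign_cast] at this
      exact_mod_cast this
    · rw [hw, head?_toList_of_length_le_one (hl e), List.append_assoc]
    · rw [List.map_append, List.append_assoc, ← hY]
      exact List.append_assoc _ [g] γ
  · obtain ⟨hv, hd, hw, hY⟩ := hs
    dsimp only at hv hd hw hY
    subst hv
    exact ⟨[], ((f.1, X, Y), d), .nil _, f.2, hd.trans (keep rfl).symm, [], Y, rfl, hw, hY⟩
  · obtain ⟨hf, hd, Y₁, Y₂, hY, hw, hσ⟩ := hs
    dsimp only at hY hw hσ
    rcases Y₂ with _ | ⟨b, Y₂⟩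
    · simp at hσ
    · have hab : a = b ∧ γ = Y₂.map some ++ [none] := by simpa using hσ
      obtain ⟨rfl, rfl⟩ := hab
      exact ⟨[], ((v, X, Y), d), .nil _, hf, hd.trans (keep rfl).symm, Y₁ ++ [a], Y₂, by simp [hY],
        by simpa using hw, rfl⟩
  · obtain ⟨hf, hd, Y₁, Y₂, hY, hw, hσ⟩ := hs
    obtain rfl : Y₂ = [] := by
      rcases Y₂ with _ | ⟨b, Y₂⟩
      · rfl
      · simp at hσ
    refine ⟨[], ((v, X, Y), d), .nil _, hf, ⟨0, fun j => ?_⟩, ?_⟩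
    · dsimp only at hd ⊢
      rw [hd, keep rfl, add_zero]
    · rw [List.append_nil] at hY
      rw [hY]
      exact hw
  · obtain ⟨hf, ⟨m, hm⟩, hw⟩ := hs
    refine ⟨[], ((v, X, Y), d), .nil _, hf, ⟨m + 1, fun j => ?_⟩, hw⟩
    have := hc j
    simp at this
    have := hm j
    dsimp only at this ⊢
    omega
  · obtain ⟨hf, ⟨m, hm⟩, hw⟩ := hs
    refine ⟨[], ((v, X, Y), d), .nil _, hf, ⟨m, fun j => ?_⟩, hw⟩
    have h0 : c j = 0 := by simpa using ht j
    have := hm j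
    dsimp only at this ⊢
    omega

theorem pushdownMachine_run (hl : ∀ e, (G.left e).length ≤ 1) (i : G.V) {es : List G.E}
    {s t : (G.V × List T × List T) × (Fin k → ℕ)} (hr : LabelledRun (G.MonotoneStep inc) es s t) :
    ∃ x, t.1.2.1 = s.1.2.1 ++ x ∧ ∀ u, ∃ τs, LabelledRun (G.pushdownMachine inc i).Step τs
      (.inl s.1.1, x ++ u, s.2, s.1.2.2.map some ++ [none])
      (.inl t.1.1, u, t.2, t.1.2.2.map some ++ [none]) := by
  induction hr with
  | nil s => exact ⟨[], by simp, fun u => ⟨_, .nil _⟩⟩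
  | @cons e es s t u h _ ih =>
    obtain ⟨⟨h₁, h₂, h₃, h₄⟩, h₅⟩ := h
    obtain ⟨x, hX, hx⟩ := ih
    refine ⟨G.left e ++ x, ?_, fun u => ?_⟩
    · rw [hX, h₃, List.append_assoc]
    · obtain ⟨τs, hτs⟩ := hx u
      -- The bottom marker is never removed, so there is always a topmost symbol to put back.
      obtain ⟨g, γ, hg⟩ : ∃ g γ, s.1.2.2.map some ++ [none] = g :: γ :=
        List.exists_cons_of_ne_nil (by simp)
      refine ⟨_, .cons (t := (.inl t.1.1, x ++ u, t.2, t.1.2.2.map some ++ [none]))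
        ⟨.edge e (fun j => decide (0 < s.2 j)) g, ?_, ?_, ?_, ?_, ?_, γ, hg, ?_⟩ hτs⟩
      · exact congrArg Sum.inl h₁
      · exact congrArg Sum.inl h₂
      · rw [head?_toList_of_length_le_one (hl e), List.append_assoc]
      · simp
      · intro j
        have := h₅ j
        simp only [boolSign_cast]
        exact_mod_cast this
      · have : t.1.2.2.map some ++ [none] = (G.right e).map some ++ [g] ++ γ := by
          rw [h₄, List.map_append, List.append_assoc, hg]
          simp
        exact this

theorem pushdownMachine_pop (i : G.V) (c : Fin k → ℕ) (Y : List T) :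
    ∃ τs, LabelledRun (G.pushdownMachine inc i).Step τs
      (.inr none, Y, c, Y.map some ++ [none]) (.inr (some false), [], c, [none]) := by
  induction Y with
  | nil =>
    exact ⟨_, .single ⟨.bottom fun j => decide (0 < c j), rfl, rfl, rfl, by simp, by simp, [], rfl,
      rfl⟩⟩
  | cons a Y ih =>
    obtain ⟨τs, hτs⟩ := ih
    exact ⟨_, .cons (t := (.inr none, Y, c, Y.map some ++ [none]))
      ⟨.pop (fun j => decide (0 < c j)) a, rfl, rfl, rfl, by simp, by simp, _, rfl, rfl⟩ hτs⟩

theorem pushdownMachine_empty (i : G.V) (n : ℕ) :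
    ∃ τs, LabelledRun (G.pushdownMachine inc i).Step τs
      (.inr (some false), [], fun _ => n, [none]) (.inr (some true), [], fun _ => 0, [none]) := by
  induction n with
  | zero => exact ⟨_, .single ⟨.accept, rfl, rfl, rfl, by simp, by simp, [], rfl, rfl⟩⟩
  | succ n ih =>
    obtain ⟨τs, hτs⟩ := ih
    exact ⟨_, .cons (t := (.inr (some false), [], fun _ => n, [none]))
      ⟨.decrement, rfl, rfl, rfl, by simp, by simp, [], rfl, rfl⟩ hτs⟩

end LinearGraph

theorem familyMonotone_subset_familyNPCM1 (T : Type) [Finite T] :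
    familyMonotone T .linear ⊆ familyNPCM1 T := by
  rintro _ ⟨G, k, inc, i, hi, hl, -, -, rfl⟩
  refine ⟨G.pushdownMachine inc i, G.pushdownMachine_isReversalBounded inc i,
    G.pushdownMachine_isOneReversalPushdown inc i, ?_⟩
  ext w
  constructor
  · rintro ⟨τs, _, c, σ, rfl, hr⟩
    obtain ⟨es, ⟨⟨v, X, Y⟩, d⟩, hes, hf, ⟨n, hn⟩, hw⟩ := hr.simulate
      (R := G.PushdownSimulation w)
      (fun _ _ _ _ h hR => G.pushdownSimulation_step inc hl i h hR)
      (a' := ((i, [], []), fun _ => 0)) ⟨rfl, rfl, rfl, rfl⟩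
    dsimp only at hf hn hw
    obtain rfl : d = fun _ => n := funext hn
    exact ⟨es, i, hi ▸ rfl, v, hf, X, Y, n, by simpa using hw, hes⟩
  · rintro ⟨es, i', hi', f, hf, X, Y, n, rfl, hr⟩
    rw [hi] at hi'
    obtain rfl : i' = i := hi'
    obtain ⟨x, hX, hx⟩ := G.pushdownMachine_run inc hl i' hr
    dsimp only at hX
    rw [List.nil_append] at hX
    subst hX
    obtain ⟨τs, hτs⟩ := hx Y
    obtain ⟨τs', hτs'⟩ := G.pushdownMachine_pop inc i' (fun _ => n) Y
    obtain ⟨τs'', hτs''⟩ := G.pushdownMachine_empty inc i' n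
    obtain ⟨g, γ, hg⟩ : ∃ g γ, Y.map some ++ [none] = g :: γ :=
      List.exists_cons_of_ne_nil (by simp)
    refine ⟨_, .inr (some true), fun _ => 0, [none], rfl, (hτs.append (.cons (l := ⟨.inl f, none, g,
      fun j => decide (0 < n), .inr none, [g], fun _ => 0⟩) ?_ (hτs'.append hτs'')))⟩
    exact ⟨.leave ⟨f, hf⟩ _ g, rfl, rfl, rfl, by simp, by simp, γ, hg, hg⟩

/-! ### Controlled state grammars -/

section Control

variable {T V₁ V₂ : Type}

open Classical in
/-- The number of occurrences of the nonterminal `C` of `V₂`. -/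
noncomputable def controlCount (C : V₂) (z : List (Symbol T (V₁ ⊕ V₂))) : ℕ :=
  z.count (Symbol.nonterminal (Sum.inr C))

theorem controlCount_append (C : V₂) (z z' : List (Symbol T (V₁ ⊕ V₂))) :
    controlCount C (z ++ z') = controlCount C z + controlCount C z' := by
  simp [controlCount]

theorem controlCount_pos {C : V₂} {z : List (Symbol T (V₁ ⊕ V₂))} :
    0 < controlCount C z ↔ Symbol.nonterminal (Sum.inr C) ∈ z := by
  classical
  simp [controlCount, List.count_pos_iff]

theorem controlCount_eq_zero {C : V₂} {z : List (Symbol T (V₁ ⊕ V₂))} :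
    controlCount C z = 0 ↔ Symbol.nonterminal (Sum.inr C) ∉ z := by
  rw [← controlCount_pos, Nat.pos_iff_ne_zero, not_not]

open Classical in
theorem controlCount_singleton (C : V₂) (B : V₁ ⊕ V₂) :
    controlCount C [(Symbol.nonterminal B : Symbol T (V₁ ⊕ V₂))] =
      if B = Sum.inr C then 1 else 0 := by
  simp [controlCount, List.count_singleton]

theorem deleteControl_append (z z' : List (Symbol T (V₁ ⊕ V₂))) :
    deleteControl (z ++ z') = deleteControl z ++ deleteControl z' :=
  List.filterMap_append

theorem deleteControl_map_inr (z : List V₂) :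
    deleteControl (z.map fun D => (Symbol.nonterminal (Sum.inr D) : Symbol T (V₁ ⊕ V₂))) = [] := by
  simp [deleteControl, List.filterMap_map, Function.comp_def, keepUncontrolled]

theorem deleteControl_map_terminal (w : List T) :
    deleteControl (w.map (Symbol.terminal : T → Symbol T (V₁ ⊕ V₂))) = w.map Symbol.terminal := by
  induction w with
  | nil => rfl
  | cons a w ih => exact congrArg _ ih

theorem controlCount_map_terminal (C : V₂) (w : List T) :
    controlCount C (w.map (Symbol.terminal : T → Symbol T (V₁ ⊕ V₂))) = 0 := by
  rw [controlCount_eq_zero]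
  simp

theorem eq_map_terminal {z : List (Symbol T (V₁ ⊕ V₂))} {w : List T}
    (h : deleteControl z = w.map Symbol.terminal) (h₀ : ∀ C, controlCount C z = 0) :
    z = w.map Symbol.terminal := by
  induction z generalizing w with
  | nil =>
    cases w with
    | nil => rfl
    | cons => simp [deleteControl] at h
  | cons a z ih =>
    have h₁ : ∀ C, controlCount C z = 0 := fun C => by
      have := h₀ C
      rw [controlCount_eq_zero] at this ⊢
      exact fun h => this (by simp [h])
    rcases a with a | A | C
    · cases w with
      | nil => simp [deleteControl, keepUncontrolled] at h
      | cons b w =>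
        rw [deleteControl, List.filterMap_cons_some (by rfl), List.map_cons] at h
        obtain ⟨h₂, h₃⟩ := List.cons.inj h
        rw [ih h₃ h₁]
        cases h₂
        rfl
    · cases w with
      | nil => simp [deleteControl, keepUncontrolled] at h
      | cons b w =>
        rw [deleteControl, List.filterMap_cons_some (by rfl), List.map_cons] at h
        exact absurd (List.cons.inj h).1 (by simp)
    · exact absurd (h₀ C) (by rw [controlCount_eq_zero]; simp)

theorem exists_uncontrolled {z : List (Symbol T (V₁ ⊕ V₂))} {u v : List (Symbol T V₁)} {B : V₁}
    (h : deleteControl z = u ++ [Symbol.nonterminal B] ++ v) :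
    ∃ u' v', z = u' ++ [Symbol.nonterminal (Sum.inl B)] ++ v' ∧ deleteControl u' = u ∧
      deleteControl v' = v := by
  rw [deleteControl, List.append_assoc, List.filterMap_eq_append_iff] at h
  obtain ⟨z₁, z₂, rfl, h₁, h₂⟩ := h
  rw [List.singleton_append, List.filterMap_eq_cons_iff] at h₂
  obtain ⟨l, a, v', rfl, hl, ha, hv⟩ := h₂
  refine ⟨z₁ ++ l, v', ?_, ?_, hv⟩
  · rcases a with a | A | C
    · simp [keepUncontrolled] at ha
    · simp only [keepUncontrolled, Option.some.injEq, Symbol.nonterminal.injEq] at ha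
      simp [ha]
    · simp [keepUncontrolled] at ha
  · rw [deleteControl_append, deleteControl, h₁, deleteControl, List.filterMap_eq_nil_iff.mpr hl,
      List.append_nil]

theorem mem_deleteControl {z : List (Symbol T (V₁ ⊕ V₂))} {B : V₁} :
    Symbol.nonterminal B ∈ deleteControl z ↔ Symbol.nonterminal (Sum.inl B) ∈ z := by
  rw [deleteControl, List.mem_filterMap]
  constructor
  · rintro ⟨a | A | C, ha, h⟩ <;> simp [keepUncontrolled] at h
    exact h ▸ ha
  · exact fun h => ⟨_, h, rfl⟩

end Control

namespace ControlledStateGrammar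

variable {T : Type} (G : ControlledStateGrammar T)

attribute [instance] finite_V₁ finite_V₂ finite_Q

/-- The rule `r` changes the nonterminal `A` of `V₁` to `A'` and emits the words `x` and `y`. -/
def Moves (r : StateRule T (G.V₁ ⊕ G.V₂) G.Q) (A : Option G.V₁) (x : List T) (A' : Option G.V₁)
    (y : List T) : Prop :=
  (∃ B, r.lhs = .inl B ∧ A = some B ∧ deleteControl r.rhs = sentential x A' y) ∨
    ∃ C, r.lhs = .inr C ∧ A' = A ∧ x = [] ∧ y = []

variable {G}

-- A sentential form matters only through what remains after deleting `V₂` and through the number of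
-- each symbol of `V₂`; the positions of the latter are irrelevant.
open Classical in
theorem Moves.step_iff {r : StateRule T (G.V₁ ⊕ G.V₂) G.Q} (hr : r ∈ G.rules)
    {A A' : Option G.V₁} {x y X Y : List T} (h : G.Moves r A x A' y)
    {z z' : List (Symbol T (G.V₁ ⊕ G.V₂))} (hz : deleteControl z = sentential X A Y) {p q : G.Q}
    (hs : G.Step r (p, z) (q, z')) :
    p = r.src ∧ q = r.tgt ∧ deleteControl z' = sentential (X ++ x) A' (y ++ Y) ∧
      ∀ C, controlCount C z' + (if r.lhs = .inr C then 1 else 0) =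
        controlCount C z + controlCount C r.rhs := by
  obtain ⟨-, h₁, h₂, u, v, h₃, h₄, -⟩ := hs
  dsimp only at h₁ h₂ h₃ h₄
  subst h₃ h₄
  refine ⟨h₁, h₂, ?_, fun C => ?_⟩
  · rcases h with ⟨B, hB, -, h⟩ | ⟨C, hC, rfl, rfl, rfl⟩
    · refine ((rewrite_sentential (A := A) (B := B)).mp
        ⟨deleteControl u, deleteControl v, ?_, ?_⟩).2
      · rw [← hz, hB, deleteControl_append, deleteControl_append]
        rfl
      · rw [deleteControl_append, deleteControl_append, h]
    · obtain ⟨w, hw⟩ := G.control r hr C hC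
      rw [deleteControl_append, deleteControl_append, hw, deleteControl_map_inr,
        sentential_append_nil, ← hz, hC, deleteControl_append, deleteControl_append]
      rfl
  · simp only [controlCount_append, controlCount_singleton]
    omega

theorem Step.uncontrolled_eq {r : StateRule T (G.V₁ ⊕ G.V₂) G.Q} {A : Option G.V₁} {X Y : List T}
    {s t : G.Q × List (Symbol T (G.V₁ ⊕ G.V₂))} (h : G.Step r s t)
    (hz : deleteControl s.2 = sentential X A Y) {B : G.V₁} (hB : r.lhs = .inl B) : A = some B := by
  obtain ⟨-, -, -, u, v, h₁, -⟩ := h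
  rw [h₁, hB, deleteControl_append, deleteControl_append] at hz
  exact (sentential_eq_append hz.symm).1

/-- At most one nonterminal of `V₁` is present, so the leftmost condition holds by itself. -/
theorem Moves.exists_step {r : StateRule T (G.V₁ ⊕ G.V₂) G.Q} (hr : r ∈ G.rules)
    {A A' : Option G.V₁} {x y X Y : List T} (h : G.Moves r A x A' y)
    {z : List (Symbol T (G.V₁ ⊕ G.V₂))} (hz : deleteControl z = sentential X A Y)
    (hC : ∀ C, r.lhs = .inr C → 0 < controlCount C z) :
    ∃ z', G.Step r (r.src, z) (r.tgt, z') := by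
  rcases h with ⟨B, hB, rfl, h⟩ | ⟨C, hC', rfl, rfl, rfl⟩
  · obtain ⟨u, v, rfl, hu, hv⟩ := exists_uncontrolled
      (u := X.map Symbol.terminal) (v := Y.map Symbol.terminal) (B := B)
      (hz.trans (by simp [sentential]))
    refine ⟨_, hr, rfl, rfl, u, v, by rw [hB], rfl, fun _ D hD => ?_⟩
    rw [← mem_deleteControl, hu] at hD
    simp at hD
  · obtain ⟨u, v, rfl⟩ := List.append_of_mem (controlCount_pos.mp (hC C hC'))
    refine ⟨_, hr, rfl, rfl, u, v, by rw [hC']; simp, rfl, fun ⟨A, hA⟩ => ?_⟩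
    rw [hC'] at hA
    exact absurd hA (by simp)

theorem exists_moves {s : Shape}
    (hG : ∀ r ∈ G.rules, ∀ A, r.lhs = Sum.inl A → s.Word (deleteControl r.rhs))
    (p : {p : G.rules × Option G.V₁ // ∀ B, p.1.1.lhs = Sum.inl B → p.2 = some B}) :
    ∃ x A y, s.Allows x y ∧ G.Moves p.1.1.1 p.1.2 x A y := by
  obtain ⟨⟨r, A⟩, hA⟩ := p
  rcases h : r.1.lhs with B | C
  · obtain ⟨x, A', y, hs, hw⟩ := Shape.word_iff.mp (hG r.1 r.2 B h)
    exact ⟨x, A', y, hs, .inl ⟨B, h, hA B h, hw⟩⟩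
  · exact ⟨[], A, [], Atom.allows_nil s, .inr ⟨C, h, rfl, rfl, rfl⟩⟩

variable (G)

open Classical in
/-- The phase of a nonterminal of `V₂` after a rule: `0` before it is produced, `1` while it is
being produced, `2` while it is being erased. -/
noncomputable def nextPhase (r : StateRule T (G.V₁ ⊕ G.V₂) G.Q) (φ : G.V₂ → Fin 3) (C : G.V₂) :
    Fin 3 :=
  if Symbol.nonterminal (Sum.inr C) ∈ r.rhs then 1 else if r.lhs = .inr C then 2 else φ C

/-- The rule `r` may be applied in the phases `φ`. -/
def PhaseAllows (r : StateRule T (G.V₁ ⊕ G.V₂) G.Q) (φ : G.V₂ → Fin 3) : Prop :=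
  ∀ C, (Symbol.nonterminal (Sum.inr C) ∈ r.rhs → φ C ≠ 2) ∧ (r.lhs = .inr C → φ C ≠ 0)

/-- The graph of the rules, with the state, the nonterminal of `V₁` and the phases of the
nonterminals of `V₂` as vertices. -/
noncomputable def phaseGraph
    (x : {p : G.rules × Option G.V₁ // ∀ B, p.1.1.lhs = Sum.inl B → p.2 = some B} → List T)
    (A : {p : G.rules × Option G.V₁ // ∀ B, p.1.1.lhs = Sum.inl B → p.2 = some B} → Option G.V₁)
    (y : {p : G.rules × Option G.V₁ // ∀ B, p.1.1.lhs = Sum.inl B → p.2 = some B} → List T) :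
    LinearGraph T where
  V := (G.Q × Option G.V₁) × (G.V₂ → Fin 3)
  E := {e : {p : G.rules × Option G.V₁ // ∀ B, p.1.1.lhs = Sum.inl B → p.2 = some B} ×
    (G.V₂ → Fin 3) // G.PhaseAllows e.1.1.1.1 e.2}
  finite_V := inferInstance
  finite_E := by have := G.finite_rules.to_subtype; infer_instance
  init := {((G.init, some G.start), fun _ => 0)}
  final := {v | v.1.1 ∈ G.final ∧ v.1.2 = none}
  src e := ((e.1.1.1.1.1.src, e.1.1.1.2), e.1.2)
  tgt e := ((e.1.1.1.1.1.tgt, A e.1.1), G.nextPhase e.1.1.1.1.1 e.1.2)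
  left e := x e.1.1
  right e := y e.1.1

variable {G}
  {x y : {p : G.rules × Option G.V₁ // ∀ B, p.1.1.lhs = Sum.inl B → p.2 = some B} → List T}
  {A : {p : G.rules × Option G.V₁ // ∀ B, p.1.1.lhs = Sum.inl B → p.2 = some B} → Option G.V₁}

/-- The rule of an edge. -/
def phaseRule (e : (G.phaseGraph x A y).E) : StateRule T (G.V₁ ⊕ G.V₂) G.Q := e.1.1.1.1.1

open Classical in
/-- The changes of the numbers of nonterminals of `V₂`. -/
noncomputable def phaseWt (e : (G.phaseGraph x A y).E) (C : G.V₂) : ℤ :=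
  controlCount C (phaseRule e).rhs - if (phaseRule e).lhs = .inr C then 1 else 0

/-- Phase `2` is permanent and keeps `C` out of right-hand sides, so the number of `C` can only
fall. -/
theorem phaseGraph_erasing {es : List (G.phaseGraph x A y).E}
    {s t : ((G.phaseGraph x A y).V × List T × List T) × (G.V₂ → ℤ)}
    (hr : LabelledRun ((G.phaseGraph x A y).WeightedStep phaseWt) es s t) {C : G.V₂}
    (hC : s.1.1.2 C = 2) :
    (∀ e ∈ es, Symbol.nonterminal (Sum.inr C) ∉ (phaseRule e).rhs) ∧ t.2 C ≤ s.2 C := by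
  induction hr with
  | nil => exact ⟨by simp, le_rfl⟩
  | @cons e es s t u h _ ih =>
    obtain ⟨⟨h₁, h₂, -⟩, h₃⟩ := h
    rw [h₁] at hC
    have hC₁ : Symbol.nonterminal (Sum.inr C) ∉ (phaseRule e).rhs := fun h => (e.2 C).1 h hC
    have hC₂ : t.1.1.2 C = 2 := by
      rw [h₂]
      refine (if_neg hC₁).trans ?_
      split_ifs
      exacts [rfl, hC]
    refine ⟨?_, (ih hC₂).2.trans ?_⟩
    · simpa [hC₁] using (ih hC₂).1
    · rw [h₃, Pi.add_apply, phaseWt, controlCount_eq_zero.mpr hC₁]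
      split_ifs <;> simp

-- The presence of a symbol `C` need not be tested. In phase `1` it is there, since `C` has been
-- produced and then rewritten only to words containing `C`. In phase `2` its number never rises and
-- ends at `0`, so a rule that consumes a `C` must have found one.
open Classical in
theorem phaseGraph_sound (hM : ∀ p, G.Moves p.1.1.1 p.1.2 (x p) (A p) (y p))
    {es : List (G.phaseGraph x A y).E}
    {s t : ((G.phaseGraph x A y).V × List T × List T) × (G.V₂ → ℤ)}
    (hr : LabelledRun ((G.phaseGraph x A y).WeightedStep phaseWt) es s t) (ht : ∀ C, t.2 C = 0)
    {z : List (Symbol T (G.V₁ ⊕ G.V₂))}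
    (hz : deleteControl z = sentential s.1.2.1 s.1.1.1.2 s.1.2.2)
    (hc : ∀ C, s.2 C = controlCount C z) (hφ : ∀ C, s.1.1.2 C = 1 → 0 < s.2 C) :
    ∃ z', LabelledRun G.Step (es.map phaseRule) (s.1.1.1.1, z) (t.1.1.1.1, z') ∧
      G.ErasureRespecting (es.map phaseRule) ∧
      deleteControl z' = sentential t.1.2.1 t.1.1.1.2 t.1.2.2 ∧ ∀ C, controlCount C z' = 0 := by
  induction hr generalizing z with
  | nil s =>
    exact ⟨z, .nil _, .nil, hz, fun C => by exact_mod_cast (hc C).symm.trans (ht C)⟩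
  | @cons e es s t u h hr ih =>
    obtain ⟨⟨h₁, h₂, h₃, h₄⟩, h₅⟩ := h
    have hrule : phaseRule e ∈ G.rules := e.1.1.1.1.2
    have hphase : ∀ C, t.1.1.2 C = G.nextPhase (phaseRule e) s.1.1.2 C := fun C => by
      rw [h₂, h₁]
      rfl
    have hallow : G.PhaseAllows (phaseRule e) s.1.1.2 := by
      rw [h₁]
      exact e.2
    have hpos : ∀ C, (phaseRule e).lhs = .inr C → 0 < controlCount C z := by
      intro C hC
      have h0 := (hallow C).2 hC
      by_cases h1 : s.1.1.2 C = 1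
      · have := hφ C h1
        rw [hc C] at this
        exact_mod_cast this
      · have h2 : s.1.1.2 C = 2 := by
          generalize s.1.1.2 C = p at h0 h1
          revert p
          decide
        have hn : Symbol.nonterminal (Sum.inr C) ∉ (phaseRule e).rhs := fun h => (hallow C).1 h h2
        have h2' : t.1.1.2 C = 2 := by
          rw [hphase]
          exact (if_neg hn).trans (if_pos hC)
        have := (phaseGraph_erasing hr h2').2
        rw [ht C, h₅, Pi.add_apply, phaseWt, controlCount_eq_zero.mpr hn, if_pos hC, hc C] at this
        omega
    rw [h₁] at hz
    obtain ⟨z', hz'⟩ := (hM e.1.1).exists_step hrule hz hpos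
    obtain ⟨-, -, hz₁, hz₂⟩ := (hM e.1.1).step_iff hrule hz hz'
    have hc' : ∀ C, t.2 C = controlCount C z' := fun C => by
      have : controlCount C z' + (if (phaseRule e).lhs = .inr C then 1 else 0) =
        controlCount C z + controlCount C (phaseRule e).rhs := hz₂ C
      rw [h₅, Pi.add_apply, hc C, phaseWt]
      split_ifs at this ⊢ <;> omega
    obtain ⟨z'', hr', her, hz'', h0⟩ := ih ht (z := z') (by rw [h₂, h₃, h₄]; exact hz₁) hc' (by
      intro C hC
      rw [hphase, nextPhase] at hC
      rw [h₅, Pi.add_apply, phaseWt]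
      split_ifs at hC with h h'
      · have := controlCount_pos.mpr h
        have h' := hc C
        split_ifs with hl
        · have := hpos C hl
          omega
        · omega
      · exact absurd hC (by decide)
      · rw [if_neg h', controlCount_eq_zero.mpr h]
        simpa using hφ C hC)
    refine ⟨z'', .cons (t := (t.1.1.1.1, z')) ?_ hr', .cons ?_ her, hz'', h0⟩
    · rw [h₁, h₂]
      exact hz'
    · intro r' hr₁ C hC hn
      obtain ⟨e', he', rfl⟩ := List.mem_map.mp hr₁
      refine (phaseGraph_erasing hr ?_).1 e' he'
      rw [hphase]
      exact (if_neg hn).trans (if_pos hC)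

-- The phases are determined by the applied rules, and the erasure condition says precisely that no
-- rule producing `C` is applied in phase `2` of `C`.
open Classical in
theorem phaseGraph_complete (hM : ∀ p, G.Moves p.1.1.1 p.1.2 (x p) (A p) (y p))
    {rs : List (StateRule T (G.V₁ ⊕ G.V₂) G.Q)} {s t : G.Q × List (Symbol T (G.V₁ ⊕ G.V₂))}
    (hr : LabelledRun G.Step rs s t) (her : G.ErasureRespecting rs) {X Y : List T}
    {B : Option G.V₁} (hz : deleteControl s.2 = sentential X B Y) {φ : G.V₂ → Fin 3}
    (h₀ : ∀ C, φ C = 0 → controlCount C s.2 = 0)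
    (h₂ : ∀ C, φ C = 2 → ∀ r ∈ rs, Symbol.nonterminal (Sum.inr C) ∉ r.rhs) :
    ∃ es B' φ' X' Y', LabelledRun ((G.phaseGraph x A y).WeightedStep phaseWt) es
      ((((s.1, B), φ), X, Y), fun C => controlCount C s.2)
      ((((t.1, B'), φ'), X', Y'), fun C => controlCount C t.2) ∧
      deleteControl t.2 = sentential X' B' Y' := by
  induction hr generalizing X Y B φ with
  | nil s => exact ⟨[], B, φ, X, Y, .nil _, hz⟩
  | @cons r rs s t u h _ ih =>
    have hr := h.1
    obtain ⟨-, -, -, v₁, v₂, hv, -⟩ := id h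
    have hB : ∀ B', r.lhs = Sum.inl B' → B = some B' := fun _ => h.uncontrolled_eq hz
    obtain ⟨h₃, h₄, h₅, h₆⟩ := (hM ⟨(⟨r, hr⟩, B), hB⟩).step_iff hr hz (p := s.1) (q := t.1) h
    have hpos : ∀ C, r.lhs = .inr C → 0 < controlCount C s.2 := by
      intro C hC
      rw [controlCount_pos, hv, hC]
      simp
    have hallow : G.PhaseAllows r φ := fun C =>
      ⟨fun h hC => h₂ C hC r (by simp) h, fun h hC => (hpos C h).ne' (h₀ C hC)⟩
    obtain ⟨es, B', φ', X', Y', hes, ht⟩ := ih (List.pairwise_cons.mp her).2 h₅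
      (φ := G.nextPhase r φ) (by
        intro C hC
        have := h₆ C
        rw [nextPhase] at hC
        split_ifs at hC with h h'
        · exact absurd hC (by decide)
        · exact absurd hC (by decide)
        · rw [h₀ C hC, controlCount_eq_zero.mpr h] at this
          omega) (by
        intro C hC r' hr'
        rw [nextPhase] at hC
        split_ifs at hC with h h'
        · exact absurd hC (by decide)
        · exact (List.pairwise_cons.mp her).1 r' hr' C h' h
        · exact h₂ C hC r' (by simp [hr']))
    refine ⟨⟨(⟨(⟨r, hr⟩, B), hB⟩, φ), hallow⟩ :: es, B', φ', X', Y', .cons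
      ⟨⟨?_, ?_, rfl, rfl⟩, ?_⟩ hes, ht⟩
    · rw [h₃]
      rfl
    · rw [h₄]
      rfl
    · funext C
      have : (controlCount C t.2 : ℤ) =
          controlCount C s.2 + (controlCount C r.rhs - if r.lhs = .inr C then 1 else 0) := by
        have := h₆ C
        split_ifs at this ⊢ <;> omega
      exact this

end ControlledStateGrammar

/-- Languages of controlled state grammars with rules of a given shape. -/
def familyCS (T : Type) (s : Shape) : Set (Language T) :=
  {L | ∃ G : ControlledStateGrammar T,
    (∀ r ∈ G.rules, ∀ A, r.lhs = Sum.inl A → s.Word (deleteControl r.rhs)) ∧ G.language = L}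

theorem familyCS_subset_familyWeighted (T : Type) (s : Shape) :
    familyCS T s ⊆ familyWeighted T s := by
  rintro _ ⟨G, hG, rfl⟩
  choose x A y hs hM using ControlledStateGrammar.exists_moves hG
  refine ⟨G.phaseGraph x A y, G.V₂, inferInstance, ControlledStateGrammar.phaseWt,
    fun _ _ => false, fun e => hs e.1.1, ?_⟩
  have hstart : deleteControl [(Symbol.nonterminal (Sum.inl G.start) : Symbol T (G.V₁ ⊕ G.V₂))] =
      sentential [] (some G.start) [] := rfl
  have hcount : ∀ C, controlCount C
      [(Symbol.nonterminal (Sum.inl G.start) : Symbol T (G.V₁ ⊕ G.V₂))] = 0 := fun C => by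
    simp [controlCount_eq_zero]
  ext w
  constructor
  · rintro ⟨es, _, rfl, ⟨⟨f, _⟩, φ⟩, ⟨hf, rfl⟩, X, Y, W, rfl, hr, hW⟩
    obtain ⟨z, hr', her, hz, h0⟩ := ControlledStateGrammar.phaseGraph_sound hM hr
      (fun C => by simpa [Meets] using hW C) hstart (fun C => by simp [hcount])
      (fun C hC => absurd hC (by simp))
    refine ⟨_, f, hf, ?_, her⟩
    rw [← eq_map_terminal (hz.trans sentential_none) h0]
    exact hr'
  · rintro ⟨rs, f, hf, hr, her⟩
    obtain ⟨es, B, φ, X, Y, hes, hz⟩ := ControlledStateGrammar.phaseGraph_complete hM hr her hstart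
      (φ := fun _ => 0) (fun C _ => hcount C) (fun C hC => absurd hC (by simp))
    rw [deleteControl_map_terminal] at hz
    obtain ⟨rfl, rfl⟩ := terminal_eq_sentential hz
    simp only [hcount, controlCount_map_terminal, Nat.cast_zero] at hes
    exact ⟨es, _, rfl, ((f, none), φ), ⟨hf, rfl⟩, X, Y, _, rfl, hes, fun C => by simp [Meets]⟩

/-! ### Simulation of monotone counters by controlled grammars -/

theorem controlCount_map_inr {T V₁ V₂ : Type} [BEq V₂] [LawfulBEq V₂] (C : V₂) (l : List V₂) :
    controlCount C (l.map fun D => (Symbol.nonterminal (Sum.inr D) : Symbol T (V₁ ⊕ V₂))) =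
      l.count C := by
  classical
  induction l with
  | nil => simp [controlCount]
  | cons D l ih =>
    rw [List.map_cons, ← List.singleton_append, controlCount_append, ih, controlCount_singleton,
      List.count_cons, add_comm]
    simp

namespace LinearGraph

variable {T : Type} (G : LinearGraph T) {k : ℕ} (inc : G.E → Fin k → Bool)

/-- The counters that are incremented, as a list of nonterminals of a controlled state grammar. -/
def controlWord (b : Fin k → Bool) : List (Option (Fin k)) :=
  ((List.finRange k).filter b).map some

theorem count_controlWord_some (b : Fin k → Bool) (j : Fin k) :
    (controlWord b).count (some j) = (b j).toNat := by
  rw [controlWord, List.count_map_of_injective _ _ (Option.some_injective _)]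
  rcases h : b j with _ | _
  · exact List.count_eq_zero_of_not_mem (by simp [h])
  · exact List.count_eq_one_of_mem ((List.nodup_finRange k).filter _) (by simp [h])

theorem count_controlWord_none (b : Fin k → Bool) : (controlWord b).count none = 0 :=
  List.count_eq_zero_of_not_mem (by simp [controlWord])

/-- The right-hand side of the rule that belongs to an edge. -/
def controlRhs (e : G.E) : List (Symbol T (G.V ⊕ Option (Fin k))) :=
  (G.left e).map Symbol.terminal ++ [Symbol.nonterminal (.inl (G.tgt e))] ++
    (G.right e).map Symbol.terminal ++
    (controlWord (inc e)).map fun D => Symbol.nonterminal (.inr D)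

theorem deleteControl_controlRhs (e : G.E) :
    deleteControl (G.controlRhs inc e) = sentential (G.left e) (some (G.tgt e)) (G.right e) := by
  rw [controlRhs, deleteControl_append, deleteControl_append, deleteControl_append,
    deleteControl_map_inr, deleteControl_map_terminal, deleteControl_map_terminal]
  simp [sentential, deleteControl, keepUncontrolled]

theorem controlCount_controlRhs (e : G.E) (C : Option (Fin k)) :
    controlCount C (G.controlRhs inc e) = (controlWord (inc e)).count C := by
  rw [controlRhs, controlCount_append, controlCount_append, controlCount_append,
    controlCount_map_inr, controlCount_map_terminal, controlCount_map_terminal,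
    controlCount_singleton, if_neg (by simp), zero_add, zero_add, zero_add]

/-- The rule that follows an edge. -/
def edgeRule (e : G.E) : StateRule T (G.V ⊕ Option (Fin k)) (Option (Finset (Fin k))) :=
  ⟨none, .inl (G.src e), none, G.controlRhs inc e⟩

/-- The rule that leaves a vertex. -/
def leaveRule (k : ℕ) (f : G.V) : StateRule T (G.V ⊕ Option (Fin k)) (Option (Finset (Fin k))) :=
  ⟨none, .inl f, some ∅, []⟩

/-- The rule that erases the nonterminal belonging to the counter `j`. In the state `some s`, the
counters in `s` have been erased once more than the others. -/
def eraseRule (s : Finset (Fin k)) (j : Fin k) :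
    StateRule T (G.V ⊕ Option (Fin k)) (Option (Finset (Fin k))) :=
  ⟨some s, .inr (some j), some (if insert j s = Finset.univ then ∅ else insert j s), []⟩

/-- The rules of a controlled state grammar that simulate a graph with monotone counters. -/
inductive IsControlRule :
    StateRule T (G.V ⊕ Option (Fin k)) (Option (Finset (Fin k))) → Prop
  | edge (e : G.E) : IsControlRule (G.edgeRule inc e)
  | leave (f : G.final) : IsControlRule (G.leaveRule k f.1)
  | erase (s : Finset (Fin k)) (j : Fin k) (hj : j ∉ s) : IsControlRule (G.eraseRule s j)

theorem finite_isControlRule : {r | G.IsControlRule inc r}.Finite := by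
  refine (((Set.finite_range (G.edgeRule inc)).union (Set.finite_range (G.leaveRule k))).union
    (Set.finite_range fun x : Finset (Fin k) × Fin k => G.eraseRule x.1 x.2)).subset ?_
  rintro _ (e | f | ⟨s, j, -⟩)
  · exact .inl (.inl ⟨e, rfl⟩)
  · exact .inl (.inr ⟨f, rfl⟩)
  · exact .inr ⟨(s, j), rfl⟩

/-- The controlled state grammar that simulates a graph with monotone counters. -/
def controlGrammar (i : G.V) : ControlledStateGrammar T where
  V₁ := G.V
  -- The symbol `none` keeps `V₂` nonempty when there are no counters; it is never produced.
  V₂ := Option (Fin k)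
  Q := Option (Finset (Fin k))
  finite_V₁ := inferInstance
  finite_V₂ := inferInstance
  finite_Q := inferInstance
  nonempty_V₂ := inferInstance
  start := i
  init := none
  -- Only complete rounds have been made, so every counter has been erased equally often.
  final := {some ∅}
  rules := {r | G.IsControlRule inc r}
  finite_rules := G.finite_isControlRule inc
  control := by
    rintro _ (e | f | ⟨s, j, -⟩) C hC
    · exact absurd hC Sum.inl_ne_inr
    · exact absurd hC Sum.inl_ne_inr
    · exact ⟨[], rfl⟩

/-- Erasures take place in states `some _`, which are never left and in which all right-hand sides
are empty. -/
theorem controlGrammar_erasureRespecting (i : G.V)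
    {rs : List (StateRule T (G.V ⊕ Option (Fin k)) (Option (Finset (Fin k))))}
    {s t : Option (Finset (Fin k)) × List (Symbol T (G.V ⊕ Option (Fin k)))}
    (hr : LabelledRun (G.controlGrammar inc i).Step rs s t) :
    (G.controlGrammar inc i).ErasureRespecting rs := by
  refine List.Pairwise.imp (R := fun r r' => (∃ C, r.lhs = Sum.inr C) → ¬ r'.rhs ≠ []) ?_
    (hr.pairwise (p := fun r => ∃ C, r.lhs = Sum.inr C) (q := fun r => r.rhs ≠ [])
      (fun s => s.1 ≠ none) ?_ ?_)
  · intro r r' h C hC _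
    rw [not_not.mp (h ⟨C, hC⟩)]
    simp
  · rintro r s t ⟨hr, -, h, -⟩ ⟨C, hC⟩
    rw [h]
    rcases hr with _ | _ | _
    · exact absurd hC Sum.inl_ne_inr
    · exact absurd hC Sum.inl_ne_inr
    · exact Option.some_ne_none _
  · rintro r s t ⟨hr, h₁, h₂, -⟩ hs
    rw [h₁] at hs
    rw [h₂]
    rcases hr with _ | _ | _
    · exact absurd rfl hs
    · exact absurd rfl hs
    · exact ⟨Option.some_ne_none _, fun h => h rfl⟩

section Steps

variable {G} {X Y : List T} {A : Option G.V} {z z' : List (Symbol T (G.V ⊕ Option (Fin k)))}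
  {p q : Option (Finset (Fin k))} {i : G.V}

theorem moves_edge (e : G.E) : (G.controlGrammar inc i).Moves (G.edgeRule inc e)
    (some (G.src e)) (G.left e) (some (G.tgt e)) (G.right e) :=
  .inl ⟨_, rfl, rfl, G.deleteControl_controlRhs inc e⟩

theorem moves_leave (f : G.V) :
    (G.controlGrammar inc i).Moves (G.leaveRule k f) (some f) [] none [] :=
  .inl ⟨_, rfl, rfl, (sentential_none (X := []) (Y := [])).symm⟩

theorem moves_erase (s : Finset (Fin k)) (j : Fin k) :
    (G.controlGrammar inc i).Moves (G.eraseRule s j) A [] A [] :=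
  .inr ⟨_, rfl, rfl, rfl, rfl⟩

variable {inc}

theorem step_edge {e : G.E} (hz : deleteControl z = sentential X (some (G.src e)) Y)
    (h : (G.controlGrammar inc i).Step (G.edgeRule inc e) (p, z) (q, z')) :
    deleteControl z' = sentential (X ++ G.left e) (some (G.tgt e)) (G.right e ++ Y) ∧
      (∀ j, controlCount (some j) z' = controlCount (some j) z + (inc e j).toNat) ∧
      controlCount none z' = controlCount none z := by
  obtain ⟨-, -, h₁, h₂⟩ := (moves_edge inc e).step_iff h.1 hz h
  have h₃ : ∀ C, controlCount C z' = controlCount C z + (controlWord (inc e)).count C := fun C => by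
    rw [← G.controlCount_controlRhs inc e]
    exact (congrArg (controlCount C z' + ·) (if_neg Sum.inl_ne_inr)).symm.trans (h₂ C)
  refine ⟨h₁, fun j => ?_, ?_⟩
  · rw [h₃, count_controlWord_some]
  · rw [h₃, count_controlWord_none, add_zero]

theorem step_leave {f : G.V} (hz : deleteControl z = sentential X (some f) Y)
    (h : (G.controlGrammar inc i).Step (G.leaveRule k f) (p, z) (q, z')) :
    deleteControl z' = sentential X none Y ∧ ∀ C, controlCount C z' = controlCount C z := by
  obtain ⟨-, -, h₁, h₂⟩ := (moves_leave inc f).step_iff h.1 hz h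
  exact ⟨h₁.trans sentential_append_nil, fun C =>
    (congrArg (controlCount C z' + ·) (if_neg Sum.inl_ne_inr)).symm.trans (h₂ C)⟩

theorem step_erase {s : Finset (Fin k)} {j : Fin k} (hz : deleteControl z = sentential X A Y)
    (h : (G.controlGrammar inc i).Step (G.eraseRule s j) (p, z) (q, z')) :
    deleteControl z' = sentential X A Y ∧ controlCount none z' = controlCount none z ∧
      ∀ j', controlCount (some j') z' + (if j = j' then 1 else 0) = controlCount (some j') z := by
  obtain ⟨-, -, h₁, h₂⟩ := (moves_erase inc s j).step_iff h.1 hz h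
  refine ⟨h₁.trans sentential_append_nil, ?_, fun j' => ?_⟩
  · exact (congrArg (controlCount none z' + ·)
      (if_neg fun h => Option.some_ne_none _ (Sum.inr.inj h))).symm.trans (h₂ none)
  · by_cases hj : j = j'
    · rw [if_pos hj]
      exact (congrArg (controlCount (some j') z' + ·)
        (if_pos (congrArg (fun j => Sum.inr (some j)) hj))).symm.trans (h₂ (some j'))
    · rw [if_neg hj]
      exact (congrArg (controlCount (some j') z' + ·)
        (if_neg fun h => hj (Option.some.inj (Sum.inr.inj h)))).symm.trans (h₂ (some j'))

end Steps

/-- The relation between the derivations of `controlGrammar` and the runs of the graph. -/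
def ControlSimulation (a : Option (Finset (Fin k)) × List (Symbol T (G.V ⊕ Option (Fin k))))
    (b : (G.V × List T × List T) × (Fin k → ℕ)) : Prop :=
  match a.1 with
  | none => deleteControl a.2 = sentential b.1.2.1 (some b.1.1) b.1.2.2 ∧
      ∀ j, controlCount (some j) a.2 = b.2 j
  | some s => b.1.1 ∈ G.final ∧ deleteControl a.2 = sentential b.1.2.1 none b.1.2.2 ∧
      -- Here `d` stands for the number of completed rounds.
      ∃ d, ∀ j, controlCount (some j) a.2 + (if j ∈ s then 1 else 0) + d = b.2 j

theorem controlSimulation_step (i : G.V)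
    {r : StateRule T (G.V ⊕ Option (Fin k)) (Option (Finset (Fin k)))}
    {s t : Option (Finset (Fin k)) × List (Symbol T (G.V ⊕ Option (Fin k)))}
    {s' : (G.V × List T × List T) × (Fin k → ℕ)}
    (h : (G.controlGrammar inc i).Step r s t) (hs : G.ControlSimulation s s') :
    ∃ es t', LabelledRun (G.MonotoneStep inc) es s' t' ∧ G.ControlSimulation t t' := by
  obtain ⟨q, z⟩ := s
  obtain ⟨q', z'⟩ := t
  obtain ⟨⟨v, X, Y⟩, c⟩ := s'
  obtain ⟨hr, hq, hq', -⟩ := id h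
  dsimp only at hq hq'
  subst hq hq'
  rcases hr with e | f | ⟨s, j, hj⟩
  · obtain ⟨hz, hc⟩ := hs
    dsimp only at hz hc
    obtain rfl : v = G.src e := Option.some.inj (h.uncontrolled_eq hz rfl)
    obtain ⟨h₁, h₂, -⟩ := step_edge hz h
    exact ⟨[e], ((G.tgt e, X ++ G.left e, G.right e ++ Y), fun j => c j + (inc e j).toNat),
      .single ⟨⟨rfl, rfl, rfl, rfl⟩, fun j => rfl⟩, h₁, fun j => (h₂ j).trans (by rw [hc j])⟩
  · obtain ⟨hz, hc⟩ := hs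
    dsimp only at hz hc
    obtain rfl : v = f.1 := Option.some.inj (h.uncontrolled_eq hz rfl)
    obtain ⟨h₁, h₂⟩ := step_leave hz h
    exact ⟨[], ((f.1, X, Y), c), .nil _, f.2, h₁, 0, fun j => (h₂ _).trans (hc j)⟩
  · obtain ⟨hf, hz, d, hd⟩ := hs
    dsimp only at hf hz hd
    obtain ⟨h₁, -, h₃⟩ := step_erase hz h
    refine ⟨[], ((v, X, Y), c), .nil _, hf, h₁, ?_⟩
    have : ∃ d, ∀ j', controlCount (some j') z' +
        (if j' ∈ (if insert j s = Finset.univ then ∅ else insert j s) then 1 else 0) + d =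
          c j' := by
      split_ifs with hu
      · refine ⟨d + 1, fun j' => ?_⟩
        have hm : j' ∈ insert j s := hu ▸ Finset.mem_univ j'
        rw [Finset.mem_insert] at hm
        rw [← hd j', ← h₃ j']
        by_cases hj' : j = j'
        · subst hj'
          simp [hj]
          omega
        · simp [hm.resolve_left (Ne.symm hj'), hj']
          omega
      · refine ⟨d, fun j' => ?_⟩
        rw [← hd j', ← h₃ j']
        by_cases hj' : j = j'
        · subst hj'
          simp [hj]
        · simp [Ne.symm hj', hj']
    exact this

/-- Induction on the number `m` of remaining control symbols; `n` is the number each counter had at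
the start of the current round. The hypothesis `hs` excludes a completed round that was not reset,
except when there are no counters at all. -/
theorem controlGrammar_erase (i : G.V) {X Y : List T} (m n : ℕ) (s : Finset (Fin k))
    (hs : s = Finset.univ → s = ∅) (z : List (Symbol T (G.V ⊕ Option (Fin k))))
    (hz : deleteControl z = sentential X none Y) (h₀ : controlCount none z = 0)
    (hn : ∀ j, controlCount (some j) z + (if j ∈ s then 1 else 0) = n)
    (hm : ∑ j, controlCount (some j) z = m) :
    ∃ rs, LabelledRun (G.controlGrammar inc i).Step rs (some s, z)
      (some ∅, (X ++ Y).map Symbol.terminal) := by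
  induction m generalizing s n z with
  | zero =>
    have h₁ : ∀ j, controlCount (some j) z = 0 := by simpa using hm
    obtain rfl : s = ∅ := by
      rcases Finset.eq_empty_or_nonempty s with h | ⟨j, hj⟩
      · exact h
      · refine hs (Finset.eq_univ_of_forall fun j' => ?_)
        have h₂ := hn j
        have h₃ := hn j'
        rw [h₁, if_pos hj] at h₂
        rw [h₁] at h₃
        by_contra h
        rw [if_neg h] at h₃
        omega
    obtain rfl := eq_map_terminal (hz.trans sentential_none) fun C => by
      rcases C with _ | j
      exacts [h₀, h₁ j]
    exact ⟨[], .nil _⟩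
  | succ m ih =>
    obtain ⟨j, hj, hpos⟩ : ∃ j ∉ s, 0 < controlCount (some j) z := by
      obtain ⟨j, -, hj⟩ : ∃ j ∈ Finset.univ, controlCount (some j) z ≠ 0 :=
        Finset.exists_ne_zero_of_sum_ne_zero (by omega)
      -- If `j` has already been erased in this round, a counter `j'` not yet erased has one symbol
      -- more than `j`, so it can be used instead.
      by_cases hjs : j ∈ s
      · obtain ⟨j', hj'⟩ : ∃ j', j' ∉ s := by
          by_contra! h
          rw [hs (Finset.eq_univ_of_forall h)] at hjs
          exact absurd hjs (by simp)
        refine ⟨j', hj', ?_⟩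
        have h₁ := hn j
        have h₂ := hn j'
        rw [if_neg hj'] at h₂
        omega
      · exact ⟨j, hjs, Nat.pos_of_ne_zero hj⟩
    obtain ⟨z', hz'⟩ := (moves_erase inc s j).exists_step
      (IsControlRule.erase s j hj) hz (by
      rintro C hC
      obtain rfl := Sum.inr.inj hC
      exact hpos)
    obtain ⟨h₁, h₄, h₃⟩ := step_erase hz hz'
    rw [h₀] at h₄
    have h₅ : ∑ j', controlCount (some j') z' = m := by
      have : ∑ j', (controlCount (some j') z' + if j = j' then 1 else 0) = m + 1 := by
        rw [← hm]
        exact Finset.sum_congr rfl fun j' _ => h₃ j'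
      rw [Finset.sum_add_distrib] at this
      simpa using this
    obtain ⟨rs, hrs⟩ : ∃ rs, LabelledRun (G.controlGrammar inc i).Step rs
        (some (if insert j s = Finset.univ then ∅ else insert j s), z')
        (some ∅, (X ++ Y).map Symbol.terminal) := by
      split_ifs with hu
      -- Closing the round lowers the common value by one.
      · refine ih (n - 1) ∅ (fun _ => rfl) z' h₁ h₄ (fun j' => ?_) h₅
        have hm : j' ∈ insert j s := hu ▸ Finset.mem_univ j'
        rw [Finset.mem_insert] at hm
        rw [← hn j', ← h₃ j']
        by_cases hj' : j = j'
        · subst hj'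
          simp [hj]
        · simp [hm.resolve_left (Ne.symm hj'), hj']
      · refine ih n _ (fun h => absurd h hu) z' h₁ h₄ (fun j' => ?_) h₅
        rw [← hn j', ← h₃ j']
        by_cases hj' : j = j'
        · subst hj'
          simp [hj]
        · simp [Ne.symm hj', hj']
    exact ⟨_, .cons hz' hrs⟩

end LinearGraph

theorem familyMonotone_subset_familyCS (T : Type) (s : Shape) :
    familyMonotone T s ⊆ familyCS T s := by
  rintro _ ⟨G, k, inc, i, hi, -, -, hs, rfl⟩
  refine ⟨G.controlGrammar inc i, ?_, ?_⟩
  · rintro _ (e | f | ⟨s, j, -⟩) A hA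
    · exact Shape.word_iff.mpr ⟨_, _, _, hs e, G.deleteControl_controlRhs inc e⟩
    · exact Shape.word_iff.mpr ⟨[], none, [], Atom.allows_nil s, rfl⟩
    · exact absurd hA Sum.inr_ne_inl
  have hstart : deleteControl [(Symbol.nonterminal (Sum.inl i) :
      Symbol T (G.V ⊕ Option (Fin k)))] = sentential [] (some i) [] := rfl
  have hcount : ∀ C, controlCount C
      [(Symbol.nonterminal (Sum.inl i) : Symbol T (G.V ⊕ Option (Fin k)))] = 0 := fun C => by
    simp [controlCount_eq_zero]
  ext w
  constructor
  · rintro ⟨rs, _, rfl, hr, -⟩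
    obtain ⟨es, ⟨⟨v, X, Y⟩, c⟩, hes, hf, hz, d, hd⟩ := hr.simulate
      (R := G.ControlSimulation) (fun _ _ _ _ h hs => G.controlSimulation_step inc i h hs)
      (a' := ((i, [], []), fun _ => 0)) ⟨hstart, fun j => hcount _⟩
    dsimp only at hf hz hd
    obtain ⟨-, rfl⟩ := terminal_eq_sentential
      ((deleteControl_map_terminal (V₂ := Option (Fin k)) _).symm.trans hz)
    obtain rfl : c = fun _ => d := funext fun j => by
      have := controlCount_map_terminal (V₁ := G.V) (some j) (X ++ Y)
      exact (hd j).symm.trans (by rw [if_neg (by simp), add_zero]; exact this ▸ zero_add d)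
    exact ⟨es, i, hi ▸ rfl, v, hf, X, Y, d, rfl, hes⟩
  · rintro ⟨es, i', hi', f, hf, X, Y, n, rfl, hr⟩
    rw [hi] at hi'
    obtain rfl : i' = i := hi'
    obtain ⟨rs, ⟨q, z⟩, hrs, hq, hz, h₀, hc⟩ := hr.simulate
      (step' := (G.controlGrammar inc i').Step)
      (R := fun (a : (G.V × List T × List T) × (Fin k → ℕ))
          (b : Option (Finset (Fin k)) × List (Symbol T (G.V ⊕ Option (Fin k)))) =>
        b.1 = none ∧ deleteControl b.2 = sentential a.1.2.1 (some a.1.1) a.1.2.2 ∧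
        controlCount none b.2 = 0 ∧ ∀ j, controlCount (some j) b.2 = a.2 j)
      (a' := (none, [Symbol.nonterminal (Sum.inl i')])) (by
        rintro e ⟨⟨u, X, Y⟩, c⟩ ⟨⟨v, X', Y'⟩, c'⟩ ⟨q, z⟩ ⟨⟨h₁, h₂, h₃, h₄⟩, h₅⟩ ⟨hq, hz, h₀, hc⟩
        dsimp only at h₁ h₂ h₃ h₄ h₅ hq hz h₀ hc
        subst h₁ h₂ h₃ h₄ hq
        obtain ⟨z', hz'⟩ := (LinearGraph.moves_edge inc e).exists_step
          (LinearGraph.IsControlRule.edge e) hz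
          fun C hC => absurd hC Sum.inl_ne_inr
        obtain ⟨h₁, h₂, h₃⟩ := LinearGraph.step_edge hz hz'
        exact ⟨_, (none, z'), .single hz', rfl, h₁, h₃.trans h₀,
          fun j => (h₂ j).trans ((congrArg (· + _) (hc j)).trans (h₅ j).symm)⟩)
      ⟨rfl, hstart, hcount _, fun j => hcount _⟩
    dsimp only at hq hz h₀ hc
    subst hq
    obtain ⟨z', hz'⟩ := (LinearGraph.moves_leave inc f).exists_step
      (LinearGraph.IsControlRule.leave ⟨f, hf⟩) hz
      fun C hC => absurd hC Sum.inl_ne_inr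
    obtain ⟨h₁, h₂⟩ := LinearGraph.step_leave hz hz'
    obtain ⟨rs', hrs'⟩ := G.controlGrammar_erase inc i' _ n ∅ (fun _ => rfl) z' h₁
      ((h₂ _).trans h₀) (fun j => by rw [h₂, hc]; simp) rfl
    have hall := hrs.append (.cons hz' hrs')
    exact ⟨_, some ∅, rfl, hall, G.controlGrammar_erasureRespecting inc i' hall⟩

/-! ### The circle of inclusions -/

theorem familyMonotone_eq_familyWeighted (T : Type) [Finite T] (s : Shape) :
    familyMonotone T s = familyWeighted T s :=
  ((familyMonotone_subset_familyMC T s).trans (familyMC_subset_familyWeighted T s)).antisymm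
    (familyWeighted_subset_familyMonotone T s)

theorem familyMC_eq (T : Type) [Finite T] (s : Shape) : familyMC T s = familyMonotone T s :=
  ((familyMC_subset_familyWeighted T s).trans
    (familyMonotone_eq_familyWeighted T s).ge).antisymm (familyMonotone_subset_familyMC T s)

theorem familySC_eq (T : Type) [Finite T] (s : Shape) : familySC T s = familyMonotone T s :=
  ((familySC_subset_familyWeighted T s).trans
    (familyMonotone_eq_familyWeighted T s).ge).antisymm (familyMonotone_subset_familySC T s)

theorem familyCS_eq (T : Type) [Finite T] (s : Shape) : familyCS T s = familyMonotone T s :=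
  ((familyCS_subset_familyWeighted T s).trans
    (familyMonotone_eq_familyWeighted T s).ge).antisymm (familyMonotone_subset_familyCS T s)

theorem familyNCM_eq (T : Type) [Finite T] : familyNCM T = familyMonotone T .rightLinear :=
  ((familyNCM_subset_familyWeighted T).trans
    (familyMonotone_eq_familyWeighted T _).ge).antisymm (familyMonotone_subset_familyNCM T)

theorem familyNPCM1_eq (T : Type) [Finite T] : familyNPCM1 T = familyMonotone T .linear :=
  ((familyNPCM1_subset_familyWeighted T).trans
    (familyMonotone_eq_familyWeighted T _).ge).antisymm (familyMonotone_subset_familyNPCM1 T)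

theorem mainTheorem7 (T : Type) [Finite T] :
    (familyCLGS T = familyNPCM1 T ∧ familyNPCM1 T = familyLGMC T ∧
      familyLGMC T = familyLGSC T) ∧
    (familyCRLGS T = familyNCM T ∧ familyNCM T = familyRLGMC T ∧
      familyRLGMC T = familyRLGSC T) ∧
    (familyCRLGSMirror T = familyNCM T ∧ familyRLGMCMirror T = familyNCM T) := by
  -- `Shape.Word` unfolds to the three conditions on right-hand sides, so each grammar family is
  -- definitionally an instance for one shape.
  have h₁ : familyCLGS T = _ := familyCS_eq T .linear
  have h₂ : familyCRLGS T = _ := familyCS_eq T .rightLinear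
  have h₃ : familyCRLGSMirror T = _ := familyCS_eq T .leftLinear
  have h₄ : familyLGMC T = _ := familyMC_eq T .linear
  have h₅ : familyRLGMC T = _ := familyMC_eq T .rightLinear
  have h₆ : familyRLGMCMirror T = _ := familyMC_eq T .leftLinear
  have h₇ : familyLGSC T = _ := familySC_eq T .linear
  have h₈ : familyRLGSC T = _ := familySC_eq T .rightLinear
  rw [h₁, h₂, h₃, h₄, h₅, h₆, h₇, h₈, familyNCM_eq, familyNPCM1_eq,
    familyMonotone_rightLinear_eq_leftLinear]
  exact ⟨⟨rfl, rfl, rfl⟩, ⟨rfl, rfl, rfl⟩, rfl, rfl⟩
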